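/- Let $n\ge 1$ and let $X_1,\dots,X_{n+1}$ be Hausdorff spaces, each with at least two points. Put $\mathbb X_m=\prod_{i=1}^m X_i$ with the product topology. **Measures.** A finite real valued Borel measure is Radon if its variation is finite on compact sets, inner regular with respect to compact sets and outer regular with respect to open sets, on all Borel sets. Let $\mathcal M_m(\mathbb X_m)$ (respectively $\mathfrak M_m(\mathbb X_m)$) be the space of finitely supported (respectively real valued Radon) measures $\mu$ on $\mathbb X_m$ with $\mu(\prod_{i=1}^m A_i)=0$ whenever the $A_i\subset X_i$ are sets (respectively Borel sets) and $A_i=X_i$ for at least one $i$. **Kernels.** A kernel $\mathfrak I:\mathbb X_m\times\mathbb X_m\to\mathbb R$ is PDI$_m$ if $\mathfrak I(x,y)$ does not change when, for any set of indices $i$, the coordinates $x_i$ and $y_i$ are interchanged, and $$\int\!\!\int(-1)^m\,\mathfrak I(u,v)\,d\mu(u)\,d\mu(v)\ge 0\qquad\text{for all }\mu\in\mathcal M_m(\mathbb X_m).$$ It is zero on the extended diagonal if $\mathfrak I(x,y)=0$ whenever $x_i=y_i$ for at least one $i$. A symmetric kernel $\gamma:Y\times Y\to\mathbb R$ is CND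 if $\sum_{i,j}c_ic_j\gamma(x_i,x_j)\le 0$ for all finite families of distinct points $x_i\in Y$ and real scalars $c_i$ with $\sum_i c_i=0$. **Characteristic kernels.** For a kernel $\mathfrak I$ on $\mathbb X_m$ let $\mathcal P[\mathfrak I]$ be the set of Radon probabilities $P$ on $\mathbb X_m$ such that $$\int_{\mathbb X_m}|\mathfrak I(x_F+z_{F^c},w)|\,dP_\pi(x)<\infty$$ for every partition $\pi$ of $\{1,\dots,m\}$, every $F\subset\{1,\dots,m\}$ and all $z,w\in\mathbb X_m$. Here $P_\pi=\bigtimes_{L\in\pi}P_L$ is the product of the marginals of $P$ on the blocks of $\pi$, and $x_F+z_{F^c}$ is the point whose coordinates are those of $x$ in $F$ and those of $z$ outside $F$. A PDI$_m$ kernel $\mathfrak I$ is PDI$_m$-Characteristic if, for $P,Q\in\mathcal P[\mathfrak I]$ with $P-Q\in\mathfrak M_m(\mathbb X_m)$, $$\int\!\!\int(-1)^m\,\mathfrak I(u,v)\,d[P-Q](u)\,d[P-Q](v)=0\quad\text{only when}\quad P=Q.$$ A CND kernel $\gamma$ on $Y$ is CND-Characteristic if, for every real valued Radon measure $\mu$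 on $Y$ with $\mu(Y)=0$ and $\gamma\in L^1(|\mu|\times|\mu|)$, $$\int\!\!\int-\gamma(x,y)\,d\mu(x)\,d\mu(y)=0\quad\text{only when}\quad\mu=0.$$ **Theorem.** Let $\mathfrak I:\mathbb X_n\times\mathbb X_n\to\mathbb R$ be a continuous PDI$_n$ kernel that is zero on the extended diagonal, and let $\gamma:X_{n+1}\times X_{n+1}\to\mathbb R$ be a continuous CND kernel with $\gamma(a,a)=0$ for all $a$. Then the kernel $$(\mathfrak I\times\gamma)\big((x,a),(y,b)\big)=\mathfrak I(x,y)\,\gamma(a,b)\qquad\text{on }\mathbb X_{n+1}$$ is PDI$_{n+1}$-Characteristic if and only if $\mathfrak I$ is PDI$_n$-Characteristic and $\gamma$ is CND-Characteristic. -/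

import Mathlib

open MeasureTheory
open scoped ENNReal

noncomputable section

namespace PDI

universe u

/-- The Cartesian product `X 0 × ⋯ × X (n - 1)`. It is a separate type (not reducible to the
function type) so that it can carry the Borel `σ`-algebra of the product topology, which for spaces
without a countable base may be larger than the product of the Borel `σ`-algebras. -/
def CartProd {n : ℕ} (X : Fin n → Type u) : Type u := ∀ i, X i

section Spaces

variable {n : ℕ} (X : Fin n → Type u) [∀ i, TopologicalSpace (X i)]

instance CartProd.instTopologicalSpace : TopologicalSpace (CartProd X) :=
  inferInstanceAs (TopologicalSpace (∀ i, X i))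

instance CartProd.instT2Space [∀ i, T2Space (X i)] : T2Space (CartProd X) :=
  inferInstanceAs (T2Space (∀ i, X i))

instance CartProd.instMeasurableSpace : MeasurableSpace (CartProd X) := borel _

instance CartProd.instBorelSpace : BorelSpace (CartProd X) := ⟨rfl⟩

end Spaces

/-- The box `∏ i, A i` in the Cartesian product. -/
def box {n : ℕ} {X : Fin n → Type u} (A : ∀ i, Set (X i)) : Set (CartProd X) :=
  {x | ∀ i, x i ∈ A i}

/-- The point whose coordinates in `F` are those of `x` and whose other coordinates are those
of `y`. -/
def mix {n : ℕ} {X : Fin n → Type u} (F : Finset (Fin n)) (x y : CartProd X) : CartProd X :=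
  fun i => if i ∈ F then x i else y i

/-! ### Positive definite independent kernels and conditionally negative definite kernels -/

/-- Conditionally negative definite kernel: symmetric, and `∑ cᵢ cⱼ γ(xᵢ, xⱼ) ≤ 0` for finitely many
distinct points and real scalars with `∑ cᵢ = 0`. -/
def IsCND {Y : Type u} (γ : Y → Y → ℝ) : Prop :=
  (∀ x y, γ x y = γ y x) ∧
    ∀ (s : Finset Y) (c : Y → ℝ), ∑ x ∈ s, c x = 0 →
      ∑ x ∈ s, ∑ y ∈ s, c x * c y * γ x y ≤ 0

/-- `n`-symmetry: the value of the kernel does not change when, for some set `F` of indices,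
the `i`-th coordinates of the two arguments are interchanged for all `i ∈ F`. -/
def IsNSymmetric {n : ℕ} {X : Fin n → Type u} (I : CartProd X → CartProd X → ℝ) : Prop :=
  ∀ (F : Finset (Fin n)) (x y : CartProd X), I (mix F y x) (mix F x y) = I x y

/-- The mass that the discrete measure `∑ x, μ x • δ_x` gives to the set `A`. -/
def discreteMass {Y : Type u} (μ : Y →₀ ℝ) (A : Set Y) : ℝ :=
  μ.sum fun x c => A.indicator (fun _ => c) x

/-- The discrete measures on the product that vanish on every box `∏ i, A i` for which
`A i` is the whole of `X i` for at least `n - k + 1` indices `i`. -/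
def discreteM {n : ℕ} (X : Fin n → Type u) (k : ℕ) : Set (CartProd X →₀ ℝ) :=
  {μ | ∀ A : ∀ i, Set (X i), n + 1 ≤ {i | A i = Set.univ}.ncard + k →
    discreteMass μ (box A) = 0}

/-- Positive definite independent kernel of order `n` on a product of `n` sets. -/
def IsPDI {n : ℕ} {X : Fin n → Type u} (I : CartProd X → CartProd X → ℝ) : Prop :=
  IsNSymmetric I ∧
    ∀ μ ∈ discreteM X n,
      0 ≤ μ.sum fun x a => μ.sum fun y b => (-1 : ℝ) ^ n * I x y * a * b

/-- The kernel is zero on the extended diagonal, that is, at all pairs of points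
which have at least one coordinate in common. -/
def ZeroOnExtendedDiagonal {n : ℕ} {X : Fin n → Type u}
    (I : CartProd X → CartProd X → ℝ) : Prop :=
  ∀ x y : CartProd X, (∃ i, x i = y i) → I x y = 0

/-- The Kronecker product `(I × γ)((x, a), (y, b)) = I(x, y) γ(a, b)`, a kernel on the product of
`n + 1` sets; `a` and `b` are the last coordinates. -/
def kronecker {n : ℕ} {X : Fin (n + 1) → Type u}
    (I : CartProd (fun i : Fin n => X i.castSucc) → CartProd (fun i : Fin n => X i.castSucc) → ℝ)
    (γ : X (Fin.last n) → X (Fin.last n) → ℝ) (x y : CartProd X) : ℝ :=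
  I (fun i => x i.castSucc) (fun i => y i.castSucc) * γ (x (Fin.last n)) (y (Fin.last n))

/-! ### Radon measures -/

/-- A nonnegative Radon measure: a Borel measure that is finite on compact sets, inner regular
with respect to compact sets and outer regular with respect to open sets, on all Borel sets. -/
structure IsRadon {Y : Type u} [TopologicalSpace Y] [MeasurableSpace Y] (μ : Measure Y) :
    Prop where
  finite : IsFiniteMeasureOnCompacts μ
  inner : μ.InnerRegular
  outer : μ.OuterRegular

/-- A real valued Radon measure: its variation is a Radon measure. (The variation of a
`SignedMeasure` is always finite.) -/
def IsRadonSigned {Y : Type u} [TopologicalSpace Y] [MeasurableSpace Y] (μ : SignedMeasure Y) :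
    Prop :=
  IsRadon μ.variation

/-- The double integral `∫ ∫ f(u, v) dμ(u) dμ(v)` with respect to a real valued measure `μ`. -/
def energy {Y : Type u} [MeasurableSpace Y] (f : Y → Y → ℝ) (μ : SignedMeasure Y) : ℝ :=
  ∫ᵛ v, (∫ᵛ w, f w v ∂<•μ) ∂<•μ

/-- The real valued Radon measures on the product that vanish on every box `∏ i, A i` of Borel sets
for which `A i` is the whole of `X i` for at least `n - k + 1` indices `i`. -/
def radonM {n : ℕ} (X : Fin n → Type u) [∀ i, TopologicalSpace (X i)]
    [∀ i, MeasurableSpace (X i)] (k : ℕ) : Set (SignedMeasure (CartProd X)) :=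
  {μ | IsRadonSigned μ ∧ ∀ A : ∀ i, Set (X i), (∀ i, MeasurableSet (A i)) →
    n + 1 ≤ {i | A i = Set.univ}.ncard + k → μ (box A) = 0}

/-! ### Characteristic kernels -/

/-- The CND kernel `γ` is CND-Characteristic: the semi-inner product
`(μ, ν) ↦ ∫ ∫ -γ(x, y) dμ(x) dν(y)` on the space of real valued Radon measures `μ` with `μ(Y) = 0`
and `γ ∈ L¹(|μ| × |μ|)` is an inner product. -/
def IsCNDCharacteristic {Y : Type u} [TopologicalSpace Y] [MeasurableSpace Y]
    (γ : Y → Y → ℝ) : Prop :=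
  IsCND γ ∧
    ∀ μ : SignedMeasure Y, IsRadonSigned μ →
      (∫⁻ y, ∫⁻ x, ‖γ x y‖ₑ ∂μ.variation ∂μ.variation < ∞) → μ Set.univ = 0 →
      energy (fun x y => -γ x y) μ = 0 → μ = 0

/-- The iterated integral `∫ ⋯ ∫ f(ω 0, …, ω (k - 1)) dP(ω (k - 1)) ⋯ dP(ω 0)` of a nonnegative
function of `k` variables. -/
def iterLIntegral {Ω : Type u} [MeasurableSpace Ω] (P : Measure Ω) :
    (k : ℕ) → ((Fin k → Ω) → ℝ≥0∞) → ℝ≥0∞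
  | 0, f => f Fin.elim0
  | k + 1, f => ∫⁻ ω, iterLIntegral P k (fun t => f (Fin.cons ω t)) ∂P

/-- The integral `∫ f dP_π` of a nonnegative function with respect to the product `P_π` of the
marginals `P_L`, `L ∈ π`, of a probability `P` on the product space. The partition `π` of the index
set is given by a labelling `c` of the indices: two indices are in the same block if and only if
they have the same label (every partition of `Fin n` comes from some `c : Fin n → Fin n`).
Drawing the points `ω 0, …, ω (n - 1)` independently with law `P` and using `ω j` for the
coordinates in the block with label `j`, one obtains a point with law `P_π`. -/
def lintegralPartition {n : ℕ} {X : Fin n → Type u} [∀ i, TopologicalSpace (X i)]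
    (P : Measure (CartProd X)) (c : Fin n → Fin n) (f : CartProd X → ℝ≥0∞) : ℝ≥0∞ :=
  iterLIntegral P n fun ω => f fun i => ω (c i) i

/-- The set `𝒫[I]` of the Radon probabilities `P` such that
`∫ I(x_F + z_{Fᶜ}, w) dP_π(x) < ∞` for all partitions `π` and subsets `F` of the index set and
all points `z`, `w`. -/
def admissible {n : ℕ} {X : Fin n → Type u} [∀ i, TopologicalSpace (X i)]
    (I : CartProd X → CartProd X → ℝ) : Set (ProbabilityMeasure (CartProd X)) :=
  {P | IsRadon (P : Measure (CartProd X)) ∧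
    ∀ (c : Fin n → Fin n) (F : Finset (Fin n)) (z w : CartProd X),
      lintegralPartition (P : Measure (CartProd X)) c (fun x => ‖I (mix F x z) w‖ₑ) < ∞}

/-- The difference `P - Q` of two probabilities, as a real valued measure. -/
def diff {Y : Type u} [MeasurableSpace Y] (P Q : ProbabilityMeasure Y) : SignedMeasure Y :=
  (P : Measure Y).toSignedMeasure - (Q : Measure Y).toSignedMeasure

/-- The set `𝒫ₙ[I, P]` of the `Q ∈ 𝒫[I]` such that `P - Q` vanishes on all boxes with at least one
full side. -/
def admissibleClass {n : ℕ} {X : Fin n → Type u} [∀ i, TopologicalSpace (X i)]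
    [∀ i, MeasurableSpace (X i)] (I : CartProd X → CartProd X → ℝ)
    (P : ProbabilityMeasure (CartProd X)) : Set (ProbabilityMeasure (CartProd X)) :=
  {Q | Q ∈ admissible I ∧ diff P Q ∈ radonM X n}

/-- The `PDIₙ` kernel `I` is `PDIₙ`-Characteristic: on each of the sets `𝒫ₙ[I, P]` the
semi-metric `(P, Q) ↦ (∫ ∫ (-1)ⁿ I(u, v) d[P - Q](u) d[P - Q](v))^(1/2)` is a metric. -/
def IsPDICharacteristic {n : ℕ} {X : Fin n → Type u} [∀ i, TopologicalSpace (X i)]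
    [∀ i, MeasurableSpace (X i)] (I : CartProd X → CartProd X → ℝ) : Prop :=
  IsPDI I ∧
    ∀ P ∈ admissible I, ∀ Q ∈ admissibleClass I P,
      energy (fun x y => (-1 : ℝ) ^ n * I x y) (diff P Q) = 0 → P = Q

end PDI

end

/-!
Write `J = kronecker I γ`. Three facts carry the proof.

*Energies and discrete measures.* For a `PDIₙ` kernel `I` that vanishes on the extended diagonal,
the form `(-1)ⁿ ∑ ∑ I` on the discrete measures without lower marginals is the inner product of a
feature space, and `Φ x = ⨂ i, (δ_{x i} - δ_{z i})` has squared norm `2ⁿ I x z`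
(`norm_sq_feature`). If `P` and `Q` have the same marginals on proper sets of indices, then the
energy of `P - Q` is the squared norm of `∫ Φ dP - ∫ Φ dQ`, so it vanishes if and only if `P - Q` is
orthogonal, with respect to `I`, to all the measures `⨂ i, (δ_{w i} - δ_{z i})`
(`Controlled.energy_eq_zero_iff`). The integrability this needs follows from the finiteness of
the integrals over the products of marginals, because `I x y ≤ 2ⁿ ∑ F, I (mix F x y) z`
(`IsPDI.le_sum_mix`, `MarginalsIntegrable.controlled`). The Borel `σ`-algebra of a product may be
larger than the product `σ`-algebra, so Fubini's theorem is not available. Measurability of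
integrals over one variable comes instead from the class `SumCont` of countable sums of
continuous functions, and Radon measures on products are identified by their values on boxes
(`measure_ext_of_box`).

*Characteristic factors.* Suppose that the energy of `P - Q` with respect to `J` vanishes, and let
`f(x) = ∑ F, sgn F * I x (mix F w z)`. The orthogonality relations say that the image of
`f (P - Q)` in the last factor has a constant potential with respect to `γ`. As `γ` is
CND-Characteristic, this image is zero. Hence, for every Borel set `B` of the last factor, the
measures `P(· × B)` and `Q(· × B)` satisfy the orthogonality relations for `I`
(`sum_sgn_potential_slice`). As `I` is `PDIₙ`-Characteristic, they are equal
(`kronecker_isPDICharacteristic`).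

*Characteristic product.* Energies of tensor products factorise. A pair `P`, `Q` for `I` is turned
into a pair with difference `(P - Q) ⊗ (δ_a - δ_b) / 2` (`twist`), and a pair `p`, `q` for `γ` into
a pair whose difference is a multiple of `⨂ i, (δ_{x i} - δ_{z i}) ⊗ (p - q)` (`fan`). Both stay in
the class of admissible probabilities, since one of the two factors of `J` is bounded on them.
-/

namespace PDI

open Finset Function

universe u v

/-! ### Mixed points, signs and alternating sums -/

section Mix

variable {n : ℕ} {X : Fin n → Type u}

@[simp] lemma mix_apply (F : Finset (Fin n)) (x y : CartProd X) (i : Fin n) :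
    mix F x y i = if i ∈ F then x i else y i := rfl

@[simp] lemma mix_univ (x y : CartProd X) : mix univ x y = x := by
  funext i; simp

@[simp] lemma mix_empty (x y : CartProd X) : mix ∅ x y = y := by
  funext i; simp

lemma CartProd.continuous_apply [∀ i, TopologicalSpace (X i)] (i : Fin n) :
    Continuous fun x : CartProd X => x i :=
  _root_.continuous_apply (A := X) i

lemma continuous_mix [∀ i, TopologicalSpace (X i)] (F : Finset (Fin n)) :
    Continuous fun p : CartProd X × CartProd X => mix F p.1 p.2 := by
  refine continuous_pi fun i => ?_
  by_cases h : i ∈ F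
  · simp only [mix_apply, h, if_true]
    exact (CartProd.continuous_apply i).comp continuous_fst
  · simp only [mix_apply, h, if_false]
    exact (CartProd.continuous_apply i).comp continuous_snd

/-- The sign with which the point `mix F x z` is charged by `⨂ i, (δ_{x i} - δ_{z i})`. -/
noncomputable def sgn (F : Finset (Fin n)) : ℝ := (-1) ^ (Fᶜ).card

lemma sgn_univ : sgn (univ : Finset (Fin n)) = 1 := by simp [sgn]

lemma sgn_mul_self (F : Finset (Fin n)) : sgn F * sgn F = 1 := by
  simp [sgn, ← pow_add, ← two_mul]

lemma sgn_compl (F : Finset (Fin n)) : sgn Fᶜ = (-1) ^ n * sgn F := by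
  have h : (-1 : ℝ) ^ n = (-1) ^ Fᶜ.card * (-1) ^ F.card := by
    rw [← pow_add, card_compl_add_card, Fintype.card_fin]
  have h2 : (-1 : ℝ) ^ Fᶜ.card * (-1) ^ Fᶜ.card = 1 := by simp [← pow_add, ← two_mul]
  simp only [sgn, compl_compl, h]
  linear_combination -(-1 : ℝ) ^ F.card * h2

lemma sgn_insert {F : Finset (Fin n)} {i : Fin n} (hi : i ∉ F) : sgn (insert i F) = -sgn F := by
  have : (Fᶜ).card = ((insert i F)ᶜ).card + 1 := by
    rw [compl_insert, card_erase_of_mem (by simpa using hi)]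
    have : 0 < (Fᶜ).card := card_pos.2 ⟨i, by simpa using hi⟩
    omega
  simp [sgn, this, pow_succ]

/-- An alternating sum over all sets of indices vanishes if the terms do not depend on whether a
given index belongs to the set. -/
lemma sum_sgn_smul_eq_zero {A : Type*} [AddCommGroup A] [Module ℝ A] (g : Finset (Fin n) → A)
    (i : Fin n) (hg : ∀ F, i ∉ F → g (insert i F) = g F) : ∑ F, sgn F • g F = 0 := by
  rw [← powerset_univ, ← insert_erase (mem_univ i),
    sum_powerset_insert (notMem_erase i univ), ← sum_add_distrib]
  refine sum_eq_zero fun F hF => ?_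
  have hi : i ∉ F := fun h => notMem_erase i univ (mem_powerset.1 hF h)
  rw [hg F hi, sgn_insert hi, neg_smul, add_neg_cancel]

/-- The function `h` does not depend on the `i`-th coordinate. -/
def IndepOf {A : Type v} (h : CartProd X → A) (i : Fin n) : Prop :=
  ∀ u v : CartProd X, (∀ j, j ≠ i → u j = v j) → h u = h v

lemma IndepOf.mix_erase {A : Type v} {h : CartProd X → A} {i : Fin n} (hh : IndepOf h i)
    (x z : CartProd X) : h (mix (univ.erase i) x z) = h x :=
  hh _ _ fun j hj => by simp [hj]

lemma indepOf_mix {A : Type v} (h : CartProd X → A) {F : Finset (Fin n)} {i : Fin n} (hi : i ∉ F)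
    (z : CartProd X) : IndepOf (fun x => h (mix F x z)) i := by
  intro u v huv
  refine congrArg h (funext fun j => ?_)
  by_cases hj : j ∈ F
  · simpa [hj] using huv j (by rintro rfl; exact hi hj)
  · simp [hj]

lemma IndepOf.sum_sgn_smul_eq_zero {A : Type v} [AddCommGroup A] [Module ℝ A]
    {h : CartProd X → A} {i : Fin n} (hh : IndepOf h i) (x z : CartProd X) :
    ∑ F, sgn F • h (mix F x z) = 0 :=
  PDI.sum_sgn_smul_eq_zero _ i fun F _ => hh _ _ fun j hj => by simp [mem_insert, hj]

/-- Only the term of the full index set survives in an iterated alternating sum. -/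
lemma sum_sgn_sum_sgn {A : Type v} [AddCommGroup A] [Module ℝ A] (h : CartProd X → A)
    (x y z : CartProd X) :
    ∑ F, sgn F • ∑ G, sgn G • h (mix G (mix F x y) z) = ∑ F, sgn F • h (mix F x y) := by
  simp_rw [smul_sum]
  rw [sum_comm, sum_eq_single univ]
  · simp [sgn_univ]
  · intro G _ hG
    obtain ⟨i, hi⟩ : ∃ i, i ∉ G := by
      by_contra! h'
      exact hG (eq_univ_iff_forall.2 h')
    have := (indepOf_mix h hi z).sum_sgn_smul_eq_zero x y
    simp_rw [smul_comm _ (sgn G)]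
    rw [← smul_sum, this, smul_zero]
  · simp

end Mix

/-! ### Discrete measures vanishing on the boxes with a full side -/

section Discrete

variable {n : ℕ} {X : Fin n → Type u}

lemma mem_discreteM_iff {μ : CartProd X →₀ ℝ} :
    μ ∈ discreteM X n ↔ ∀ (A : ∀ i, Set (X i)) (i : Fin n), A i = Set.univ →
      discreteMass μ (box A) = 0 := by
  refine forall_congr' fun A => ⟨fun h i hi => h ?_, fun h hA => ?_⟩
  · have : 0 < {i | A i = Set.univ}.ncard := (Set.ncard_pos (Set.toFinite _)).2 ⟨i, hi⟩
    omega
  · have : 0 < {i | A i = Set.univ}.ncard := by omega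
    obtain ⟨i, hi⟩ := (Set.ncard_pos (Set.toFinite _)).1 this
    exact h i hi

lemma discreteMass_add {Y : Type u} (μ ν : Y →₀ ℝ) (A : Set Y) :
    discreteMass (μ + ν) A = discreteMass μ A + discreteMass ν A := by
  classical
  refine Finsupp.sum_add_index' (by simp) fun x a b => ?_
  by_cases h : x ∈ A <;> simp [h]

lemma discreteMass_smul {Y : Type u} (c : ℝ) (μ : Y →₀ ℝ) (A : Set Y) :
    discreteMass (c • μ) A = c * discreteMass μ A := by
  classical
  rw [discreteMass, Finsupp.sum_smul_index (by simp), discreteMass, Finsupp.mul_sum]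
  refine Finsupp.sum_congr fun x _ => ?_
  by_cases h : x ∈ A <;> simp [h]

variable (X) in
/-- The space of the discrete measures vanishing on all boxes with at least one full side. -/
def discreteSubmodule : Submodule ℝ (CartProd X →₀ ℝ) where
  carrier := discreteM X n
  zero_mem' := fun A _ => by simp [discreteMass]
  add_mem' := fun h h' A hA => by rw [discreteMass_add, h A hA, h' A hA, add_zero]
  smul_mem' := fun c μ h A hA => by rw [discreteMass_smul, h A hA, mul_zero]

/-- A discrete measure without lower marginals annihilates the functions that do not depend on some
coordinate `i`: its image under the map that fixes the `i`-th coordinate is zero. -/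
lemma linearCombination_eq_zero {A : Type*} [AddCommGroup A] [Module ℝ A] {μ : CartProd X →₀ ℝ}
    (hμ : μ ∈ discreteM X n) {h : CartProd X → A} {i : Fin n} (hh : IndepOf h i) :
    Finsupp.linearCombination ℝ h μ = 0 := by
  classical
  rcases isEmpty_or_nonempty (CartProd X) with hX | ⟨⟨z⟩⟩
  · rw [Subsingleton.elim μ 0, map_zero]
  set r : CartProd X → CartProd X := fun x => mix (univ.erase i) x z with hr
  have h1 : h = h ∘ r := funext fun x => (hh.mix_erase x z).symm
  have h2 : Finsupp.mapDomain r μ = 0 := by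
    ext y
    by_cases hy : y i = z i
    · have := mem_discreteM_iff.1 hμ (fun j => if j = i then Set.univ else {y j}) i (by simp)
      rw [Finsupp.coe_zero, Pi.zero_apply, ← this, Finsupp.mapDomain, Finsupp.sum_apply,
        discreteMass]
      refine Finsupp.sum_congr fun x _ => ?_
      have : r x = y ↔ x ∈ box fun j => if j = i then Set.univ else {y j} := by
        constructor
        · rintro rfl j
          by_cases hj : j = i <;> simp [hj, hr]
        · intro hx
          funext j
          by_cases hj : j = i
          · subst hj; simp [hr, hy]
          · have := hx j
            simp only [hj, if_false, Set.mem_singleton_iff] at this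
            simp [hr, hj, this]
      by_cases hx : r x = y
      · rw [Set.indicator_of_mem (this.1 hx), hx, Finsupp.single_eq_same]
      · rw [Set.indicator_of_notMem (fun h' => hx (this.2 h')), Finsupp.single_eq_of_ne']
        exact hx
    · refine Finsupp.mapDomain_of_notMem_range _ _ ?_
      rintro ⟨x, rfl⟩
      exact hy (by simp [hr])
  rw [h1, ← Finsupp.linearCombination_mapDomain, h2, map_zero]

/-- The discrete measure `⨂ i, (δ_{x i} - δ_{z i})`. -/
noncomputable def rectDiff (x z : CartProd X) : CartProd X →₀ ℝ :=
  ∑ F, Finsupp.single (mix F x z) (sgn F)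

lemma linearCombination_rectDiff {A : Type*} [AddCommGroup A] [Module ℝ A] (h : CartProd X → A)
    (x z : CartProd X) :
    Finsupp.linearCombination ℝ h (rectDiff x z) = ∑ F, sgn F • h (mix F x z) := by
  simp [rectDiff, map_sum, Finsupp.linearCombination_single]

lemma discreteMass_eq_linearCombination {Y : Type u} (μ : Y →₀ ℝ) (A : Set Y) :
    discreteMass μ A = Finsupp.linearCombination ℝ (A.indicator (1 : Y → ℝ)) μ := by
  classical
  rw [discreteMass, Finsupp.linearCombination_apply]
  refine Finsupp.sum_congr fun x _ => ?_
  by_cases h : x ∈ A <;> simp [h]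

lemma indepOf_indicator_box {A : ∀ i, Set (X i)} {i : Fin n} (hi : A i = Set.univ) (c : ℝ) :
    IndepOf ((box A).indicator fun _ => c) i := by
  classical
  intro u v huv
  have : u ∈ box A ↔ v ∈ box A := forall_congr' fun j => by
    by_cases hj : j = i
    · subst hj; simp [hi]
    · rw [huv j hj]
  by_cases h : u ∈ box A
  · rw [Set.indicator_of_mem h, Set.indicator_of_mem (this.1 h)]
  · rw [Set.indicator_of_notMem h, Set.indicator_of_notMem (fun h' => h (this.2 h'))]

lemma rectDiff_mem (x z : CartProd X) : rectDiff x z ∈ discreteM X n := by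
  refine mem_discreteM_iff.2 fun A i hi => ?_
  rw [discreteMass_eq_linearCombination, linearCombination_rectDiff]
  exact (indepOf_indicator_box hi 1).sum_sgn_smul_eq_zero x z

/-- A rectangle is an alternating sum of rectangles based at a given point. -/
lemma rectDiff_eq_sum (x y z : CartProd X) :
    rectDiff x y = ∑ F, sgn F • rectDiff (mix F x y) z := by
  have := sum_sgn_sum_sgn (fun w => Finsupp.single w (1 : ℝ)) x y z
  simpa [rectDiff] using this.symm

end Discrete

/-! ### The quadratic form of a kernel on discrete measures -/

section Form

/-- The bilinear form `(μ, ν) ↦ ∑ x, ∑ y, μ x * ν y * k x y` on discrete measures. -/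
noncomputable def kernelForm {Y : Type u} (k : Y → Y → ℝ) : (Y →₀ ℝ) →ₗ[ℝ] (Y →₀ ℝ) →ₗ[ℝ] ℝ :=
  Finsupp.linearCombination ℝ fun x => Finsupp.linearCombination ℝ (k x)

lemma kernelForm_apply {Y : Type u} (k : Y → Y → ℝ) (μ ν : Y →₀ ℝ) :
    kernelForm k μ ν = ∑ x ∈ μ.support, ∑ y ∈ ν.support, μ x * ν y * k x y := by
  simp only [kernelForm, Finsupp.linearCombination_apply, Finsupp.sum, LinearMap.coe_sum,
    Finset.sum_apply, LinearMap.smul_apply, smul_eq_mul, mul_sum, mul_assoc]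

lemma kernelForm_eq_linearCombination {Y : Type u} (k : Y → Y → ℝ) (μ ν : Y →₀ ℝ) :
    kernelForm k μ ν =
      Finsupp.linearCombination ℝ (fun x => Finsupp.linearCombination ℝ (k x) ν) μ := by
  simp [kernelForm, Finsupp.linearCombination_apply, Finsupp.sum, LinearMap.coe_sum,
    Finset.sum_apply]

lemma sum_sum_eq_kernelForm {Y : Type u} (c : ℝ) (k : Y → Y → ℝ) (μ : Y →₀ ℝ) :
    (μ.sum fun x a => μ.sum fun y b => c * k x y * a * b) = c * kernelForm k μ μ := by
  rw [kernelForm_apply, mul_sum]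
  refine sum_congr rfl fun x _ => ?_
  rw [mul_sum]
  exact sum_congr rfl fun y _ => by ring

lemma kernelForm_comm {Y : Type u} {k : Y → Y → ℝ} (hk : ∀ x y, k x y = k y x) (μ ν : Y →₀ ℝ) :
    kernelForm k μ ν = kernelForm k ν μ := by
  rw [kernelForm_apply, kernelForm_apply, sum_comm]
  exact sum_congr rfl fun x _ => sum_congr rfl fun y _ => by rw [hk]; ring

/-- A positive semidefinite symmetric bilinear form is the pullback of the inner product of a
Hilbert space: complete the space with respect to the seminorm of the form. -/
lemma exists_hilbert_of_form {V : Type u} [AddCommGroup V] [Module ℝ V] (B : V →ₗ[ℝ] V →ₗ[ℝ] ℝ)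
    (hs : ∀ u v, B u v = B v u) (hp : ∀ u, 0 ≤ B u u) :
    ∃ (H : Type u) (_ : NormedAddCommGroup H) (_ : InnerProductSpace ℝ H) (_ : CompleteSpace H)
      (T : V →ₗ[ℝ] H), ∀ u v, inner ℝ (T u) (T v) = B u v := by
  let core : PreInnerProductSpace.Core ℝ V :=
    { inner := fun u v => B u v
      conj_inner_symm := fun u v => by simpa using hs v u
      re_inner_nonneg := fun u => by simpa using hp u
      add_left := fun u v w => by simp
      smul_left := fun u v r => by simp }
  let _ : SeminormedAddCommGroup V := InnerProductSpace.Core.toSeminormedAddCommGroup (𝕜 := ℝ)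
  let _ : InnerProductSpace ℝ V := .ofCore _
  exact ⟨UniformSpace.Completion V, inferInstance, inferInstance, inferInstance,
    (UniformSpace.Completion.toComplₗᵢ (𝕜 := ℝ) (E := V)).toLinearMap,
    fun u v => UniformSpace.Completion.inner_coe u v⟩

end Form

/-! ### Positive definite independent kernels that vanish on the extended diagonal -/

section Kernel

variable {n : ℕ} {X : Fin n → Type u} {I : CartProd X → CartProd X → ℝ}

lemma IsNSymmetric.comm (hI : IsNSymmetric I) (x y : CartProd X) : I x y = I y x := by
  simpa using hI univ y x

lemma IsPDI.kernelForm_nonneg (hI : IsPDI I) {μ : CartProd X →₀ ℝ} (hμ : μ ∈ discreteM X n) :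
    0 ≤ (-1 : ℝ) ^ n * kernelForm I μ μ := by
  rw [← sum_sum_eq_kernelForm]
  exact hI.2 μ hμ

lemma kernelForm_rectDiff (x y x' y' : CartProd X) :
    kernelForm I (rectDiff x y) (rectDiff x' y') =
      ∑ F, sgn F * ∑ G, sgn G * I (mix F x y) (mix G x' y') := by
  simp_rw [kernelForm_eq_linearCombination, linearCombination_rectDiff, smul_eq_mul]

/-- Since the kernel vanishes on the extended diagonal, only the pairs of opposite vertices
contribute to the energy of `⨂ i, (δ_{x i} - δ_{y i})`, and by symmetry each contributes the
same. -/
lemma kernelForm_rectDiff_self (hI : IsNSymmetric I) (h0 : ZeroOnExtendedDiagonal I)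
    (x y : CartProd X) :
    kernelForm I (rectDiff x y) (rectDiff x y) = (-1) ^ n * 2 ^ n * I x y := by
  rw [kernelForm_rectDiff]
  have key : ∀ F : Finset (Fin n),
      sgn F * ∑ G, sgn G * I (mix F x y) (mix G x y) = (-1) ^ n * I x y := by
    intro F
    rw [sum_eq_single Fᶜ]
    · have : mix Fᶜ x y = mix F y x := by
        funext i; by_cases h : i ∈ F <;> simp [h]
      rw [this, hI.comm, hI F x y, sgn_compl]
      linear_combination (-1 : ℝ) ^ n * I x y * sgn_mul_self F
    · intro G _ hG
      rw [h0, mul_zero]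
      by_contra! h
      apply hG
      ext i
      have := h i
      by_cases h1 : i ∈ F <;> by_cases h2 : i ∈ G <;> simp_all
    · simp
  rw [sum_congr rfl fun F _ => key F]
  simp only [sum_const, card_univ, Fintype.card_finset, Fintype.card_fin, nsmul_eq_mul,
    Nat.cast_pow, Nat.cast_ofNat]
  ring

/-- A feature space of the kernel: a Hilbert space that represents the form of the kernel on the
discrete measures without lower marginals. -/
lemma IsPDI.exists_feature (hI : IsPDI I) :
    ∃ (H : Type u) (_ : NormedAddCommGroup H) (_ : InnerProductSpace ℝ H) (_ : CompleteSpace H)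
      (T : discreteSubmodule X →ₗ[ℝ] H),
      ∀ μ ν, inner ℝ (T μ) (T ν) = (-1) ^ n * kernelForm I (μ : CartProd X →₀ ℝ) ν := by
  let B : discreteSubmodule X →ₗ[ℝ] discreteSubmodule X →ₗ[ℝ] ℝ :=
    ((-1 : ℝ) ^ n) • (kernelForm I).domRestrict₁₂ (discreteSubmodule X) (discreteSubmodule X)
  exact exists_hilbert_of_form (V := discreteSubmodule X) B
    (fun u v => congrArg ((-1 : ℝ) ^ n * ·) (kernelForm_comm hI.1.comm (u : CartProd X →₀ ℝ) v))
    fun u => hI.kernelForm_nonneg u.2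

/-- The measure `⨂ i, (δ_{x i} - δ_{z i})` as an element of `discreteSubmodule`. -/
noncomputable def rectDiff' (x z : CartProd X) : discreteSubmodule X :=
  ⟨rectDiff x z, rectDiff_mem x z⟩

lemma norm_sq_feature (hI : IsPDI I) (h0 : ZeroOnExtendedDiagonal I) {H : Type*}
    [NormedAddCommGroup H] [InnerProductSpace ℝ H] {T : discreteSubmodule X →ₗ[ℝ] H}
    (hT : ∀ μ ν, inner ℝ (T μ) (T ν) = (-1) ^ n * kernelForm I (μ : CartProd X →₀ ℝ) ν)
    (x y : CartProd X) : ‖T (rectDiff' x y)‖ ^ 2 = 2 ^ n * I x y := by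
  rw [← real_inner_self_eq_norm_sq, hT]
  have h : ((-1 : ℝ) ^ n) * (-1) ^ n = 1 := by simp [← pow_add, ← two_mul]
  simp only [rectDiff', kernelForm_rectDiff_self hI.1 h0]
  linear_combination 2 ^ n * I x y * h

lemma IsPDI.nonneg (hI : IsPDI I) (h0 : ZeroOnExtendedDiagonal I) (x y : CartProd X) :
    0 ≤ I x y := by
  obtain ⟨H, _, _, _, T, hT⟩ := hI.exists_feature
  have := norm_sq_feature hI h0 hT x y
  have h2 : (0 : ℝ) < 2 ^ n := by positivity
  exact nonneg_of_mul_nonneg_right (this ▸ sq_nonneg _) h2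

/-- A substitute for the triangle inequality: `I x y` is the squared norm of an alternating sum of
feature vectors based at `z`. -/
lemma IsPDI.le_sum_mix (hI : IsPDI I) (h0 : ZeroOnExtendedDiagonal I) (x y z : CartProd X) :
    I x y ≤ 2 ^ n * ∑ F, I (mix F x y) z := by
  obtain ⟨H, _, _, _, T, hT⟩ := hI.exists_feature
  have h2 : (0 : ℝ) < 2 ^ n := by positivity
  have e : T (rectDiff' x y) = ∑ F, sgn F • T (rectDiff' (mix F x y) z) := by
    simp_rw [← map_smul, ← map_sum]
    refine congrArg T (Subtype.ext ?_)
    simp [rectDiff', rectDiff_eq_sum x y z]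
  have h1 : ‖T (rectDiff' x y)‖ ≤ ∑ F, ‖T (rectDiff' (mix F x y) z)‖ := by
    rw [e]
    refine (norm_sum_le _ _).trans (le_of_eq (sum_congr rfl fun F _ => ?_))
    simp [norm_smul, sgn]
  have h3 := (pow_le_pow_left₀ (norm_nonneg _) h1 2).trans sq_sum_le_card_mul_sum_sq
  simp_rw [norm_sq_feature hI h0 hT, ← mul_sum] at h3
  simp only [card_univ, Fintype.card_finset, Fintype.card_fin, Nat.cast_pow, Nat.cast_ofNat] at h3
  exact le_of_mul_le_mul_left (by linarith) h2

end Kernel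

/-! ### The Kronecker product with a conditionally negative definite kernel -/

section CND

variable {Y : Type u} {γ : Y → Y → ℝ}

lemma IsCND.kernelForm_nonpos (hγ : IsCND γ) (ν : Y →₀ ℝ)
    (hν : Finsupp.linearCombination ℝ (fun _ => (1 : ℝ)) ν = 0) : kernelForm γ ν ν ≤ 0 := by
  rw [kernelForm_apply]
  refine hγ.2 ν.support ν ?_
  simpa [Finsupp.linearCombination_apply, Finsupp.sum] using hν

lemma IsCND.nonneg (hγ : IsCND γ) (h0 : ∀ a, γ a a = 0) (a b : Y) : 0 ≤ γ a b := by
  have := hγ.kernelForm_nonpos (Finsupp.single a 1 - Finsupp.single b 1) (by simp)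
  simp [kernelForm, h0, hγ.1 b a] at this
  linarith

/-- The kernel `γ(a, o) + γ(o, b) - γ(a, b)` is positive semidefinite: its form on `c` is minus the
form of `γ` on `c - (∑ c) δ_o`. -/
lemma IsCND.sum_nonneg (hγ : IsCND γ) (h0 : ∀ a, γ a a = 0) (o : Y) (c : Y →₀ ℝ) :
    0 ≤ kernelForm (fun a b => γ a o + γ o b - γ a b) c c := by
  set m := Finsupp.linearCombination ℝ (fun _ : Y => (1 : ℝ)) c with hm
  have := hγ.kernelForm_nonpos (c - m • Finsupp.single o 1) (by simp [hm])
  have e1 : kernelForm γ c (Finsupp.single o 1) =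
      Finsupp.linearCombination ℝ (fun a => γ a o) c := by
    rw [kernelForm_eq_linearCombination]; simp
  have e2 : kernelForm γ (Finsupp.single o 1) c =
      Finsupp.linearCombination ℝ (fun a => γ o a) c := by
    rw [kernelForm_eq_linearCombination]; simp
  have e3 : kernelForm (fun a b => γ a o + γ o b - γ a b) c c =
      Finsupp.linearCombination ℝ (fun a => γ a o) c * m +
      m * Finsupp.linearCombination ℝ (fun a => γ o a) c - kernelForm γ c c := by
    rw [kernelForm_apply, kernelForm_apply]
    simp only [hm, Finsupp.linearCombination_apply, Finsupp.sum, smul_eq_mul, mul_one]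
    rw [sum_mul_sum, sum_mul_sum, ← sum_add_distrib, ← sum_sub_distrib]
    refine sum_congr rfl fun x _ => ?_
    rw [← sum_add_distrib, ← sum_sub_distrib]
    exact sum_congr rfl fun y _ => by ring
  simp only [map_sub, map_smul, LinearMap.sub_apply, LinearMap.smul_apply, smul_eq_mul, e1, e2]
    at this
  have e4 : kernelForm γ (Finsupp.single o 1) (Finsupp.single o 1) = 0 := by
    simp [kernelForm, h0]
  rw [e4] at this
  linarith

/-- The square root of a conditionally negative definite kernel is a semimetric; in particular
the kernel satisfies this weak triangle inequality. -/
lemma IsCND.triangle (hγ : IsCND γ) (h0 : ∀ a, γ a a = 0) (a b o : Y) :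
    γ a b ≤ 2 * γ a o + 2 * γ o b := by
  have := hγ.sum_nonneg h0 o (Finsupp.single a 1 + Finsupp.single b 1)
  simp [kernelForm, h0, hγ.1 b a, hγ.1 b o, hγ.1 o a] at this
  linarith

open scoped MatrixOrder Matrix.Norms.L2Operator in
/-- On a finite set a positive semidefinite kernel is a Gram matrix. -/
lemma IsCND.exists_gram (hγ : IsCND γ) (h0 : ∀ a, γ a a = 0) (o : Y) (S : Finset Y) :
    ∃ b : S → Y → ℝ, ∀ x ∈ S, ∀ y ∈ S, γ x o + γ o y - γ x y = ∑ k, b k x * b k y := by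
  classical
  let M : Matrix S S ℝ := fun x y => γ x o + γ o y - γ x y
  have hM : M.PosSemidef := by
    refine Matrix.PosSemidef.of_dotProduct_mulVec_nonneg ?_ fun c => ?_
    · ext x y
      change γ y o + γ o x - γ y x = γ x o + γ o y - γ x y
      rw [hγ.1 y x, hγ.1 y o, hγ.1 o x]
      ring
    · have := hγ.sum_nonneg h0 o (∑ x : S, Finsupp.single (x : Y) (c x))
      simp only [map_sum, LinearMap.coe_sum, Finset.sum_apply] at this
      rw [sum_comm] at this
      simpa [kernelForm, M, dotProduct, Matrix.mulVec, mul_sum, mul_comm, mul_left_comm, mul_assoc]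
        using this
  obtain ⟨B, hB⟩ := CStarAlgebra.nonneg_iff_eq_star_mul_self.1 hM.nonneg
  refine ⟨fun k x => if h : x ∈ S then B k ⟨x, h⟩ else 0, fun x hx y hy => ?_⟩
  have := congrFun (congrFun hB ⟨x, hx⟩) ⟨y, hy⟩
  simpa [M, Matrix.mul_apply, Matrix.star_apply, hx, hy] using this

end CND

section Kronecker

variable {n : ℕ} {X : Fin (n + 1) → Type u}

/-- The point without its last coordinate. -/
def initPt (x : CartProd X) : CartProd (fun i : Fin n => X i.castSucc) := fun i => x i.castSucc

@[simp] lemma initPt_apply (x : CartProd X) (i : Fin n) : initPt x i = x i.castSucc := rfl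

/-- The point `(x, a)`. -/
def snocPt (x : CartProd (fun i : Fin n => X i.castSucc)) (a : X (Fin.last n)) : CartProd X :=
  Fin.snoc (α := X) x a

@[simp] lemma snocPt_castSucc (x : CartProd (fun i : Fin n => X i.castSucc)) (a : X (Fin.last n))
    (i : Fin n) : snocPt x a i.castSucc = x i := Fin.snoc_castSucc (α := X) ..

@[simp] lemma snocPt_last (x : CartProd (fun i : Fin n => X i.castSucc)) (a : X (Fin.last n)) :
    snocPt x a (Fin.last n) = a := Fin.snoc_last (α := X) ..

@[simp] lemma initPt_snocPt (x : CartProd (fun i : Fin n => X i.castSucc)) (a : X (Fin.last n)) :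
    initPt (snocPt x a) = x := by
  funext i; simp

@[simp] lemma snocPt_initPt (x : CartProd X) : snocPt (initPt x) (x (Fin.last n)) = x := by
  funext i
  refine Fin.lastCases ?_ (fun i => ?_) i <;> simp

variable {I : CartProd (fun i : Fin n => X i.castSucc) →
      CartProd (fun i : Fin n => X i.castSucc) → ℝ} {γ : X (Fin.last n) → X (Fin.last n) → ℝ}

lemma kronecker_apply (x y : CartProd X) :
    kronecker I γ x y = I (initPt x) (initPt y) * γ (x (Fin.last n)) (y (Fin.last n)) := rfl

/-- The indices other than the last one that belong to `F`. -/
def initFin (F : Finset (Fin (n + 1))) : Finset (Fin n) := univ.filter fun i => i.castSucc ∈ F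

lemma initPt_mix (F : Finset (Fin (n + 1))) (x y : CartProd X) :
    initPt (mix F x y) = mix (initFin F) (initPt x) (initPt y) := by
  funext i; simp [initFin]

lemma kronecker_zeroOnExtendedDiagonal (h0 : ZeroOnExtendedDiagonal I) (hγ : ∀ a, γ a a = 0) :
    ZeroOnExtendedDiagonal (kronecker I γ) := by
  rintro x y ⟨i, hi⟩
  rw [kronecker_apply]
  induction i using Fin.lastCases with
  | last => rw [hi, hγ, mul_zero]
  | cast i => rw [h0 _ _ ⟨i, hi⟩, zero_mul]

lemma kronecker_isNSymmetric (hI : IsNSymmetric I) (hγ : ∀ a b, γ a b = γ b a) :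
    IsNSymmetric (kronecker I γ) := by
  intro F x y
  rw [kronecker_apply, kronecker_apply, initPt_mix, initPt_mix,
    hI (initFin F) (initPt x) (initPt y)]
  by_cases h : Fin.last n ∈ F <;> simp [h, hγ (y _)]

/-- With `K(a, b) = γ(a, o) + γ(o, b) - γ(a, b)`, the energies of `I × γ` and of `-(I × K)` agree
on measures with vanishing marginals, and `K` is a sum of squares on finite sets. -/
lemma kronecker_isPDI (hI : IsPDI I) (hγ : IsCND γ) (h0 : ∀ a, γ a a = 0) :
    IsPDI (kronecker I γ) := by
  classical
  refine ⟨kronecker_isNSymmetric hI.1 hγ.1, fun μ hμ => ?_⟩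
  rcases isEmpty_or_nonempty (CartProd X) with hX | ⟨⟨z⟩⟩
  · rw [Subsingleton.elim μ 0]; simp
  rw [sum_sum_eq_kernelForm]
  set o := z (Fin.last n)
  have hr : ∀ x : CartProd X, Finsupp.linearCombination ℝ
      (fun y : CartProd X => I (initPt x) (initPt y) * γ (x (Fin.last n)) o) μ = 0 := by
    refine fun x => linearCombination_eq_zero hμ (i := Fin.last n) fun u v huv => ?_
    have : initPt u = initPt v := funext fun j => huv _ j.castSucc_ne_last
    rw [this]
  have hl : ∀ y : CartProd X, Finsupp.linearCombination ℝ
      (fun x : CartProd X => I (initPt x) (initPt y) * γ o (y (Fin.last n))) μ = 0 := by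
    refine fun x => linearCombination_eq_zero hμ (i := Fin.last n) fun u v huv => ?_
    have : initPt u = initPt v := funext fun j => huv _ j.castSucc_ne_last
    rw [this]
  -- The form of `I × K` at `μ` is the sum over `k` of the energies of the measures
  -- `ν k = ∑ x, μ x * b k (x last) • δ_{initPt x}`, which have no lower marginals either.
  obtain ⟨b, hb⟩ := hγ.exists_gram h0 o (μ.support.image fun x => x (Fin.last n))
  let ν : (μ.support.image fun x => x (Fin.last n)) →
      CartProd (fun i : Fin n => X i.castSucc) →₀ ℝ := fun k =>
    Finsupp.linearCombination ℝ
      (fun x => Finsupp.single (initPt x) (b k (x (Fin.last n)))) μ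
  have hν : ∀ k, ν k ∈ discreteM (fun i : Fin n => X i.castSucc) n := by
    intro k
    refine mem_discreteM_iff.2 fun A i hi => ?_
    rw [discreteMass_eq_linearCombination]
    have : Finsupp.linearCombination ℝ ((box A).indicator 1) (ν k) =
        Finsupp.linearCombination ℝ
          (fun x => b k (x (Fin.last n)) * (box A).indicator (fun _ => 1) (initPt x)) μ := by
      simp only [ν]
      rw [Finsupp.linearCombination_apply (R := ℝ) (l := μ), Finsupp.sum, map_sum,
        Finsupp.linearCombination_apply, Finsupp.sum]
      refine sum_congr rfl fun x _ => ?_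
      rw [map_smul, Finsupp.linearCombination_single]
      rfl
    rw [this]
    refine linearCombination_eq_zero hμ (i := i.castSucc) fun u v huv => ?_
    rw [huv _ (Fin.castSucc_ne_last i).symm,
      indepOf_indicator_box hi (1 : ℝ) (initPt u) (initPt v) fun j hj => huv _ (by simpa using hj)]
  have key : kernelForm (kronecker I γ) μ μ = -∑ k, kernelForm I (ν k) (ν k) := by
    have e1 : ∀ k, kernelForm I (ν k) (ν k) = ∑ x ∈ μ.support, ∑ y ∈ μ.support,
        μ x * μ y * (I (initPt x) (initPt y) * (b k (x (Fin.last n)) * b k (y (Fin.last n)))) := by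
      intro k
      simp only [ν, Finsupp.linearCombination_apply, Finsupp.sum, map_sum, map_smul,
        LinearMap.coe_sum, Finset.sum_apply, LinearMap.smul_apply]
      refine sum_congr rfl fun x _ => ?_
      rw [smul_sum]
      refine sum_congr rfl fun y _ => ?_
      simp [kernelForm, hI.1.comm (initPt y)]
      ring
    have e2 : ∑ x ∈ μ.support, ∑ y ∈ μ.support,
        μ x * μ y * (I (initPt x) (initPt y) * γ (x (Fin.last n)) o) = 0 := by
      refine sum_eq_zero fun x _ => ?_
      have := hr x
      rw [Finsupp.linearCombination_apply, Finsupp.sum] at this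
      simp_rw [mul_assoc (μ x), ← mul_sum]
      simp only [smul_eq_mul] at this
      rw [this, mul_zero]
    have e3 : ∑ x ∈ μ.support, ∑ y ∈ μ.support,
        μ x * μ y * (I (initPt x) (initPt y) * γ o (y (Fin.last n))) = 0 := by
      rw [sum_comm]
      refine sum_eq_zero fun x _ => ?_
      have := hl x
      rw [Finsupp.linearCombination_apply, Finsupp.sum] at this
      simp_rw [mul_comm _ (μ x), mul_assoc (μ x), ← mul_sum]
      simp only [smul_eq_mul] at this
      rw [this, mul_zero]
    simp_rw [e1]
    rw [sum_comm]
    simp_rw [sum_comm (s := univ)]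
    have e4 : ∀ x ∈ μ.support, ∀ y ∈ μ.support, ∑ k, μ x * μ y *
        (I (initPt x) (initPt y) * (b k (x (Fin.last n)) * b k (y (Fin.last n)))) =
        μ x * μ y * (I (initPt x) (initPt y) * γ (x (Fin.last n)) o) +
        μ x * μ y * (I (initPt x) (initPt y) * γ o (y (Fin.last n))) -
        μ x * μ y * kronecker I γ x y := by
      intro x hx y hy
      rw [← mul_sum, ← mul_sum, ← hb _ (mem_image_of_mem _ hx) _ (mem_image_of_mem _ hy),
        kronecker_apply]
      ring
    rw [sum_congr rfl fun x hx => sum_congr rfl fun y hy => e4 x hx y hy]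
    simp_rw [sum_sub_distrib, sum_add_distrib]
    rw [e2, e3, kernelForm_apply]
    ring
  rw [key, pow_succ]
  have : 0 ≤ ∑ k, (-1 : ℝ) ^ n * kernelForm I (ν k) (ν k) :=
    Finset.sum_nonneg fun k _ => hI.kernelForm_nonneg (hν k)
  rw [← mul_sum] at this
  linarith

end Kronecker

/-! ### Finite Radon measures -/

section Radon

open scoped NNReal

variable {Y : Type u} [TopologicalSpace Y] [MeasurableSpace Y] [BorelSpace Y]

lemma isRadon_of_innerRegular [T2Space Y] (μ : Measure Y) [IsFiniteMeasure μ] [μ.InnerRegular] :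
    IsRadon μ :=
  ⟨inferInstance, inferInstance, inferInstance⟩

/-- A finite inner regular measure is, on each measurable set, concentrated on a `σ`-compact
subset. -/
lemma exists_sigmaCompact [T2Space Y] (μ : Measure Y) [IsFiniteMeasure μ] [μ.InnerRegular]
    {U : Set Y}    (hU : MeasurableSet U) :
    ∃ K : ℕ → Set Y, (∀ n, IsCompact (K n)) ∧ (∀ n, K n ⊆ U) ∧ μ (U \ ⋃ n, K n) = 0 := by
  have h : ∀ n : ℕ, ∃ K ⊆ U, IsCompact K ∧ μ (U \ K) < ((n : ℝ≥0∞) + 1)⁻¹ := by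
    intro n
    obtain ⟨K, h1, h2, h3⟩ := hU.exists_isCompact_sdiff_lt (μ := μ) (measure_ne_top μ U)
      (ε := ((n : ℝ≥0∞) + 1)⁻¹) (by simp)
    exact ⟨K, h1, h2, h3⟩
  choose K hKU hK hμK using h
  refine ⟨K, hK, hKU, ?_⟩
  refine le_antisymm (le_of_forall_gt fun ε hε => ?_) zero_le
  obtain ⟨n, hn⟩ := ENNReal.exists_inv_nat_lt hε.ne'
  calc μ (U \ ⋃ n, K n) ≤ μ (U \ K n) :=
        measure_mono (Set.sdiff_subset_sdiff_right (Set.subset_iUnion K n))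
    _ < _ := hμK n
    _ ≤ (n : ℝ≥0∞)⁻¹ := ENNReal.inv_le_inv.2 le_self_add
    _ < ε := hn

/-- A measure that is absolutely continuous with respect to a finite inner regular measure is inner
regular, because both are concentrated on the same `σ`-compact subsets. -/
lemma innerRegular_of_absolutelyContinuous [T2Space Y] {μ ν : Measure Y} [IsFiniteMeasure μ]
    [μ.InnerRegular]    (h : ν ≪ μ) : ν.InnerRegular := by
  refine ⟨fun U hU r hr => ?_⟩
  obtain ⟨K, hK, hKU, hμ⟩ := exists_sigmaCompact μ hU
  have h1 : ν U ≤ ν (⋃ n, K n) := by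
    calc ν U ≤ ν ((⋃ n, K n) ∪ U \ ⋃ n, K n) := measure_mono (by simp)
      _ ≤ ν (⋃ n, K n) + ν (U \ ⋃ n, K n) := measure_union_le _ _
      _ = ν (⋃ n, K n) := by rw [h hμ, add_zero]
  rw [measure_iUnion_eq_iSup_accumulate] at h1
  obtain ⟨n, hn⟩ := lt_iSup_iff.1 (hr.trans_le h1)
  refine ⟨Set.accumulate K n, ?_, ?_, hn⟩
  · exact Set.iUnion₂_subset fun i _ => hKU i
  · exact (Set.finite_Iic n).isCompact_biUnion fun i _ => hK i

end Radon

/-! ### Countable sums of continuous functions and their integrals -/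

section SumCont

open scoped NNReal

/-- Countable sums of continuous nonnegative functions. Unlike joint Borel measurability on
products, this property passes to integrals over one of the variables with respect to a Radon
measure. -/
def SumCont {Z : Type u} [TopologicalSpace Z] (f : Z → ℝ≥0∞) : Prop :=
  ∃ g : ℕ → Z → ℝ≥0, (∀ k, Continuous (g k)) ∧ ∀ z, f z = ∑' k, (g k z : ℝ≥0∞)

variable {Z : Type u} [TopologicalSpace Z]

lemma SumCont.measurable [MeasurableSpace Z] [OpensMeasurableSpace Z] {f : Z → ℝ≥0∞}
    (hf : SumCont f) : Measurable f := by
  obtain ⟨g, hg, h⟩ := hf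
  rw [funext h]
  exact Measurable.tsum fun k => (hg k).measurable.coe_nnreal_ennreal

lemma SumCont.comp {W : Type v} [TopologicalSpace W] {f : Z → ℝ≥0∞} (hf : SumCont f) {φ : W → Z}
    (hφ : Continuous φ) : SumCont fun x => f (φ x) := by
  obtain ⟨g, hg, h⟩ := hf
  exact ⟨fun k => g k ∘ φ, fun k => (hg k).comp hφ, fun x => h _⟩

lemma sumCont_of_continuous {g : Z → ℝ≥0} (hg : Continuous g) :
    SumCont fun z => (g z : ℝ≥0∞) := by
  refine ⟨fun k => if k = 0 then g else 0, fun k => ?_, fun z => ?_⟩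
  · by_cases h : k = 0
    · simpa [h] using hg
    · simp only [h, if_false]
      exact continuous_const
  · rw [tsum_eq_single 0 fun k hk => by simp [hk]]
    simp

lemma sumCont_enorm {g : Z → ℝ} (hg : Continuous g) : SumCont fun z => ‖g z‖ₑ :=
  sumCont_of_continuous (g := fun z => ‖g z‖₊) hg.nnnorm

variable {Y : Type v} [TopologicalSpace Y] [MeasurableSpace Y] [BorelSpace Y] [T2Space Y]

omit [T2Space Y] [BorelSpace Y] in
lemma continuous_setLIntegral_of_subset_compact (P : Measure Y) [IsFiniteMeasure P] {K D : Set Y}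
    (hK : IsCompact K) (hD : MeasurableSet D) (hDK : D ⊆ K) {g : Z × Y → ℝ≥0}
    (hg : Continuous g) :
    (∀ z, ∫⁻ y in D, g (z, y) ∂P ≠ ∞) ∧ Continuous fun z => ∫⁻ y in D, g (z, y) ∂P := by
  have hloc : ∀ z₀ : Z, ∀ ε > 0, ∀ᶠ z in nhds z₀, ∀ y ∈ K, dist (g (z, y)) (g (z₀, y)) < ε := by
    intro z₀ ε hε
    obtain ⟨v, hv, h⟩ := hK.mem_uniformity_of_prod (f := fun z y => g (z, y)) (s := Set.univ)
      (q := z₀) (u := {p | dist p.1 p.2 < ε}) hg.continuousOn (Set.mem_univ _)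
      (Metric.dist_mem_uniformity hε)
    rw [nhdsWithin_univ] at hv
    filter_upwards [hv] with z hz y hy using h z hz y hy
  have hfin : ∀ z, ∫⁻ y in D, g (z, y) ∂P ≠ ∞ := by
    intro z
    obtain ⟨C, hC⟩ := (hK.image (hg.comp (Continuous.prodMk_right z))).bddAbove
    refine ne_top_of_le_ne_top ?_ (setLIntegral_mono_ae' (g := fun _ => (C : ℝ≥0∞)) hD
      (Filter.Eventually.of_forall fun y hy => ?_))
    · simp [ENNReal.mul_eq_top]
    · exact ENNReal.coe_le_coe.2 (hC ⟨y, hDK hy, rfl⟩)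
  refine ⟨hfin, continuous_iff_continuousAt.2 fun z₀ => ?_⟩
  rw [ContinuousAt, ENNReal.tendsto_nhds (hfin z₀)]
  intro ε hε
  obtain ⟨δ, hδ, hδε⟩ : ∃ δ : ℝ≥0, 0 < δ ∧ δ * P D ≤ ε := by
    rcases eq_or_ne (P D) 0 with h | h
    · exact ⟨1, one_pos, by simp [h]⟩
    obtain ⟨δ, h1, h2⟩ := ENNReal.exists_nnreal_pos_mul_lt (measure_ne_top P D) hε.ne'
    exact ⟨δ, h1, h2.le⟩
  have key : ∀ z z', (∀ y ∈ K, dist (g (z, y)) (g (z', y)) < δ) →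
      ∫⁻ y in D, g (z, y) ∂P ≤ ∫⁻ y in D, g (z', y) ∂P + ε := by
    intro z z' h
    calc ∫⁻ y in D, g (z, y) ∂P ≤ ∫⁻ y in D, (g (z', y) + δ : ℝ≥0∞) ∂P := by
          refine setLIntegral_mono_ae' hD (Filter.Eventually.of_forall fun y hy => ?_)
          have := h y (hDK hy)
          rw [NNReal.dist_eq] at this
          have h3 : g (z, y) ≤ g (z', y) + δ := by
            rw [← NNReal.coe_le_coe, NNReal.coe_add]
            linarith [le_abs_self ((g (z, y) : ℝ) - g (z', y))]
          exact_mod_cast h3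
      _ = ∫⁻ y in D, g (z', y) ∂P + δ * P D := by
          rw [lintegral_add_right _ measurable_const]; simp
      _ ≤ _ := by gcongr
  filter_upwards [hloc z₀ δ hδ] with z hz
  refine ⟨?_, key _ _ hz⟩
  rw [tsub_le_iff_right]
  exact key _ _ fun y hy => by rw [dist_comm]; exact hz y hy

/-- Integrate over the pieces of a `σ`-compact set that carries the measure: over each piece the
integral of a continuous function depends continuously on the parameter. -/
lemma SumCont.lintegral (P : Measure Y) [IsFiniteMeasure P] [P.InnerRegular] {f : Z × Y → ℝ≥0∞}
    (hf : SumCont f) : SumCont fun z => ∫⁻ y, f (z, y) ∂P := by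
  obtain ⟨g, hg, h⟩ := hf
  obtain ⟨K, hK, -, hPK⟩ := exists_sigmaCompact P MeasurableSet.univ
  have hm : ∀ n, MeasurableSet (disjointed K n) :=
    fun n => MeasurableSet.disjointed (fun i => (hK i).measurableSet) n
  have hc := fun (n k : ℕ) => continuous_setLIntegral_of_subset_compact P (hK n) (hm n)
    (disjointed_subset K n) (hg k)
  refine ⟨fun m z => (∫⁻ y in disjointed K m.unpair.1, g m.unpair.2 (z, y) ∂P).toNNReal,
    fun m => ?_, fun z => ?_⟩
  · refine continuous_iff_continuousAt.2 fun z => ?_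
    exact (ENNReal.tendsto_toNNReal ((hc _ _).1 z)).comp (hc _ _).2.continuousAt
  · simp_rw [ENNReal.coe_toNNReal ((hc _ _).1 z), h]
    have hgm : ∀ k, Measurable fun y => (g k (z, y) : ℝ≥0∞) := fun k =>
      ((hg k).comp (Continuous.prodMk_right z)).measurable.coe_nnreal_ennreal
    have e1 : P = P.restrict (⋃ n, disjointed K n) := by
      rw [iUnion_disjointed, Measure.restrict_eq_self_of_ae_mem]
      rw [ae_iff]
      convert! hPK using 2
      ext; simp
    conv_lhs => rw [e1]
    rw [lintegral_iUnion hm (disjoint_disjointed K), ← Nat.pairEquiv.tsum_eq fun m => ∫⁻ y in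
      disjointed K m.unpair.1, (g m.unpair.2 (z, y) : ℝ≥0∞) ∂P, ENNReal.tsum_prod']
    refine tsum_congr fun n => ?_
    rw [lintegral_tsum fun k => (hgm k).aemeasurable]
    have : ∀ k, (Nat.pairEquiv (n, k)).unpair = (n, k) := fun k => Nat.unpair_pair n k
    simp only [this]

end SumCont

/-! ### Iterated integrals -/

section IterLIntegral

variable {Ω : Type u} [MeasurableSpace Ω]

/-- It suffices to compare the integrands where all variables lie in a set of full measure. -/
lemma iterLIntegral_mono_ae (P : Measure Ω) {S : Set Ω} (hS : ∀ᵐ ω ∂P, ω ∈ S) {k : ℕ}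
    {f g : (Fin k → Ω) → ℝ≥0∞} (h : ∀ t, (∀ j, t j ∈ S) → f t ≤ g t) :
    iterLIntegral P k f ≤ iterLIntegral P k g := by
  induction k with
  | zero => exact h _ fun j => j.elim0
  | succ k ih =>
    refine lintegral_mono_ae ?_
    filter_upwards [hS] with ω hω
    exact ih fun t ht => h _ fun j => Fin.cases hω ht j

lemma iterLIntegral_const_mul (P : Measure Ω) {k : ℕ} {c : ℝ≥0∞} (hc : c ≠ ∞)
    (f : (Fin k → Ω) → ℝ≥0∞) :
    iterLIntegral P k (fun t => c * f t) = c * iterLIntegral P k f := by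
  induction k with
  | zero => rfl
  | succ k ih =>
    simp only [iterLIntegral, ih]
    exact lintegral_const_mul' _ _ hc

lemma iterLIntegral_mono_measure {P Q : Measure Ω} {c : ℝ≥0∞} (hc : c ≠ ∞) (h : P ≤ c • Q) {k : ℕ}
    (f : (Fin k → Ω) → ℝ≥0∞) : iterLIntegral P k f ≤ c ^ k * iterLIntegral Q k f := by
  induction k with
  | zero => simp [iterLIntegral]
  | succ k ih =>
    calc ∫⁻ ω, iterLIntegral P k (fun t => f (Fin.cons ω t)) ∂P
        ≤ ∫⁻ ω, c ^ k * iterLIntegral Q k (fun t => f (Fin.cons ω t)) ∂(c • Q) :=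
          lintegral_mono' h fun ω => ih _
      _ = c ^ (k + 1) * iterLIntegral Q (k + 1) f := by
          rw [lintegral_smul_measure, lintegral_const_mul' _ _ (ENNReal.pow_ne_top hc), pow_succ',
            mul_assoc]
          rfl

lemma iterLIntegral_const (P : Measure Ω) [IsProbabilityMeasure P] (k : ℕ) (c : ℝ≥0∞) :
    iterLIntegral P k (fun _ => c) = c := by
  induction k with
  | zero => rfl
  | succ k ih => simp [iterLIntegral, ih]

lemma iterLIntegral_apply (P : Measure Ω) [IsProbabilityMeasure P] {k : ℕ} (j : Fin k)
    (f : Ω → ℝ≥0∞) : iterLIntegral P k (fun t => f (t j)) = ∫⁻ ω, f ω ∂P := by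
  induction k with
  | zero => exact j.elim0
  | succ k ih =>
    induction j using Fin.cases with
    | zero => simp [iterLIntegral, iterLIntegral_const]
    | succ j => simp [iterLIntegral, ih]

lemma iterLIntegral_apply₂ (P : Measure Ω) [IsProbabilityMeasure P] {k : ℕ} {i j : Fin k}
    (hij : i < j) (f : Ω → Ω → ℝ≥0∞) :
    iterLIntegral P k (fun t => f (t i) (t j)) = ∫⁻ x, ∫⁻ y, f x y ∂P ∂P := by
  induction k with
  | zero => exact i.elim0
  | succ k ih =>
    induction j using Fin.cases with
    | zero => simp at hij
    | succ j =>
      induction i using Fin.cases with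
      | zero => simp [iterLIntegral, iterLIntegral_apply P j]
      | succ i => simp [iterLIntegral, ih (Fin.succ_lt_succ_iff.1 hij)]

/-- A variable on which the integrand does not depend may be dropped. -/
lemma iterLIntegral_succAbove (P : Measure Ω) [IsProbabilityMeasure P] {k : ℕ} (j : Fin (k + 1))
    (f : (Fin k → Ω) → ℝ≥0∞) :
    iterLIntegral P (k + 1) (fun t => f fun i => t (j.succAbove i)) = iterLIntegral P k f := by
  induction k with
  | zero =>
    have : ∀ ω : Ω, f (fun i => Fin.cons (α := fun _ => Ω) ω Fin.elim0 (j.succAbove i)) =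
        f Fin.elim0 := fun ω => congrArg f (Subsingleton.elim _ _)
    simp [iterLIntegral, this]
  | succ k ih =>
    induction j using Fin.cases with
    | zero =>
      simp [iterLIntegral]
    | succ j =>
      rw [iterLIntegral]
      conv_rhs => rw [iterLIntegral]
      refine lintegral_congr fun ω => ?_
      rw [← ih j]
      congr 1
      funext t
      congr 1
      funext i
      induction i using Fin.cases with
      | zero => simp
      | succ i => simp

variable [TopologicalSpace Ω] [BorelSpace Ω] [T2Space Ω]

omit [MeasurableSpace Ω] [BorelSpace Ω] [T2Space Ω] in
lemma continuous_finCons {k : ℕ} :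
    Continuous fun p : Ω × (Fin k → Ω) => (Fin.cons p.1 p.2 : Fin (k + 1) → Ω) :=
  Continuous.finCons (A := fun _ => Ω) continuous_fst continuous_snd

lemma SumCont.iterLIntegral {Z : Type u} [TopologicalSpace Z] (P : Measure Ω) [IsFiniteMeasure P]
    [P.InnerRegular] {k : ℕ} {f : Z × (Fin k → Ω) → ℝ≥0∞} (hf : SumCont f) :
    SumCont fun z => iterLIntegral P k fun t => f (z, t) := by
  induction k generalizing Z with
  | zero => exact hf.comp (Continuous.prodMk_left _)
  | succ k ih =>
    have hc : Continuous fun p : (Z × Ω) × (Fin k → Ω) =>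
        (p.1.1, (Fin.cons p.1.2 p.2 : Fin (k + 1) → Ω)) :=
      (continuous_fst.comp continuous_fst).prodMk
        (continuous_finCons.comp ((continuous_snd.comp continuous_fst).prodMk continuous_snd))
    exact (ih (hf.comp hc)).lintegral P

omit [MeasurableSpace Ω] [BorelSpace Ω] [T2Space Ω] in
lemma SumCont.cons {k : ℕ} {f : (Fin (k + 1) → Ω) → ℝ≥0∞} (hf : SumCont f) :
    SumCont fun p : Ω × (Fin k → Ω) => f (Fin.cons p.1 p.2) :=
  hf.comp continuous_finCons

omit [MeasurableSpace Ω] [BorelSpace Ω] [T2Space Ω] in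
lemma SumCont.cons_left {k : ℕ} {f : (Fin (k + 1) → Ω) → ℝ≥0∞} (hf : SumCont f) (ω : Ω) :
    SumCont fun t : Fin k → Ω => f (Fin.cons ω t) :=
  hf.cons.comp (Continuous.prodMk_right ω)

/-- Iterated integrals of functions that depend on the `j`-th variable only through `r j` are
determined by the images of the measure under the maps `r j`. -/
lemma iterLIntegral_congr_map {P Q : Measure Ω} [IsFiniteMeasure P] [IsFiniteMeasure Q]
    [Q.InnerRegular] {k : ℕ} {r : Fin k → Ω → Ω} (hr : ∀ j, Continuous (r j))
    (h : ∀ j, P.map (r j) = Q.map (r j)) {f : (Fin k → Ω) → ℝ≥0∞} (hf : SumCont f) :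
    iterLIntegral P k (fun t => f fun j => r j (t j)) =
      iterLIntegral Q k (fun t => f fun j => r j (t j)) := by
  induction k with
  | zero => rfl
  | succ k ih =>
    have e : ∀ (ω : Ω) (t : Fin k → Ω),
        (fun j => r j (Fin.cons (α := fun _ => Ω) ω t j)) =
          Fin.cons (α := fun _ => Ω) (r 0 ω) fun j => r j.succ (t j) := by
      intro ω t
      funext j
      induction j using Fin.cases <;> simp
    have hG : SumCont fun y => iterLIntegral Q k fun t =>
        f (Fin.cons (α := fun _ => Ω) y fun j => r j.succ (t j)) := by
      refine SumCont.iterLIntegral Q (f := fun p : Ω × (Fin k → Ω) =>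
        f (Fin.cons (α := fun _ => Ω) p.1 fun j => r j.succ (p.2 j))) ?_
      refine hf.cons.comp (φ := fun p : Ω × (Fin k → Ω) => (p.1, fun j => r j.succ (p.2 j))) ?_
      exact continuous_fst.prodMk (continuous_pi fun j =>
        (hr _).comp ((continuous_apply j).comp continuous_snd))
    simp only [iterLIntegral, e]
    calc ∫⁻ ω, iterLIntegral P k (fun t => f (Fin.cons (r 0 ω) fun j => r j.succ (t j))) ∂P
        = ∫⁻ ω, iterLIntegral Q k (fun t => f (Fin.cons (r 0 ω) fun j => r j.succ (t j))) ∂P :=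
          lintegral_congr fun ω => ih (fun j => hr _) (fun j => h _) (hf.cons_left (r 0 ω))
      _ = ∫⁻ ω, iterLIntegral Q k (fun t => f (Fin.cons ω fun j => r j.succ (t j)))
            ∂(P.map (r 0)) := (lintegral_map hG.measurable (hr 0).measurable).symm
      _ = _ := by rw [h 0, lintegral_map hG.measurable (hr 0).measurable]

omit [T2Space Ω] in
lemma iterLIntegral_map {Ω' : Type u} [MeasurableSpace Ω'] [TopologicalSpace Ω'] [BorelSpace Ω']
    [T2Space Ω'] (P : Measure Ω) [IsFiniteMeasure P] [P.InnerRegular] {φ : Ω → Ω'}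
    (hφ : Continuous φ) {k : ℕ} {f : (Fin k → Ω') → ℝ≥0∞} (hf : SumCont f) :
    iterLIntegral (P.map φ) k f = iterLIntegral P k fun t => f fun j => φ (t j) := by
  induction k with
  | zero => exact congrArg f (Subsingleton.elim _ _)
  | succ k ih =>
    have := Measure.InnerRegular.map_of_continuous (μ := P) hφ
    have hG := SumCont.iterLIntegral (P.map φ) hf.cons
    have e : ∀ (ω : Ω) (t : Fin k → Ω), (fun j => φ (Fin.cons (α := fun _ => Ω) ω t j)) =
        Fin.cons (α := fun _ => Ω') (φ ω) fun j => φ (t j) := by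
      intro ω t
      funext j
      induction j using Fin.cases <;> simp
    simp only [iterLIntegral, e]
    rw [lintegral_map hG.measurable hφ.measurable]
    exact lintegral_congr fun ω => ih (hf.cons_left (φ ω))

end IterLIntegral

/-! ### Radon measures on products and their marginals -/

section Marginals

variable {n : ℕ} {X : Fin n → Type u} [∀ i, TopologicalSpace (X i)]

lemma measurable_apply [∀ i, MeasurableSpace (X i)] [∀ i, BorelSpace (X i)] (i : Fin n) :
    Measurable fun x : CartProd X => x i :=
  (CartProd.continuous_apply i).measurable

lemma measurableSet_box [∀ i, MeasurableSpace (X i)] [∀ i, BorelSpace (X i)] {A : ∀ i, Set (X i)}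
    (hA : ∀ i, MeasurableSet (A i)) : MeasurableSet (box A) := by
  have : box A = ⋂ i, (fun x : CartProd X => x i) ⁻¹' A i := by ext; simp [box]
  rw [this]
  exact MeasurableSet.iInter fun i => measurable_apply i (hA i)

variable [∀ i, MeasurableSpace (X i)] [∀ i, BorelSpace (X i)]

/-- Inner regularity bridges the gap between the product of the Borel `σ`-algebras and the Borel
`σ`-algebra of the product: a compact subset of an open set is contained in a finite union of
open boxes inside that set. -/
lemma measure_ext_of_box {P Q : Measure (CartProd X)} [IsFiniteMeasure P]
    [IsFiniteMeasure Q] [P.InnerRegular] [Q.InnerRegular]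
    (h : ∀ A : ∀ i, Set (X i), (∀ i, MeasurableSet (A i)) → P (box A) = Q (box A)) : P = Q := by
  let e : CartProd X → ∀ i, X i := fun x => x
  have he : Measurable e := measurable_pi_iff.2 fun i => measurable_apply i
  have huniv : P Set.univ = Q Set.univ := by
    have : (Set.univ : Set (CartProd X)) = box fun _ => Set.univ := by ext; simp [box]
    rw [this]
    exact h _ fun _ => MeasurableSet.univ
  have h1 : P.map e = Q.map e := by
    refine ext_of_generate_finite _ generateFrom_pi.symm isPiSystem_pi ?_ ?_
    · rintro _ ⟨A, hA, rfl⟩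
      have hA' : ∀ i, MeasurableSet (A i) := fun i => hA i (Set.mem_univ i)
      have hm : MeasurableSet (Set.pi Set.univ A) := MeasurableSet.univ_pi hA'
      have hb : e ⁻¹' Set.pi Set.univ A = box A := by
        ext
        simp only [Set.mem_preimage, Set.mem_univ_pi]
        rfl
      rw [Measure.map_apply he hm, Measure.map_apply he hm, hb, h A hA']
    · rw [Measure.map_apply he MeasurableSet.univ, Measure.map_apply he MeasurableSet.univ]
      exact huniv
  have h2 : ∀ (R S : Measure (CartProd X)) [R.InnerRegular], R.map e = S.map e →
      ∀ U : Set (CartProd X), IsOpen U → R U ≤ S U := by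
    intro R S _ hRS U hU
    rw [hU.measurableSet.measure_eq_iSup_isCompact]
    refine iSup₂_le fun K hKU => iSup_le fun hK => ?_
    have hloc : ∀ x ∈ U, ∃ A : ∀ i, Set (X i), (∀ i, IsOpen (A i)) ∧ x ∈ box A ∧ box A ⊆ U := by
      intro x hx
      obtain ⟨F, A, hA, hAU⟩ := isOpen_pi_iff.1 hU x hx
      classical
      refine ⟨fun i => if i ∈ F then A i else Set.univ, fun i => ?_, fun i => ?_, ?_⟩
      · by_cases hi : i ∈ F
        · simpa [hi] using (hA i hi).1
        · simp [hi]
      · by_cases hi : i ∈ F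
        · simpa [hi] using (hA i hi).2
        · simp [hi]
      · intro y hy
        refine hAU fun i hi => ?_
        have := hy i
        simpa [Finset.mem_coe.1 hi] using this
    choose! A hAo hxA hAU using hloc
    have hbo : ∀ x ∈ K, IsOpen (box (A x)) := by
      intro x hx
      have : box (A x) = ⋂ i, (fun y : CartProd X => y i) ⁻¹' A x i := by ext; simp [box]
      rw [this]
      exact isOpen_iInter_of_finite fun i =>
        (hAo x (hKU hx) i).preimage (CartProd.continuous_apply i)
    obtain ⟨t, hKt⟩ := hK.elim_nhds_subcover' (fun x _ => box (A x))
      fun x hx => (hbo x hx).mem_nhds (hxA x (hKU hx))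
    have hW : MeasurableSet (⋃ x ∈ t, Set.pi Set.univ (A x)) :=
      t.measurableSet_biUnion fun x _ =>
        MeasurableSet.univ_pi fun i => (hAo x (hKU x.2) i).measurableSet
    have hWe : e ⁻¹' (⋃ x ∈ t, Set.pi Set.univ (A x)) = ⋃ x ∈ t, box (A x) := by
      ext
      simp only [Set.mem_preimage, Set.mem_iUnion, Set.mem_univ_pi]
      rfl
    calc R K ≤ R (⋃ x ∈ t, box (A x)) := measure_mono hKt
      _ = S (⋃ x ∈ t, box (A x)) := by
        rw [← hWe, ← Measure.map_apply he hW, ← Measure.map_apply he hW, hRS]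
      _ ≤ S U := measure_mono (Set.iUnion₂_subset fun x _ => hAU x (hKU x.2))
  refine ext_of_generate_finite _ (BorelSpace.measurable_eq (α := CartProd X)) isPiSystem_isOpen
    (fun U hU => le_antisymm (h2 P Q h1 U hU) (h2 Q P h1.symm U hU)) huniv

/-- The measures agree on all boxes with at least one full side, that is, they have the same
marginals on proper sets of indices. -/
def SameMarginals (P Q : Measure (CartProd X)) : Prop :=
  ∀ A : ∀ i, Set (X i), (∀ i, MeasurableSet (A i)) → ∀ i, A i = Set.univ → P (box A) = Q (box A)

omit [∀ i, BorelSpace (X i)] in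
lemma SameMarginals.symm {P Q : Measure (CartProd X)} (h : SameMarginals P Q) :
    SameMarginals Q P := fun A hA i hi => (h A hA i hi).symm

/-- The marginals on a proper set of indices `F` agree; the coordinates outside `F` are filled with
those of `z`. -/
lemma SameMarginals.map_mix {P Q : Measure (CartProd X)} [IsFiniteMeasure P]
    [IsFiniteMeasure Q] [P.InnerRegular] [Q.InnerRegular] (h : SameMarginals P Q)
    {F : Finset (Fin n)} {i : Fin n} (hi : i ∉ F) (z : CartProd X) :
    P.map (fun x => mix F x z) = Q.map fun x => mix F x z := by
  classical
  have hc : Continuous fun x : CartProd X => mix F x z :=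
    (continuous_mix F).comp (Continuous.prodMk_left z)
  have := Measure.InnerRegular.map_of_continuous (μ := P) hc
  have := Measure.InnerRegular.map_of_continuous (μ := Q) hc
  refine measure_ext_of_box fun A hA => ?_
  rw [Measure.map_apply hc.measurable (measurableSet_box hA),
    Measure.map_apply hc.measurable (measurableSet_box hA)]
  by_cases hz : ∀ j, j ∉ F → z j ∈ A j
  · have : (fun x : CartProd X => mix F x z) ⁻¹' box A =
        box fun j => if j ∈ F then A j else Set.univ := by
      ext x
      simp only [box, Set.mem_preimage, Set.mem_ofPred_eq, mix_apply]
      refine forall_congr' fun j => ?_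
      by_cases hj : j ∈ F
      · simp [hj]
      · simp [hj, hz j hj]
    rw [this]
    refine h _ (fun j => ?_) i (by simp [hi])
    by_cases hj : j ∈ F
    · simpa [hj] using hA j
    · simp [hj]
  · push Not at hz
    obtain ⟨j, hj, hzj⟩ := hz
    have : (fun x : CartProd X => mix F x z) ⁻¹' box A = ∅ := by
      refine Set.eq_empty_iff_forall_notMem.2 fun x hx => hzj ?_
      simpa [hj] using hx j
    rw [this, measure_empty, measure_empty]

lemma SameMarginals.integral_eq {P Q : Measure (CartProd X)} [IsFiniteMeasure P]
    [IsFiniteMeasure Q] [P.InnerRegular] [Q.InnerRegular] (h : SameMarginals P Q)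
    {f : CartProd X → ℝ} (hf : Measurable f) {i : Fin n} (hi : IndepOf f i) :
    ∫ x, f x ∂P = ∫ x, f x ∂Q := by
  rcases isEmpty_or_nonempty (CartProd X) with hX | ⟨⟨z⟩⟩
  · rw [Measure.eq_zero_of_isEmpty P, Measure.eq_zero_of_isEmpty Q]
  have hc : Continuous fun x : CartProd X => mix (univ.erase i) x z :=
    (continuous_mix _).comp (Continuous.prodMk_left z)
  have key : ∀ ν : Measure (CartProd X),
      ∫ x, f x ∂ν = ∫ x, f x ∂(ν.map fun x => mix (univ.erase i) x z) := by
    intro ν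
    rw [integral_map hc.aemeasurable hf.aestronglyMeasurable]
    simp_rw [hi.mix_erase]
  rw [key P, key Q, h.map_mix (notMem_erase i univ)]

end Marginals

/-! ### Integrability with respect to the products of marginals -/

section Admissible

variable {n : ℕ} {X : Fin n → Type u} [∀ i, TopologicalSpace (X i)]
  {I : CartProd X → CartProd X → ℝ}

/-- The integrability condition in the definition of `admissible`. -/
def MarginalsIntegrable (I : CartProd X → CartProd X → ℝ) (P : Measure (CartProd X)) : Prop :=
  ∀ (c : Fin n → Fin n) (F : Finset (Fin n)) (z w : CartProd X),
    lintegralPartition P c (fun x => ‖I (mix F x z) w‖ₑ) < ∞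

lemma sumCont_kernel_mix (hI : Continuous (uncurry I)) {Z : Type u} [TopologicalSpace Z]
    {φ ψ : Z → CartProd X} (hφ : Continuous φ) (hψ : Continuous ψ) :
    SumCont fun p => ‖I (φ p) (ψ p)‖ₑ :=
  sumCont_enorm (hI.comp (hφ.prodMk hψ))

lemma MarginalsIntegrable.mono {P Q : Measure (CartProd X)} (hQ : MarginalsIntegrable I Q)
    {c : ℝ≥0∞} (hc : c ≠ ∞) (h : P ≤ c • Q) : MarginalsIntegrable I P := fun b F z w =>
  (iterLIntegral_mono_measure hc h _).trans_lt
    (ENNReal.mul_lt_top (ENNReal.pow_lt_top hc.lt_top) (hQ b F z w))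

lemma MarginalsIntegrable.lintegral_lt_top {P : Measure (CartProd X)} [IsProbabilityMeasure P]
    (hP : MarginalsIntegrable I P) (hn : 0 < n) (F : Finset (Fin n)) (z w : CartProd X) :
    ∫⁻ x, ‖I (mix F x z) w‖ₑ ∂P < ∞ := by
  have := hP (fun _ => ⟨0, hn⟩) F z w
  rwa [lintegralPartition, iterLIntegral_apply P ⟨0, hn⟩ fun x => ‖I (mix F x z) w‖ₑ] at this

/-- Integrability with respect to the partition into `F` and its complement. -/
lemma MarginalsIntegrable.lintegral_mix_lt_top {P : Measure (CartProd X)} [IsProbabilityMeasure P]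
    (hP : MarginalsIntegrable I P) (hn : 0 < n) (F G : Finset (Fin n)) (z w : CartProd X) :
    ∫⁻ y, ∫⁻ x, ‖I (mix F x (mix G y z)) w‖ₑ ∂P ∂P < ∞ := by
  by_cases hF : F = univ
  · simpa [hF] using hP.lintegral_lt_top hn univ z w
  by_cases hF' : F = ∅
  · simpa [hF'] using hP.lintegral_lt_top hn G z w
  obtain ⟨i, hi⟩ := nonempty_iff_ne_empty.2 hF'
  obtain ⟨j, hj⟩ : ∃ j, j ∉ F := by
    by_contra! h
    exact hF (eq_univ_iff_forall.2 h)
  have hij : i ≠ j := fun h => hj (h ▸ hi)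
  obtain ⟨k, l, hkl⟩ : ∃ k l : Fin n, k < l := by
    rcases lt_or_gt_of_ne hij with h | h
    exacts [⟨i, j, h⟩, ⟨j, i, h⟩]
  have := hP (fun i => if i ∈ F then l else k) (F ∪ G) z w
  have e : ∀ t : Fin n → CartProd X, mix (F ∪ G) (fun i => t (if i ∈ F then l else k) i) z =
      mix F (t l) (mix G (t k) z) := by
    intro t
    funext m
    change (if m ∈ F ∪ G then t (if m ∈ F then l else k) m else z m) = _
    by_cases h1 : m ∈ F <;> by_cases h2 : m ∈ G <;> simp [h1, h2]
  simp only [lintegralPartition, e] at this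
  rwa [iterLIntegral_apply₂ P hkl fun y x => ‖I (mix F x (mix G y z)) w‖ₑ] at this

variable [∀ i, MeasurableSpace (X i)] [∀ i, BorelSpace (X i)] [∀ i, T2Space (X i)]

/-- The average of two measures. -/
noncomputable def avg {Y : Type u} [MeasurableSpace Y] (P Q : Measure Y) : Measure Y :=
  (2⁻¹ : ℝ≥0∞) • (P + Q)

instance {Y : Type u} [MeasurableSpace Y] (P Q : Measure Y) [IsProbabilityMeasure P]
    [IsProbabilityMeasure Q] : IsProbabilityMeasure (avg P Q) := by
  refine ⟨?_⟩
  simp only [avg, Measure.smul_apply, Measure.add_apply, measure_univ, smul_eq_mul]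
  rw [one_add_one_eq_two, ENNReal.inv_mul_cancel] <;> simp

instance {Y : Type u} [TopologicalSpace Y] [MeasurableSpace Y] (P Q : Measure Y) [P.InnerRegular]
    [Q.InnerRegular] : (avg P Q).InnerRegular := Measure.InnerRegular.smul _

lemma le_avg_left {Y : Type u} [MeasurableSpace Y] (P Q : Measure Y) :
    P ≤ (2 : ℝ≥0∞) • avg P Q := by
  rw [avg, smul_smul, ENNReal.mul_inv_cancel (by simp) (by simp), one_smul]
  exact Measure.le_add_right le_rfl

lemma le_avg_right {Y : Type u} [MeasurableSpace Y] (P Q : Measure Y) :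
    Q ≤ (2 : ℝ≥0∞) • avg P Q := by
  rw [avg, smul_smul, ENNReal.mul_inv_cancel (by simp) (by simp), one_smul]
  exact Measure.le_add_left le_rfl

/-- Passing to the average does not change the products of marginals for partitions with at least
two blocks, since the marginals on proper sets of indices agree. -/
lemma MarginalsIntegrable.avg {P Q : Measure (CartProd X)} [IsProbabilityMeasure P]
    [IsProbabilityMeasure Q] [P.InnerRegular] [Q.InnerRegular] (hI : Continuous (uncurry I))
    (hPQ : SameMarginals P Q) (hP : MarginalsIntegrable I P) (hQ : MarginalsIntegrable I Q) :
    MarginalsIntegrable I (avg P Q) := by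
  intro c F z w
  by_cases hc : ∃ j, ∀ i, c i = j
  · obtain ⟨j, hj⟩ := hc
    have h1 := hP c F z w
    have h2 := hQ c F z w
    simp only [lintegralPartition, hj] at h1 h2 ⊢
    rw [iterLIntegral_apply _ j fun x => ‖I (mix F x z) w‖ₑ] at h1 h2 ⊢
    rw [PDI.avg, lintegral_smul_measure, lintegral_add_measure]
    exact ENNReal.mul_lt_top (by simp) (ENNReal.add_lt_top.2 ⟨h1, h2⟩)
  · push Not at hc
    have hsame : SameMarginals P (PDI.avg P Q) := by
      intro A hA i hi
      rw [PDI.avg, Measure.smul_apply, Measure.add_apply, ← hPQ A hA i hi, ← two_mul, smul_eq_mul,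
        ← mul_assoc, ENNReal.inv_mul_cancel (by simp) (by simp), one_mul]
    have h1 := hP c F z w
    set r : Fin n → CartProd X → CartProd X := fun j x => mix (univ.filter fun i => c i = j) x z
    have hr : ∀ j, Continuous (r j) := fun j =>
      (continuous_mix _).comp (Continuous.prodMk_left z)
    have hev : Continuous fun ω : Fin n → CartProd X => (fun i => ω (c i) i : CartProd X) :=
      continuous_pi fun i => (CartProd.continuous_apply i).comp (continuous_apply (c i))
    have hf : SumCont fun ω : Fin n → CartProd X =>
        ‖I (mix F (fun i => ω (c i) i) z) w‖ₑ :=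
      sumCont_kernel_mix hI ((continuous_mix F).comp (hev.prodMk continuous_const))
        continuous_const
    have key := iterLIntegral_congr_map (P := P) (Q := PDI.avg P Q) hr (fun j => by
      obtain ⟨i, hi⟩ := hc j
      exact hsame.map_mix (i := i) (by simpa using hi) z) hf
    simp only [r, mix_apply, mem_filter_univ, if_true] at key
    rw [lintegralPartition] at h1 ⊢
    rwa [← key]

omit [∀ i, BorelSpace (X i)] [∀ i, MeasurableSpace (X i)] in
/-- A substitute for `∫∫ |I| dP dP < ∞`: bound the kernel by its values at the mixed points. -/
lemma MarginalsIntegrable.lintegral_lintegral_lt_top {P : Measure (CartProd X)}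
    [IsProbabilityMeasure P] [P.InnerRegular] (hP : MarginalsIntegrable I P) (hn : 0 < n)
    (hI : Continuous (uncurry I)) (hpdi : IsPDI I) (h0 : ZeroOnExtendedDiagonal I)
    (G : Finset (Fin n)) (z : CartProd X) :
    ∫⁻ y, ∫⁻ x, ‖I x (mix G y z)‖ₑ ∂P ∂P < ∞ := by
  have hmix : ∀ F, Continuous fun p : CartProd X × CartProd X => mix F p.2 (mix G p.1 z) :=
    fun F => (continuous_mix F).comp (continuous_snd.prodMk
      ((continuous_mix G).comp (continuous_fst.prodMk continuous_const)))
  have hs : ∀ F, SumCont fun p : CartProd X × CartProd X => ‖I (mix F p.2 (mix G p.1 z)) z‖ₑ :=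
    fun F => sumCont_kernel_mix hI (hmix F) continuous_const
  have hle : ∀ y x, ‖I x (mix G y z)‖ₑ ≤ 2 ^ n * ∑ F, ‖I (mix F x (mix G y z)) z‖ₑ := by
    intro y x
    have := hpdi.le_sum_mix h0 x (mix G y z) z
    simp_rw [Real.enorm_of_nonneg (hpdi.nonneg h0 _ _)]
    rw [← ENNReal.ofReal_sum_of_nonneg fun F _ => hpdi.nonneg h0 _ _]
    refine (ENNReal.ofReal_le_ofReal this).trans (le_of_eq ?_)
    rw [ENNReal.ofReal_mul (by positivity), ENNReal.ofReal_pow (by norm_num)]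
    simp
  calc ∫⁻ y, ∫⁻ x, ‖I x (mix G y z)‖ₑ ∂P ∂P
      ≤ ∫⁻ y, ∫⁻ x, 2 ^ n * ∑ F, ‖I (mix F x (mix G y z)) z‖ₑ ∂P ∂P :=
        lintegral_mono fun y => lintegral_mono fun x => hle y x
    _ = 2 ^ n * ∑ F, ∫⁻ y, ∫⁻ x, ‖I (mix F x (mix G y z)) z‖ₑ ∂P ∂P := by
        rw [← lintegral_finsetSum _ fun F _ => ((hs F).lintegral P).measurable,
          ← lintegral_const_mul' _ _ (by finiteness)]
        refine lintegral_congr fun y => ?_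
        rw [← lintegral_finsetSum _ fun F _ => ((hs F).comp (Continuous.prodMk_right y)).measurable,
          ← lintegral_const_mul' _ _ (by finiteness)]
    _ < ∞ := ENNReal.mul_lt_top (by finiteness)
        (ENNReal.sum_lt_top.2 fun F _ => hP.lintegral_mix_lt_top hn F G z z)

end Admissible

/-! ### Energies of differences of measures -/

section Energy

lemma integrable_variation_sub {Y : Type u} [MeasurableSpace Y] {P Q : Measure Y}
    [IsFiniteMeasure P] [IsFiniteMeasure Q] {f : Y → ℝ} (hf : Integrable f (P + Q)) :
    VectorMeasure.Integrable P.toSignedMeasure f ∧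
      VectorMeasure.Integrable Q.toSignedMeasure f := by
  simp only [VectorMeasure.Integrable, Measure.variation_toSignedMeasure]
  exact ⟨hf.left_of_add_measure, hf.right_of_add_measure⟩

lemma vectorIntegral_sub {Y : Type u} [MeasurableSpace Y] {P Q : Measure Y} [IsFiniteMeasure P]
    [IsFiniteMeasure Q] {f : Y → ℝ} (hf : Integrable f (P + Q)) :
    ∫ᵛ x, f x ∂<•(P.toSignedMeasure - Q.toSignedMeasure) = ∫ x, f x ∂P - ∫ x, f x ∂Q := by
  rw [VectorMeasure.integral_sub_vectorMeasure (integrable_variation_sub hf).1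
    (integrable_variation_sub hf).2, VectorMeasure.integral_toSignedMeasure,
    VectorMeasure.integral_toSignedMeasure]

/-- The potential `y ↦ ∫ k(x, y) d(P - Q)(x)`. -/
noncomputable def potential {Y : Type u} [MeasurableSpace Y] (k : Y → Y → ℝ) (P Q : Measure Y)
    (y : Y) : ℝ := ∫ x, k x y ∂P - ∫ x, k x y ∂Q

lemma energy_sub {Y : Type u} [MeasurableSpace Y] {P Q : Measure Y} [IsFiniteMeasure P]
    [IsFiniteMeasure Q] {k : Y → Y → ℝ} (c : ℝ) (h1 : ∀ y, Integrable (fun x => k x y) (P + Q))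
    (h2 : Integrable (potential k P Q) (P + Q)) :
    energy (fun x y => c * k x y) (P.toSignedMeasure - Q.toSignedMeasure) =
      c * (∫ y, potential k P Q y ∂P - ∫ y, potential k P Q y ∂Q) := by
  have e : ∀ y, ∫ᵛ x, c * k x y ∂<•(P.toSignedMeasure - Q.toSignedMeasure) =
      c * potential k P Q y := by
    intro y
    rw [vectorIntegral_sub ((h1 y).const_mul c), integral_const_mul, integral_const_mul, potential,
      mul_sub]
  simp only [energy, e]
  rw [vectorIntegral_sub (h2.const_mul c), integral_const_mul, integral_const_mul, mul_sub]

end Energy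

section Feature

variable {Y : Type u} [TopologicalSpace Y] {H : Type v} [NormedAddCommGroup H]
  [InnerProductSpace ℝ H]

/-- A map into an inner product space is continuous if its Gram kernel is. -/
lemma continuous_of_continuous_inner {Φ : Y → H}
    (h : Continuous fun p : Y × Y => inner ℝ (Φ p.1) (Φ p.2)) : Continuous Φ := by
  refine continuous_iff_continuousAt.2 fun x => tendsto_iff_norm_sub_tendsto_zero.2 ?_
  have e : ∀ y, ‖Φ y - Φ x‖ = √(inner ℝ (Φ y) (Φ y) - 2 * inner ℝ (Φ y) (Φ x) +
      inner ℝ (Φ x) (Φ x)) := by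
    intro y
    rw [real_inner_self_eq_norm_sq, real_inner_self_eq_norm_sq, ← norm_sub_sq_real,
      Real.sqrt_sq (norm_nonneg _)]
  have hc : Continuous fun y => √(inner ℝ (Φ y) (Φ y) - 2 * inner ℝ (Φ y) (Φ x) +
      inner ℝ (Φ x) (Φ x)) := by
    have h1 : Continuous fun y => inner ℝ (Φ y) (Φ y) := h.comp (continuous_id.prodMk continuous_id)
    have h2 : Continuous fun y => inner ℝ (Φ y) (Φ x) := h.comp (Continuous.prodMk_left x)
    fun_prop
  have := hc.tendsto x
  simp_rw [← e] at this
  simpa using this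

omit [InnerProductSpace ℝ H] in
/-- The target need not be separable, but the measure is concentrated on a `σ`-compact set, whose
image is separable. -/
lemma aestronglyMeasurable_of_continuous [MeasurableSpace Y] [BorelSpace Y] [T2Space Y]
    {P : Measure Y} [IsFiniteMeasure P] [P.InnerRegular] {Φ : Y → H} (h : Continuous Φ) :
    AEStronglyMeasurable Φ P := by
  borelize H
  obtain ⟨K, hK, -, hPK⟩ := exists_sigmaCompact P MeasurableSet.univ
  refine aestronglyMeasurable_iff_aemeasurable_separable.2 ⟨h.measurable.aemeasurable,
    ⋃ n, Φ '' K n, ?_, ?_⟩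
  · exact TopologicalSpace.IsSeparable.iUnion fun n => ((hK n).image h).isSeparable
  · rw [ae_iff]
    refine measure_mono_null (t := Set.univ \ ⋃ n, K n) ?_ hPK
    refine fun x hx => ⟨Set.mem_univ _, fun hx' => hx ?_⟩
    obtain ⟨n, hn⟩ := Set.mem_iUnion.1 hx'
    exact Set.mem_iUnion.2 ⟨n, x, hn, rfl⟩

/-- Measurability in the parameter, for a kernel that need not be measurable for the product of the
Borel `σ`-algebras. -/
lemma measurable_integral_kernel [T2Space Y] [MeasurableSpace Y] [BorelSpace Y] {k : Y → Y → ℝ}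
    (hk : Continuous (uncurry k)) (h0 : ∀ x y, 0 ≤ k x y) (P : Measure Y) [IsFiniteMeasure P]
    [P.InnerRegular] : Measurable fun y => ∫ x, k x y ∂P := by
  have hs : SumCont fun p : Y × Y => ‖k p.2 p.1‖ₑ :=
    sumCont_enorm (hk.comp (continuous_snd.prodMk continuous_fst))
  have e : (fun y => ∫ x, k x y ∂P) = fun y => (∫⁻ x, ‖k x y‖ₑ ∂P).toReal := by
    funext y
    rw [← integral_norm_eq_lintegral_enorm]
    · simp_rw [Real.norm_of_nonneg (h0 _ _)]
    · exact (hk.comp (Continuous.prodMk_left y)).aestronglyMeasurable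
  rw [e]
  exact (hs.lintegral P).measurable.ennreal_toReal

end Feature

section Controlled

variable {n : ℕ} {X : Fin n → Type u} [∀ i, TopologicalSpace (X i)]
  {I : CartProd X → CartProd X → ℝ}

/-- The integrability needed to compute the energy of `P - Q` and to expand it in mixed points. -/
structure Controlled (I : CartProd X → CartProd X → ℝ) (P Q : Measure (CartProd X)) : Prop where
  integrable : ∀ (F : Finset (Fin n)) (z w : CartProd X),
    Integrable (fun x => I (mix F x z) w) (P + Q)
  measurable : Measurable (potential I P Q)
  integrable_potential : ∀ (G : Finset (Fin n)) (z : CartProd X),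
    Integrable (fun y => potential I P Q (mix G y z)) (P + Q)

section

variable [∀ i, T2Space (X i)]

/-- Integrability with respect to the products of the marginals of `M` controls all measures
dominated by `M`. -/
lemma MarginalsIntegrable.controlled {M P Q : Measure (CartProd X)} [IsProbabilityMeasure M]
    [M.InnerRegular] [IsFiniteMeasure P] [IsFiniteMeasure Q] [P.InnerRegular] [Q.InnerRegular]
    (hM : MarginalsIntegrable I M) (hn : 0 < n) (hI : Continuous (uncurry I)) (hpdi : IsPDI I)
    (h0 : ZeroOnExtendedDiagonal I) {c : ℝ≥0∞} (hc : c ≠ ∞) (hP : P ≤ c • M) (hQ : Q ≤ c • M) :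
    Controlled I P Q := by
  have hnn := hpdi.nonneg h0
  have hle : P + Q ≤ (c + c) • M := by
    rw [add_smul]
    exact add_le_add hP hQ
  have hcc : c + c ≠ ∞ := by finiteness
  have hint : ∀ (F : Finset (Fin n)) (z w : CartProd X),
      Integrable (fun x => I (mix F x z) w) (P + Q) := by
    intro F z w
    refine Integrable.mono_measure (Integrable.smul_measure ⟨?_, ?_⟩ hcc) hle
    · exact (hI.comp (((continuous_mix F).comp (Continuous.prodMk_left z)).prodMk
        continuous_const)).aestronglyMeasurable
    · exact hM.lintegral_lt_top hn F z w
  have hpot : ∀ (ν : Measure (CartProd X)) [IsFiniteMeasure ν] [ν.InnerRegular], ν ≤ c • M →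
      ∀ (G : Finset (Fin n)) (z : CartProd X),
        Integrable (fun y => ∫ x, I x (mix G y z) ∂ν) (P + Q) := by
    intro ν _ _ hν G z
    refine Integrable.mono_measure (Integrable.smul_measure ⟨?_, ?_⟩ hcc) hle
    · exact ((measurable_integral_kernel hI hnn ν).comp ((continuous_mix G).comp
        (Continuous.prodMk_left z)).measurable).aestronglyMeasurable
    · calc ∫⁻ y, ‖∫ x, I x (mix G y z) ∂ν‖ₑ ∂M ≤ ∫⁻ y, ∫⁻ x, ‖I x (mix G y z)‖ₑ ∂ν ∂M :=
            lintegral_mono fun y => enorm_integral_le_lintegral_enorm _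
        _ ≤ ∫⁻ y, c * ∫⁻ x, ‖I x (mix G y z)‖ₑ ∂M ∂M := by
            refine lintegral_mono fun y => ?_
            rw [← smul_eq_mul, ← lintegral_smul_measure]
            exact lintegral_mono' hν le_rfl
        _ = c * ∫⁻ y, ∫⁻ x, ‖I x (mix G y z)‖ₑ ∂M ∂M := lintegral_const_mul' _ _ hc
        _ < ∞ := ENNReal.mul_lt_top hc.lt_top (hM.lintegral_lintegral_lt_top hn hI hpdi h0 G z)
  exact ⟨hint, (measurable_integral_kernel hI hnn P).sub (measurable_integral_kernel hI hnn Q),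
    fun G z => (hpot P hP G z).sub (hpot Q hQ G z)⟩

end

lemma Controlled.energy_eq {P Q : Measure (CartProd X)} [IsFiniteMeasure P] [IsFiniteMeasure Q]
    (h : Controlled I P Q) :
    energy (fun x y => (-1 : ℝ) ^ n * I x y) (P.toSignedMeasure - Q.toSignedMeasure) =
      (-1) ^ n * (∫ y, potential I P Q y ∂P - ∫ y, potential I P Q y ∂Q) := by
  refine energy_sub _ (fun w => ?_) ?_
  · simpa using h.integrable univ w w
  · rcases isEmpty_or_nonempty (CartProd X) with hX | ⟨⟨z⟩⟩
    · rw [Measure.eq_zero_of_isEmpty (P + Q)]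
      exact integrable_zero_measure
    · simpa using h.integrable_potential univ z

variable [∀ i, MeasurableSpace (X i)] [∀ i, BorelSpace (X i)]

/-- In the alternating sum over mixed points only the full index set contributes to the integral
against `P - Q`, because the other terms do not depend on some coordinate. -/
lemma Controlled.integral_alternating_potential {P Q : Measure (CartProd X)} [IsFiniteMeasure P]
    [IsFiniteMeasure Q] [P.InnerRegular] [Q.InnerRegular] (h : Controlled I P Q)
    (hPQ : SameMarginals P Q) (z : CartProd X) :
    ∫ y, ∑ G, sgn G * potential I P Q (mix G y z) ∂P -
      ∫ y, ∑ G, sgn G * potential I P Q (mix G y z) ∂Q =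
      ∫ y, potential I P Q y ∂P - ∫ y, potential I P Q y ∂Q := by
  have hi := fun G : Finset (Fin n) => (h.integrable_potential G z).const_mul (sgn G)
  rw [integral_finsetSum _ fun G _ => (hi G).left_of_add_measure,
    integral_finsetSum _ fun G _ => (hi G).right_of_add_measure, ← sum_sub_distrib,
    sum_eq_single univ]
  · simp [sgn_univ]
  · intro G _ hG
    obtain ⟨i, hi⟩ : ∃ i, i ∉ G := by
      by_contra! h'
      exact hG (eq_univ_iff_forall.2 h')
    have hm : Measurable fun y => potential I P Q (mix G y z) :=
      h.measurable.comp ((continuous_mix G).comp (Continuous.prodMk_left z)).measurable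
    rw [integral_const_mul, integral_const_mul, hPQ.integral_eq hm (indepOf_mix _ hi z), sub_self]
  · simp

variable [∀ i, T2Space (X i)]

/-- The energy of `P - Q` vanishes if and only if `P - Q` is orthogonal to all the discrete measures
`⨂ i, (δ_{w i} - δ_{z i})`: the energy is the squared norm of the difference of the mean embeddings
of `P` and `Q` in the feature space, and the images of these discrete measures are the feature
vectors. -/
lemma Controlled.energy_eq_zero_iff {P Q : Measure (CartProd X)} [IsFiniteMeasure P]
    [IsFiniteMeasure Q] [P.InnerRegular] [Q.InnerRegular] (h : Controlled I P Q)
    (hPQ : SameMarginals P Q) (hI : Continuous (uncurry I)) (hpdi : IsPDI I)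
    (h0 : ZeroOnExtendedDiagonal I) (z : CartProd X) :
    energy (fun x y => (-1 : ℝ) ^ n * I x y) (P.toSignedMeasure - Q.toSignedMeasure) = 0 ↔
      ∀ w, ∑ G, sgn G * potential I P Q (mix G w z) = 0 := by
  have hsq : ((-1 : ℝ) ^ n) * (-1) ^ n = 1 := by simp [← pow_add, ← two_mul]
  rw [h.energy_eq, ← h.integral_alternating_potential hPQ z]
  constructor
  swap
  · intro hw
    simp [hw]
  intro hE
  obtain ⟨H, _, _, _, T, hT⟩ := hpdi.exists_feature
  set Φ : CartProd X → H := fun x => T (rectDiff' x z) with hΦ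
  have hinner : ∀ y x, inner ℝ (Φ y) (Φ x) =
      (-1) ^ n * ∑ F, sgn F * ∑ G, sgn G * I (mix G x z) (mix F y z) := by
    intro y x
    rw [hΦ, hT, rectDiff', rectDiff', kernelForm_rectDiff]
    simp_rw [hpdi.1.comm (mix _ x z)]
  have hΦc : Continuous Φ := by
    refine continuous_of_continuous_inner ?_
    simp_rw [hinner]
    have : ∀ F G : Finset (Fin n), Continuous fun p : CartProd X × CartProd X =>
        I (mix G p.2 z) (mix F p.1 z) := fun F G =>
      hI.comp (((continuous_mix G).comp (continuous_snd.prodMk continuous_const)).prodMk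
        ((continuous_mix F).comp (continuous_fst.prodMk continuous_const)))
    exact continuous_const.mul (continuous_finsetSum _ fun F _ => continuous_const.mul
      (continuous_finsetSum _ fun G _ => continuous_const.mul (this F G)))
  -- `‖Φ x‖² = 2ⁿ I x z`, hence `‖Φ x‖ ≤ 1 + 2ⁿ I x z` is integrable.
  have hΦi : Integrable Φ (P + Q) := by
    refine Integrable.mono' (g := fun x => 1 + 2 ^ n * I x z) ?_
      (aestronglyMeasurable_of_continuous hΦc) (Filter.Eventually.of_forall fun x => ?_)
    · have := (h.integrable univ z z).const_mul (2 ^ n)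
      simp only [mix_univ] at this
      exact (integrable_const _).add this
    · rw [← norm_sq_feature hpdi h0 hT x z]
      nlinarith [sq_nonneg (‖Φ x‖ - 1)]
  have hΦP := hΦi.left_of_add_measure
  have hΦQ := hΦi.right_of_add_measure
  set V : H := ∫ x, Φ x ∂P - ∫ x, Φ x ∂Q with hV
  -- Only `G = univ` contributes: the other terms do not depend on some coordinate of `x`.
  have hVy : ∀ y, inner ℝ V (Φ y) = (-1) ^ n * ∑ F, sgn F * potential I P Q (mix F y z) := by
    intro y
    rw [real_inner_comm, hV, inner_sub_right, ← integral_inner hΦP, ← integral_inner hΦQ]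
    simp_rw [hinner]
    have hint := fun F G : Finset (Fin n) => (h.integrable G z (mix F y z)).const_mul (sgn G)
    have hint2 := fun F : Finset (Fin n) =>
      (integrable_finsetSum univ fun G _ => hint F G).const_mul (sgn F)
    rw [integral_const_mul, integral_const_mul, ← mul_sub,
      integral_finsetSum _ fun F _ => (hint2 F).left_of_add_measure,
      integral_finsetSum _ fun F _ => (hint2 F).right_of_add_measure, ← sum_sub_distrib]
    congr 1
    refine sum_congr rfl fun F _ => ?_
    rw [integral_const_mul, integral_const_mul, ← mul_sub,
      integral_finsetSum _ fun G _ => (hint F G).left_of_add_measure,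
      integral_finsetSum _ fun G _ => (hint F G).right_of_add_measure, ← sum_sub_distrib]
    congr 1
    rw [sum_eq_single univ]
    · simp [sgn_univ, potential]
    · intro G _ hG
      obtain ⟨i, hi⟩ : ∃ i, i ∉ G := by
        by_contra! h'
        exact hG (eq_univ_iff_forall.2 h')
      have hm : Measurable fun x => I (mix G x z) (mix F y z) :=
        (hI.comp (((continuous_mix G).comp (Continuous.prodMk_left z)).prodMk
          continuous_const)).measurable
      rw [integral_const_mul, integral_const_mul,
        hPQ.integral_eq hm (indepOf_mix (fun x => I x (mix F y z)) hi z), sub_self]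
    · simp
  have hVV : inner ℝ V V = 0 := by
    conv_lhs => rw [hV]
    rw [← hV, inner_sub_right, ← integral_inner hΦP, ← integral_inner hΦQ]
    simp_rw [hVy]
    rw [integral_const_mul, integral_const_mul, ← mul_sub, hE]
  have hV0 : V = 0 := inner_self_eq_zero.1 hVV
  intro w
  have := hVy w
  rw [hV0, inner_zero_left] at this
  exact (mul_eq_zero.1 this.symm).resolve_left (by positivity)

end Controlled

/-! ### Differences of Radon measures -/

section Signed

variable {Y : Type u} [TopologicalSpace Y] [T2Space Y] [MeasurableSpace Y] [BorelSpace Y]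

lemma variation_sub_le {Y : Type u} [MeasurableSpace Y] (P Q : Measure Y) [IsFiniteMeasure P]
    [IsFiniteMeasure Q] : (P.toSignedMeasure - Q.toSignedMeasure).variation ≤ P + Q := by
  refine VectorMeasure.variation_sub_le.trans (le_of_eq ?_)
  simp only [Measure.variation_toSignedMeasure]

lemma isRadonSigned_sub (P Q : Measure Y) [IsFiniteMeasure P] [IsFiniteMeasure Q]
    [P.InnerRegular] [Q.InnerRegular] : IsRadonSigned (P.toSignedMeasure - Q.toSignedMeasure) := by
  have hle := variation_sub_le P Q
  have : IsFiniteMeasure (P.toSignedMeasure - Q.toSignedMeasure).variation :=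
    isFiniteMeasure_of_le _ hle
  have := innerRegular_of_absolutelyContinuous (Measure.absolutelyContinuous_of_le hle)
  exact isRadon_of_innerRegular _

lemma toSignedMeasure_sub_apply {Y : Type u} [MeasurableSpace Y] (P Q : Measure Y)
    [IsFiniteMeasure P] [IsFiniteMeasure Q] {A : Set Y} (hA : MeasurableSet A) :
    (P.toSignedMeasure - Q.toSignedMeasure) A = (P A).toReal - (Q A).toReal := by
  simp [Measure.toSignedMeasure_apply_measurable hA, Measure.real]

lemma toSignedMeasure_sub_apply_eq_zero {Y : Type u} [MeasurableSpace Y] {P Q : Measure Y}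
    [IsFiniteMeasure P] [IsFiniteMeasure Q] {A : Set Y} (hA : MeasurableSet A) :
    (P.toSignedMeasure - Q.toSignedMeasure) A = 0 ↔ P A = Q A := by
  rw [toSignedMeasure_sub_apply P Q hA, sub_eq_zero,
    ENNReal.toReal_eq_toReal_iff' (measure_ne_top _ _) (measure_ne_top _ _)]

lemma toSignedMeasure_sub_eq_zero {Y : Type u} [MeasurableSpace Y] {P Q : Measure Y}
    [IsFiniteMeasure P] [IsFiniteMeasure Q] :
    P.toSignedMeasure - Q.toSignedMeasure = 0 ↔ P = Q := by
  refine ⟨fun h => Measure.ext fun A hA => ?_, ?_⟩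
  · rw [← toSignedMeasure_sub_apply_eq_zero hA, h]; simp
  · rintro rfl
    exact sub_self _

lemma mem_radonM_iff {n : ℕ} {X : Fin n → Type u} [∀ i, TopologicalSpace (X i)]
    [∀ i, MeasurableSpace (X i)] {μ : SignedMeasure (CartProd X)} :
    μ ∈ radonM X n ↔ IsRadonSigned μ ∧ ∀ A : ∀ i, Set (X i), (∀ i, MeasurableSet (A i)) →
      ∀ i, A i = Set.univ → μ (box A) = 0 := by
  refine and_congr_right fun _ => forall_congr' fun A => forall_congr' fun _ =>
    ⟨fun h i hi => h ?_, fun h hA => ?_⟩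
  · have : 0 < {i | A i = Set.univ}.ncard := (Set.ncard_pos (Set.toFinite _)).2 ⟨i, hi⟩
    omega
  · have : 0 < {i | A i = Set.univ}.ncard := by omega
    obtain ⟨i, hi⟩ := (Set.ncard_pos (Set.toFinite _)).1 this
    exact h i hi

lemma diff_mem_radonM_iff {n : ℕ} {X : Fin n → Type u} [∀ i, TopologicalSpace (X i)]
    [∀ i, T2Space (X i)] [∀ i, MeasurableSpace (X i)] [∀ i, BorelSpace (X i)]
    {P Q : ProbabilityMeasure (CartProd X)} (hP : (P : Measure (CartProd X)).InnerRegular)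
    (hQ : (Q : Measure (CartProd X)).InnerRegular) :
    diff P Q ∈ radonM X n ↔ SameMarginals (P : Measure (CartProd X)) Q := by
  rw [mem_radonM_iff, diff, and_iff_right (isRadonSigned_sub _ _)]
  exact forall_congr' fun A => forall_congr' fun hA => forall_congr' fun i =>
    forall_congr' fun _ => toSignedMeasure_sub_apply_eq_zero (measurableSet_box hA)

end Signed

/-! ### Consequences of the characteristic properties for finite measures -/

section Characteristic

/-- For a characteristic kernel, two finite measures with the same marginals are equal as soon as
their difference is orthogonal to all discrete measures `⨂ i, (δ_{w i} - δ_{z i})`. -/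
lemma IsPDICharacteristic.eq_of_alternating_potential {n : ℕ} {X : Fin n → Type u}
    [∀ i, TopologicalSpace (X i)]
    [∀ i, T2Space (X i)] [∀ i, MeasurableSpace (X i)] [∀ i, BorelSpace (X i)]
    {I : CartProd X → CartProd X → ℝ} (hchar : IsPDICharacteristic I) (hn : 0 < n)
    (hI : Continuous (uncurry I)) (h0 : ZeroOnExtendedDiagonal I)
    {M P Q : Measure (CartProd X)} [IsProbabilityMeasure M]
    [M.InnerRegular] [IsFiniteMeasure P] [IsFiniteMeasure Q] [P.InnerRegular] [Q.InnerRegular]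
    (hM : MarginalsIntegrable I M) {c : ℝ≥0∞} (hc : c ≠ ∞) (hP : P ≤ c • M) (hQ : Q ≤ c • M)
    (hPQ : SameMarginals P Q) (huniv : P Set.univ = Q Set.univ) (z : CartProd X)
    (h : ∀ w, ∑ G, sgn G * potential I P Q (mix G w z) = 0) : P = Q := by
  -- The hypothesis on `I` concerns probabilities, so divide by the common mass.
  by_cases hp : P Set.univ = 0
  · rw [Measure.measure_univ_eq_zero.1 hp, Measure.measure_univ_eq_zero.1 (huniv.symm.trans hp)]
  set p := (P Set.univ)⁻¹ with hpdef
  have hp0 : p ≠ 0 := ENNReal.inv_ne_zero.2 (measure_ne_top _ _)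
  have hpt : p ≠ ∞ := ENNReal.inv_ne_top.2 hp
  have hPp : IsProbabilityMeasure (p • P) :=
    ⟨by simp [hpdef, ENNReal.inv_mul_cancel hp (measure_ne_top _ _)]⟩
  have hQp : IsProbabilityMeasure (p • Q) :=
    ⟨by simp [hpdef, ← huniv, ENNReal.inv_mul_cancel hp (measure_ne_top _ _)]⟩
  have hle : ∀ {ν : Measure (CartProd X)}, ν ≤ c • M → p • ν ≤ (p * c) • M := by
    intro ν hν
    rw [← smul_smul]
    exact Measure.le_iff.2 fun A hA => by
      simpa using mul_le_mul_right (Measure.le_iff.1 hν A hA) p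
  have hpc : p * c ≠ ∞ := by finiteness
  have hsame : SameMarginals (p • P) (p • Q) := by
    intro A hA i hi
    rw [Measure.smul_apply, Measure.smul_apply, hPQ A hA i hi]
  have hPr : Measure.InnerRegular (p • P) := inferInstance
  have hQr : Measure.InnerRegular (p • Q) := inferInstance
  have hctrl := hM.controlled (P := p • P) (Q := p • Q) hn hI hchar.1 h0 hpc (hle hP) (hle hQ)
  have hE := (hctrl.energy_eq_zero_iff hsame hI hchar.1 h0 z).2 fun w => by
    have e : ∀ y, potential I (p • P) (p • Q) y = p.toReal * potential I P Q y := by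
      intro y
      simp [potential, integral_smul_measure, mul_sub]
    simp_rw [e, mul_left_comm _ p.toReal]
    rw [← mul_sum, h w, mul_zero]
  have key := hchar.2 ⟨p • P, hPp⟩ ⟨isRadon_of_innerRegular (p • P), hM.mono hpc (hle hP)⟩
    ⟨p • Q, hQp⟩ ⟨⟨isRadon_of_innerRegular (p • Q), hM.mono hpc (hle hQ)⟩, ?_⟩ hE
  · have key2 : p • P = p • Q := congrArg Subtype.val key
    refine Measure.ext fun A _ => ?_
    have := congrArg (fun ν : Measure _ => ν A) key2
    simp only [Measure.smul_apply, smul_eq_mul] at this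
    exact (ENNReal.mul_right_inj hp0 hpt).1 this
  · exact (diff_mem_radonM_iff hPr hQr).2 hsame

variable {Y : Type u} [TopologicalSpace Y] [T2Space Y] [MeasurableSpace Y] [BorelSpace Y]
  {γ : Y → Y → ℝ}

/-- For a characteristic kernel, two finite measures of the same mass are equal as soon as the
potential of their difference is constant. -/
lemma IsCNDCharacteristic.eq_of_potential_const (hchar : IsCNDCharacteristic γ)
    (hγ0 : ∀ a, γ a a = 0) {P Q : Measure Y} [IsFiniteMeasure P]
    [IsFiniteMeasure Q] [P.InnerRegular] [Q.InnerRegular] (huniv : P Set.univ = Q Set.univ)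
    (hint : ∀ b, Integrable (fun a => γ a b) (P + Q)) {C : ℝ}
    (h : ∀ b, potential γ P Q b = C) : P = Q := by
  have hnn := hchar.1.nonneg hγ0
  refine toSignedMeasure_sub_eq_zero.1 (hchar.2 _ (isRadonSigned_sub P Q) ?_ ?_ ?_)
  · have hle := variation_sub_le P Q
    rcases isEmpty_or_nonempty Y with hY | ⟨⟨o⟩⟩
    · simp [Measure.eq_zero_of_isEmpty (P.toSignedMeasure - Q.toSignedMeasure).variation]
    have ho := hint o
    have hm : ∫⁻ a, ‖γ a o‖ₑ ∂(P + Q) < ∞ := ho.2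
    calc ∫⁻ b, ∫⁻ a, ‖γ a b‖ₑ ∂(P.toSignedMeasure - Q.toSignedMeasure).variation
          ∂(P.toSignedMeasure - Q.toSignedMeasure).variation
        ≤ ∫⁻ b, ∫⁻ a, ‖γ a b‖ₑ ∂(P + Q) ∂(P + Q) :=
          lintegral_mono' hle fun b => lintegral_mono' hle le_rfl
      _ ≤ ∫⁻ b, ∫⁻ a, (2 * ‖γ a o‖ₑ + 2 * ‖γ b o‖ₑ) ∂(P + Q) ∂(P + Q) := by
          refine lintegral_mono fun b => lintegral_mono fun a => ?_
          have := hchar.1.triangle hγ0 a b o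
          rw [hchar.1.1 o b] at this
          simp_rw [Real.enorm_of_nonneg (hnn _ _)]
          refine (ENNReal.ofReal_le_ofReal this).trans (le_of_eq ?_)
          rw [ENNReal.ofReal_add (by linarith [hnn a o]) (by linarith [hnn b o]),
            ENNReal.ofReal_mul (by norm_num), ENNReal.ofReal_mul (by norm_num)]
          simp
      _ = ∫⁻ b, (2 * ∫⁻ a, ‖γ a o‖ₑ ∂(P + Q)) + 2 * ‖γ b o‖ₑ * (P + Q) Set.univ ∂(P + Q) := by
          refine lintegral_congr fun b => ?_
          rw [lintegral_add_right _ measurable_const, lintegral_const,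
            lintegral_const_mul' _ _ (by finiteness)]
      _ = 2 * (∫⁻ a, ‖γ a o‖ₑ ∂(P + Q)) * (P + Q) Set.univ +
            2 * (∫⁻ b, ‖γ b o‖ₑ ∂(P + Q)) * (P + Q) Set.univ := by
          rw [lintegral_add_left measurable_const, lintegral_const,
            lintegral_mul_const' _ _ (measure_ne_top _ _),
            lintegral_const_mul' _ _ (by finiteness)]
      _ < ∞ := by finiteness
  · rw [toSignedMeasure_sub_apply_eq_zero MeasurableSet.univ, huniv]
  · have hpot : potential γ P Q = fun _ => C := funext h
    have := energy_sub (P := P) (Q := Q) (k := γ) (-1) hint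
      (by rw [hpot]; exact integrable_const _)
    simp only [neg_one_mul] at this
    rw [this]
    simp [hpot, Measure.real, huniv]

omit [T2Space Y] [BorelSpace Y] in
lemma innerRegular_dirac (a : Y) : (Measure.dirac a).InnerRegular := by
  refine ⟨fun U hU r hr => ?_⟩
  rw [Measure.dirac_apply' a hU] at hr
  by_cases ha : a ∈ U
  · refine ⟨{a}, by simpa using ha, isCompact_singleton, ?_⟩
    rw [Set.indicator_of_mem ha] at hr
    refine hr.trans_le ?_
    exact (by simp : (1 : ℝ≥0∞) ≤ Set.indicator {a} 1 a).trans (Measure.le_dirac_apply)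
  · simp [ha] at hr

/-- A characteristic kernel on a space with two points is not zero, since it separates the Dirac
measures. -/
lemma IsCNDCharacteristic.exists_ne_zero [Nontrivial Y] (hchar : IsCNDCharacteristic γ)
    (hγ0 : ∀ a, γ a a = 0) : ∃ a b, γ a b ≠ 0 := by
  by_contra! h
  obtain ⟨a, b, hab⟩ := exists_pair_ne Y
  have := innerRegular_dirac a
  have := innerRegular_dirac b
  have key := hchar.eq_of_potential_const hγ0 (P := Measure.dirac a) (Q := Measure.dirac b)
    (by simp) (fun b => by simp [h]) (C := 0) fun b => by simp [potential, h]
  have := congrArg (fun ν : Measure Y => ν {a}) key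
  simp [hab.symm] at this

end Characteristic

/-! ### Images of weighted differences of measures -/

section Weighted

variable {Ω : Type u} {Y : Type v} [MeasurableSpace Ω] [MeasurableSpace Y]

/-- The image under `φ` of `f⁺ P + f⁻ Q`. The difference `weighted P Q f φ - weighted Q P f φ` is
the image under `φ` of the signed measure `f (P - Q)`. -/
noncomputable def weighted (P Q : Measure Ω) (f : Ω → ℝ) (φ : Ω → Y) : Measure Y :=
  (P.withDensity (fun x => ENNReal.ofReal (f x)) +
    Q.withDensity fun x => ENNReal.ofReal (-f x)).map φ

variable {P Q : Measure Ω} {f : Ω → ℝ} {φ : Ω → Y}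

lemma isFiniteMeasure_weighted (hf : Integrable f (P + Q)) :
    IsFiniteMeasure (weighted P Q f φ) := by
  have := isFiniteMeasure_withDensity_ofReal hf.left_of_add_measure.2
  have := isFiniteMeasure_withDensity_ofReal hf.right_of_add_measure.neg.2
  simp only [Pi.neg_apply] at this
  rw [weighted]
  infer_instance

lemma innerRegular_weighted [TopologicalSpace Ω] [BorelSpace Ω] [T2Space Ω] [TopologicalSpace Y]
    [BorelSpace Y] [IsFiniteMeasure P] [IsFiniteMeasure Q] [P.InnerRegular] [Q.InnerRegular]
    (hφ : Continuous φ) : (weighted P Q f φ).InnerRegular := by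
  have := innerRegular_of_absolutelyContinuous
    (withDensity_absolutelyContinuous P fun x => ENNReal.ofReal (f x))
  have := innerRegular_of_absolutelyContinuous
    (withDensity_absolutelyContinuous Q fun x => ENNReal.ofReal (-f x))
  exact Measure.InnerRegular.map_of_continuous hφ

lemma integrable_weighted_aux {R : Measure Ω} {g k : Ω → ℝ} (hg : Measurable g)
    (hgk : Integrable (fun x => g x * k x) R) (hk : Measurable k) :
    Integrable k (R.withDensity fun x => ENNReal.ofReal (g x)) := by
  rw [integrable_withDensity_iff_integrable_smul' hg.ennreal_ofReal (by simp)]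
  refine hgk.mono (by fun_prop) (Filter.Eventually.of_forall fun x => ?_)
  rw [smul_eq_mul, norm_mul, norm_mul]
  gcongr
  rw [ENNReal.toReal_ofReal']
  simp only [Real.norm_eq_abs]
  rw [abs_of_nonneg (le_max_right _ _)]
  exact max_le (le_abs_self _) (abs_nonneg _)

lemma integrable_weighted (hf : Measurable f) (hφ : Measurable φ) {h : Y → ℝ} (hh : Measurable h)
    (hi : Integrable (fun x => f x * h (φ x)) (P + Q)) : Integrable h (weighted P Q f φ) := by
  rw [weighted, integrable_map_measure hh.aestronglyMeasurable hφ.aemeasurable]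
  refine Integrable.add_measure ?_ ?_
  · exact integrable_weighted_aux hf hi.left_of_add_measure (hh.comp hφ)
  · refine integrable_weighted_aux hf.neg ?_ (hh.comp hφ)
    simpa using hi.right_of_add_measure.neg

lemma integral_weighted (hf : Measurable f) (hφ : Measurable φ) {h : Y → ℝ} (hh : Measurable h)
    (hi : Integrable (fun x => f x * h (φ x)) (P + Q)) :
    ∫ y, h y ∂(weighted P Q f φ) =
      ∫ x, max (f x) 0 * h (φ x) ∂P + ∫ x, max (-f x) 0 * h (φ x) ∂Q := by
  rw [weighted, integral_map hφ.aemeasurable hh.aestronglyMeasurable, integral_add_measure,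
    integral_withDensity_eq_integral_toReal_smul (by fun_prop) (by simp),
    integral_withDensity_eq_integral_toReal_smul (by fun_prop) (by simp)]
  · simp only [ENNReal.toReal_ofReal', smul_eq_mul]
  · exact integrable_weighted_aux hf hi.left_of_add_measure (hh.comp hφ)
  · refine integrable_weighted_aux hf.neg ?_ (hh.comp hφ)
    simpa using hi.right_of_add_measure.neg

lemma integral_max_mul_sub {ν : Measure Ω} {g k : Ω → ℝ} (hg : Measurable g)
    (hgk : Integrable (fun x => g x * k x) ν) (hk : Measurable k) :
    ∫ x, max (g x) 0 * k x ∂ν - ∫ x, max (-g x) 0 * k x ∂ν = ∫ x, g x * k x ∂ν := by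
  have key : ∀ g : Ω → ℝ, Measurable g → Integrable (fun x => g x * k x) ν →
      Integrable (fun x => max (g x) 0 * k x) ν := by
    intro g hg hgk
    refine hgk.mono (by fun_prop) (Filter.Eventually.of_forall fun x => ?_)
    rw [norm_mul, norm_mul]
    gcongr
    rw [Real.norm_of_nonneg (le_max_right _ _), Real.norm_eq_abs]
    exact max_le (le_abs_self _) (abs_nonneg _)
  rw [← integral_sub (key g hg hgk) (key (fun x => -g x) hg.neg (by simpa using hgk.neg))]
  refine integral_congr_ae (Filter.Eventually.of_forall fun x => ?_)
  change max (g x) 0 * k x - max (-g x) 0 * k x = g x * k x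
  rw [← sub_mul]
  congr 1
  rcases le_total 0 (g x) with h | h
  · rw [max_eq_left h, max_eq_right (by linarith), sub_zero]
  · rw [max_eq_right h, max_eq_left (by linarith)]
    ring

/-- Integrals against the image of `f (P - Q)`. -/
lemma integral_weighted_sub (hf : Measurable f) (hφ : Measurable φ) {h : Y → ℝ}
    (hh : Measurable h) (hi : Integrable (fun x => f x * h (φ x)) (P + Q)) :
    ∫ y, h y ∂(weighted P Q f φ) - ∫ y, h y ∂(weighted Q P f φ) =
      ∫ x, f x * h (φ x) ∂P - ∫ x, f x * h (φ x) ∂Q := by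
  rw [integral_weighted hf hφ hh hi, integral_weighted hf hφ hh (add_comm P Q ▸ hi),
    ← integral_max_mul_sub hf hi.left_of_add_measure (hh.comp hφ),
    ← integral_max_mul_sub hf hi.right_of_add_measure (hh.comp hφ)]
  ring

end Weighted

/-! ### Splitting off the last coordinate -/

section Product

variable {n : ℕ} {X : Fin (n + 1) → Type u}

/-- A sum over the sets of `n + 1` indices, split according to whether the last index belongs to
the set. -/
lemma sum_finset_succ {A : Type*} [AddCommMonoid A] (g : Finset (Fin (n + 1)) → A) :
    ∑ G, g G = ∑ F : Finset (Fin n), (g (F.map Fin.castSuccEmb) +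
      g (insert (Fin.last n) (F.map Fin.castSuccEmb))) := by
  have hlast : ∀ F : Finset (Fin n), Fin.last n ∉ F.map Fin.castSuccEmb := by
    intro F
    simp [Fin.castSucc_ne_last]
  rw [sum_add_distrib, ← sum_filter_add_sum_filter_not univ fun G => Fin.last n ∉ G]
  have hinit : ∀ F : Finset (Fin n), initFin (F.map Fin.castSuccEmb) = F := by
    intro F; ext; simp [initFin]
  congr 1
  · refine sum_nbij' initFin (fun F => F.map Fin.castSuccEmb) (by simp)
      (fun F _ => by simp) (fun G hG => ?_) (fun F _ => hinit F) (fun G hG => ?_)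
    all_goals
      have : (initFin G).map Fin.castSuccEmb = G := by
        ext i
        have hl : Fin.last n ∉ G := by simpa using hG
        induction i using Fin.lastCases <;> simp [initFin, hl, Fin.castSucc_ne_last]
      simp only [this]
  · refine sum_nbij' initFin (fun F => insert (Fin.last n) (F.map Fin.castSuccEmb)) (by simp)
      (fun F _ => by simp) (fun G hG => ?_) (fun F _ => ?_) (fun G hG => ?_)
    · have hl : Fin.last n ∈ G := by simpa using hG
      ext i
      induction i using Fin.lastCases <;> simp [initFin, hl, Fin.castSucc_ne_last]
    · ext; simp [initFin, Fin.castSucc_ne_last]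
    · have hl : Fin.last n ∈ G := by simpa using hG
      congr 1
      ext i
      induction i using Fin.lastCases <;> simp [initFin, hl, Fin.castSucc_ne_last]

lemma sgn_insert_last (F : Finset (Fin n)) :
    sgn (insert (Fin.last n) (F.map Fin.castSuccEmb)) = sgn F := by
  have hlast : Fin.last n ∉ F.map Fin.castSuccEmb := by simp [Fin.castSucc_ne_last]
  rw [sgn, card_compl, card_insert_of_notMem hlast, sgn, card_compl]
  simp

lemma sgn_map_castSucc (F : Finset (Fin n)) : sgn (F.map Fin.castSuccEmb) = -sgn F := by
  have hlast : Fin.last n ∉ F.map Fin.castSuccEmb := by simp [Fin.castSucc_ne_last]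
  rw [← sgn_insert_last F, sgn_insert hlast, neg_neg]

lemma mix_snocPt_map (F : Finset (Fin n)) (w z : CartProd fun i : Fin n => X i.castSucc)
    (b o : X (Fin.last n)) :
    mix (F.map Fin.castSuccEmb) (snocPt w b) (snocPt z o) = snocPt (mix F w z) o := by
  funext i
  induction i using Fin.lastCases <;> simp [Fin.castSucc_ne_last]

lemma mix_snocPt_insert (F : Finset (Fin n)) (w z : CartProd fun i : Fin n => X i.castSucc)
    (b o : X (Fin.last n)) :
    mix (insert (Fin.last n) (F.map Fin.castSuccEmb)) (snocPt w b) (snocPt z o) =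
      snocPt (mix F w z) b := by
  funext i
  induction i using Fin.lastCases <;> simp [Fin.castSucc_ne_last]

variable [∀ i, TopologicalSpace (X i)]

lemma continuous_initPt : Continuous (initPt : CartProd X → _) :=
  continuous_pi fun i => CartProd.continuous_apply i.castSucc

lemma continuous_snocPt : Continuous fun p : CartProd (fun i : Fin n => X i.castSucc) ×
    X (Fin.last n) => (snocPt p.1 p.2 : CartProd X) := by
  refine continuous_pi fun i => ?_
  induction i using Fin.lastCases with
  | last => simpa using continuous_snd
  | cast i =>
    simp only [snocPt_castSucc]
    exact (CartProd.continuous_apply i).comp continuous_fst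

variable {I : CartProd (fun i : Fin n => X i.castSucc) →
      CartProd (fun i : Fin n => X i.castSucc) → ℝ} {γ : X (Fin.last n) → X (Fin.last n) → ℝ}

lemma kronecker_continuous (hI : Continuous (uncurry I)) (hγ : Continuous (uncurry γ)) :
    Continuous (uncurry (kronecker I γ)) := by
  have h1 : Continuous fun p : CartProd X × CartProd X => I (initPt p.1) (initPt p.2) :=
    hI.comp ((continuous_initPt.comp continuous_fst).prodMk (continuous_initPt.comp continuous_snd))
  have h2 : Continuous fun p : CartProd X × CartProd X =>
      γ (p.1 (Fin.last n)) (p.2 (Fin.last n)) :=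
    hγ.comp (((CartProd.continuous_apply _).comp continuous_fst).prodMk
      ((CartProd.continuous_apply _).comp continuous_snd))
  exact h1.mul h2

omit [∀ i, TopologicalSpace (X i)] in
lemma kronecker_mix_map (F : Finset (Fin n)) (x : CartProd X)
    (z w : CartProd fun i : Fin n => X i.castSucc) (a b : X (Fin.last n)) :
    kronecker I γ (mix (F.map Fin.castSuccEmb) x (snocPt z a)) (snocPt w b) =
      I (mix F (initPt x) z) w * γ a b := by
  rw [← snocPt_initPt x, mix_snocPt_map, kronecker_apply]
  simp

variable [∀ i, T2Space (X i)]

/-- A partition of the first `n` indices is extended by the singleton block of the last index. With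
the last coordinate frozen at `a` and the second argument ending in `b`, the factor `γ` is the
nonzero constant `γ a b`. -/
lemma MarginalsIntegrable.map_initPt {M : Measure (CartProd X)} [IsProbabilityMeasure M]
    [M.InnerRegular] (hM : MarginalsIntegrable (kronecker I γ) M) (hI : Continuous (uncurry I))
    {a b : X (Fin.last n)} (hab : γ a b ≠ 0) : MarginalsIntegrable I (M.map initPt) := by
  intro c F z w
  have h := hM (Fin.lastCases 0 fun i => (c i).castSucc) (F.map Fin.castSuccEmb) (snocPt z a)
    (snocPt w b)
  have hev : Continuous fun ω : Fin n → CartProd (fun i : Fin n => X i.castSucc) =>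
      (fun i => ω (c i) i : CartProd (fun i : Fin n => X i.castSucc)) :=
    continuous_pi fun i => (CartProd.continuous_apply i).comp (continuous_apply (c i))
  have hs : SumCont fun ω : Fin n → CartProd (fun i : Fin n => X i.castSucc) =>
      ‖I (mix F (fun i => ω (c i) i) z) w‖ₑ :=
    sumCont_kernel_mix hI ((continuous_mix F).comp (hev.prodMk continuous_const))
      continuous_const
  -- The label `0` of the last index is irrelevant, since its coordinate is replaced by `a`.
  rw [lintegralPartition, iterLIntegral_map M continuous_initPt hs,
    ← iterLIntegral_succAbove M (Fin.last n)]
  have e : ∀ ω : Fin (n + 1) → CartProd X, ‖kronecker I γ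
      (mix (F.map Fin.castSuccEmb) (fun i => ω (Fin.lastCases (motive := fun _ => Fin (n + 1)) 0
        (fun i => (c i).castSucc) i) i) (snocPt z a)) (snocPt w b)‖ₑ =
      ‖γ a b‖ₑ * ‖I (mix F (fun i => initPt (ω ((Fin.last n).succAbove (c i))) i) z) w‖ₑ := by
    intro ω
    refine (congrArg _ (kronecker_mix_map (I := I) (γ := γ) F (fun i => ω (Fin.lastCases
      (motive := fun _ => Fin (n + 1)) 0 (fun i => (c i).castSucc) i) i : CartProd X) z w a
      b)).trans ?_
    rw [enorm_mul, mul_comm]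
    congr 4
    funext i
    change ω (Fin.lastCases (motive := fun _ => Fin (n + 1)) 0
        (fun i => (c i).castSucc) i.castSucc) i.castSucc = _
    rw [Fin.lastCases_castSucc, Fin.succAbove_last, initPt_apply]
  simp only [lintegralPartition, e] at h
  rw [iterLIntegral_const_mul _ (by simp)] at h
  exact ENNReal.lt_top_of_mul_ne_top_right h.ne (by simpa using hab)

end Product

/-! ### Characteristic factors give a characteristic product -/

section Converse

variable {n : ℕ} {X : Fin (n + 1) → Type u} [∀ i, TopologicalSpace (X i)]
  {I : CartProd (fun i : Fin n => X i.castSucc) →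
      CartProd (fun i : Fin n => X i.castSucc) → ℝ} {γ : X (Fin.last n) → X (Fin.last n) → ℝ}

/-- The image under `initPt` of the restriction of `P` to the points with last coordinate
in `B`. -/
noncomputable def slice (P : Measure (CartProd X)) (B : Set (X (Fin.last n))) :
    Measure (CartProd fun i : Fin n => X i.castSucc) :=
  (P.restrict ((fun x : CartProd X => x (Fin.last n)) ⁻¹' B)).map initPt

lemma slice_le (P : Measure (CartProd X)) (B : Set (X (Fin.last n))) :
    slice P B ≤ P.map initPt :=
  Measure.map_mono Measure.restrict_le_self continuous_initPt.measurable

instance (P : Measure (CartProd X)) [IsFiniteMeasure P] (B : Set (X (Fin.last n))) :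
    IsFiniteMeasure (slice P B) := by
  rw [slice]; infer_instance

instance [∀ i, T2Space (X i)] (P : Measure (CartProd X)) [IsFiniteMeasure P] [P.InnerRegular]
    (B : Set (X (Fin.last n))) : (slice P B).InnerRegular := by
  have : (P.map initPt).InnerRegular := Measure.InnerRegular.map_of_continuous continuous_initPt
  exact innerRegular_of_absolutelyContinuous (Measure.absolutelyContinuous_of_le (slice_le P B))

/-- Orthogonality of `P - Q` to the measure `⨂ i, (δ_{w i} - δ_{z i}) ⊗ (δ_b - δ_o)`. -/
lemma sum_sgn_potential_snocPt [∀ i, T2Space (X i)] [∀ i, MeasurableSpace (X i)]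
    [∀ i, BorelSpace (X i)] {J : CartProd X → CartProd X → ℝ}
    (hJ : Continuous (uncurry J)) (hpdi : IsPDI J) (h0 : ZeroOnExtendedDiagonal J)
    {P Q : Measure (CartProd X)} [IsFiniteMeasure P] [IsFiniteMeasure Q] [P.InnerRegular]
    [Q.InnerRegular] (h : Controlled J P Q) (hPQ : SameMarginals P Q)
    (hE : energy (fun x y => (-1 : ℝ) ^ (n + 1) * J x y)
      (P.toSignedMeasure - Q.toSignedMeasure) = 0)
    (w z : CartProd fun i : Fin n => X i.castSucc) (b o : X (Fin.last n)) :
    ∑ F, sgn F * potential J P Q (snocPt (mix F w z) b) =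
      ∑ F, sgn F * potential J P Q (snocPt (mix F w z) o) := by
  have := (h.energy_eq_zero_iff hPQ hJ hpdi h0 (snocPt z o)).1 hE (snocPt w b)
  rw [sum_finset_succ] at this
  simp_rw [mix_snocPt_map, mix_snocPt_insert, sgn_insert_last, sgn_map_castSucc] at this
  rw [sum_add_distrib] at this
  simp_rw [neg_mul] at this
  rw [sum_neg_distrib] at this
  linarith

lemma measurableSet_last_preimage [∀ i, MeasurableSpace (X i)] [∀ i, BorelSpace (X i)]
    {B : Set (X (Fin.last n))} (hB : MeasurableSet B) :
    MeasurableSet ((fun x : CartProd X => x (Fin.last n)) ⁻¹' B) :=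
  measurable_apply (Fin.last n) hB

lemma slice_box [∀ i, MeasurableSpace (X i)] [∀ i, BorelSpace (X i)] (P : Measure (CartProd X))
    {A : ∀ i : Fin n, Set (X i.castSucc)} (hA : ∀ i, MeasurableSet (A i))
    (B : Set (X (Fin.last n))) :
    slice P B (box A) = P (box (Fin.snoc (α := fun i => Set (X i)) A B)) := by
  rw [slice, Measure.map_apply continuous_initPt.measurable (measurableSet_box hA),
    Measure.restrict_apply (continuous_initPt.measurable (measurableSet_box hA))]
  congr 1
  ext x
  simp [box, Fin.forall_fin_succ']

lemma SameMarginals.slice [∀ i, MeasurableSpace (X i)] [∀ i, BorelSpace (X i)]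
    {P Q : Measure (CartProd X)} (h : SameMarginals P Q) {B : Set (X (Fin.last n))}
    (hB : MeasurableSet B) : SameMarginals (slice P B) (slice Q B) := by
  intro A hA i hi
  rw [slice_box P hA B, slice_box Q hA B]
  refine h _ (fun j => ?_) i.castSucc (by simpa using hi)
  induction j using Fin.lastCases with
  | last => simpa using hB
  | cast j => simpa using hA j

lemma eq_of_slice_eq [∀ i, T2Space (X i)] [∀ i, MeasurableSpace (X i)] [∀ i, BorelSpace (X i)]
    {P Q : Measure (CartProd X)} [IsFiniteMeasure P] [IsFiniteMeasure Q] [P.InnerRegular]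
    [Q.InnerRegular] (h : ∀ B : Set (X (Fin.last n)), MeasurableSet B → slice P B = slice Q B) :
    P = Q := by
  refine measure_ext_of_box fun A hA => ?_
  have e : (Fin.snoc (α := fun i => Set (X i)) (fun i => A (Fin.castSucc i)) (A (Fin.last n))) =
      A := Fin.snoc_init_self A
  have := congrArg (fun ν => ν (box fun i => A (Fin.castSucc i))) (h _ (hA (Fin.last n)))
  rwa [slice_box P (fun i => hA _), slice_box Q (fun i => hA _), e] at this

/-- Let `f = ∑ F, sgn F * I (initPt ·) (mix F w z)`. Since the energy of `P - Q` vanishes, the image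
of `f (P - Q)` under the last coordinate has a constant potential with respect to `γ`, hence it is
zero. Its value at `B` is the alternating sum in the statement. -/
lemma sum_sgn_potential_slice [∀ i, T2Space (X i)] [∀ i, MeasurableSpace (X i)]
    [∀ i, BorelSpace (X i)] (hIc : Continuous (uncurry I)) (hI : IsPDI I)
    (hI0 : ZeroOnExtendedDiagonal I)
    (hγc : Continuous (uncurry γ)) (hγ : IsCNDCharacteristic γ) (hγ0 : ∀ a, γ a a = 0)
    {P Q : Measure (CartProd X)} [IsFiniteMeasure P] [IsFiniteMeasure Q] [P.InnerRegular]
    [Q.InnerRegular] (h : Controlled (kronecker I γ) P Q) (hPQ : SameMarginals P Q)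
    (hi : ∀ y, Integrable (fun x : CartProd X => I (initPt x) y) (P + Q))
    (hE : energy (fun x y => (-1 : ℝ) ^ (n + 1) * kronecker I γ x y)
      (P.toSignedMeasure - Q.toSignedMeasure) = 0)
    {B : Set (X (Fin.last n))} (hB : MeasurableSet B)
    (w z : CartProd fun i : Fin n => X i.castSucc) :
    ∑ F, sgn F * potential I (slice P B) (slice Q B) (mix F w z) = 0 := by
  rcases isEmpty_or_nonempty (X (Fin.last n)) with hX | ⟨⟨o⟩⟩
  · have : IsEmpty (CartProd X) := ⟨fun x => hX.elim (x (Fin.last n))⟩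
    simp [slice, potential, Measure.eq_zero_of_isEmpty P, Measure.eq_zero_of_isEmpty Q]
  set φ : CartProd X → X (Fin.last n) := fun x => x (Fin.last n) with hφ
  have hφm : Measurable φ := measurable_apply _
  set f : CartProd X → ℝ := fun x => ∑ F, sgn F * I (initPt x) (mix F w z) with hf
  have hIy : ∀ y, Continuous fun x : CartProd X => I (initPt x) y := fun y =>
    hIc.comp (continuous_initPt.prodMk continuous_const)
  have hfc : Continuous f :=
    continuous_finsetSum _ fun F _ => continuous_const.mul (hIy _)
  have hfm := hfc.measurable
  have hfi : Integrable f (P + Q) := integrable_finsetSum _ fun F _ => (hi _).const_mul _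
  have hJi : ∀ F b, Integrable (fun x : CartProd X =>
      sgn F * kronecker I γ x (snocPt (mix F w z) b)) (P + Q) := by
    intro F b
    have := h.integrable univ (snocPt z o) (snocPt (mix F w z) b)
    simp only [mix_univ] at this
    exact this.const_mul _
  have hexp : ∀ b x, f x * γ (φ x) b =
      ∑ F, sgn F * kronecker I γ x (snocPt (mix F w z) b) := by
    intro b x
    simp only [hf, sum_mul, kronecker_apply, initPt_snocPt, snocPt_last, mul_assoc, hφ]
  have hfγ : ∀ b, Integrable (fun x => f x * γ (φ x) b) (P + Q) := by
    intro b
    simp_rw [hexp]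
    exact integrable_finsetSum _ fun F _ => hJi F b
  have hγb : ∀ b, Measurable fun a => γ a b := fun b =>
    (hγc.comp (Continuous.prodMk_left b)).measurable
  have hf1 : Integrable (fun x => f x * (fun _ => (1 : ℝ)) (φ x)) (P + Q) := by simpa using hfi
  have := isFiniteMeasure_weighted (φ := φ) hfi
  have := isFiniteMeasure_weighted (φ := φ) (add_comm P Q ▸ hfi)
  have := innerRegular_weighted (P := P) (Q := Q) (f := f) (φ := φ)
    (CartProd.continuous_apply (Fin.last n))
  have := innerRegular_weighted (P := Q) (Q := P) (f := f) (φ := φ)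
    (CartProd.continuous_apply (Fin.last n))
  have hmass : weighted P Q f φ Set.univ = weighted Q P f φ Set.univ := by
    have h1 := integral_weighted_sub hfm hφm measurable_const hf1
    simp only [integral_const, smul_eq_mul, mul_one] at h1
    have hind : IndepOf f (Fin.last n) := by
      intro x y hxy
      have : initPt x = initPt y := funext fun i => hxy _ (Fin.castSucc_ne_last i)
      simp only [hf, this]
    rw [hPQ.integral_eq hfm hind, sub_self, sub_eq_zero] at h1
    exact (ENNReal.toReal_eq_toReal_iff' (measure_ne_top _ _) (measure_ne_top _ _)).1 h1
  have hpot : ∀ b, potential γ (weighted P Q f φ) (weighted Q P f φ) b =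
      ∑ F, sgn F * potential (kronecker I γ) P Q (snocPt (mix F w z) b) := by
    intro b
    rw [potential, integral_weighted_sub hfm hφm (hγb b) (hfγ b)]
    simp_rw [hexp]
    rw [integral_finsetSum _ fun F _ => (hJi F b).left_of_add_measure,
      integral_finsetSum _ fun F _ => (hJi F b).right_of_add_measure, ← sum_sub_distrib]
    refine sum_congr rfl fun F _ => ?_
    rw [integral_const_mul, integral_const_mul, potential, mul_sub]
  have heq : weighted P Q f φ = weighted Q P f φ := by
    refine hγ.eq_of_potential_const hγ0 hmass (fun b => ?_)
      (C := ∑ F, sgn F * potential (kronecker I γ) P Q (snocPt (mix F w z) o)) fun b => ?_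
    · exact (integrable_weighted hfm hφm (hγb b) (hfγ b)).add_measure
        (integrable_weighted hfm hφm (hγb b) (add_comm P Q ▸ hfγ b))
    · rw [hpot b]
      exact sum_sgn_potential_snocPt (kronecker_continuous hIc hγc) (kronecker_isPDI hI hγ.1 hγ0)
        (kronecker_zeroOnExtendedDiagonal hI0 hγ0) h hPQ hE w z b o
  have hind : ∀ x, f x * B.indicator (fun _ => (1 : ℝ)) (φ x) = (φ ⁻¹' B).indicator f x := by
    intro x
    by_cases hx : φ x ∈ B <;> simp [Set.indicator, hx]
  have hset : ∫ x in φ ⁻¹' B, f x ∂P = ∫ x in φ ⁻¹' B, f x ∂Q := by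
    have h1 := integral_weighted_sub hfm hφm (measurable_const.indicator hB)
      (h := B.indicator fun _ => (1 : ℝ)) (P := P) (Q := Q) (by
        simp_rw [hind]
        exact hfi.indicator (hφm hB))
    rw [heq, sub_self] at h1
    simp_rw [hind] at h1
    rw [integral_indicator (hφm hB), integral_indicator (hφm hB)] at h1
    linarith
  have hpotI : ∀ y, potential I (slice P B) (slice Q B) y =
      ∫ x in φ ⁻¹' B, I (initPt x) y ∂P - ∫ x in φ ⁻¹' B, I (initPt x) y ∂Q := by
    intro y
    have hm : Continuous fun x => I x y := hIc.comp (Continuous.prodMk_left y)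
    rw [potential, slice, slice, integral_map continuous_initPt.aemeasurable
      hm.aestronglyMeasurable, integral_map continuous_initPt.aemeasurable
      hm.aestronglyMeasurable]
  simp_rw [hpotI, mul_sub]
  rw [sum_sub_distrib, sub_eq_zero]
  simp_rw [← integral_const_mul]
  rw [← integral_finsetSum _ fun F _ => ((hi _).left_of_add_measure.restrict).const_mul _,
    ← integral_finsetSum _ fun F _ => ((hi _).right_of_add_measure.restrict).const_mul _]
  exact hset

/-- If both factors are characteristic, then two measures on the product with the same marginals
are equal as soon as the energy of their difference vanishes. -/
lemma eq_of_energy_kronecker_eq_zero (hn : 0 < n) [∀ i, T2Space (X i)]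
    [Nontrivial (X (Fin.last n))]
    [∀ i, MeasurableSpace (X i)] [∀ i, BorelSpace (X i)] (hIc : Continuous (uncurry I))
    (hI0 : ZeroOnExtendedDiagonal I) (hγc : Continuous (uncurry γ)) (hγ0 : ∀ a, γ a a = 0)
    (hI : IsPDICharacteristic I) (hγ : IsCNDCharacteristic γ) {P Q : Measure (CartProd X)}
    [IsProbabilityMeasure P] [IsProbabilityMeasure Q] [P.InnerRegular] [Q.InnerRegular]
    (hP : MarginalsIntegrable (kronecker I γ) P) (hQ : MarginalsIntegrable (kronecker I γ) Q)
    (hPQ : SameMarginals P Q)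
    (hE : energy (fun x y => (-1 : ℝ) ^ (n + 1) * kronecker I γ x y)
      (P.toSignedMeasure - Q.toSignedMeasure) = 0) : P = Q := by
  have hpdi := kronecker_isPDI hI.1 hγ.1 hγ0
  have hJc := kronecker_continuous hIc hγc
  have hJ0 := kronecker_zeroOnExtendedDiagonal hI0 hγ0
  have hM := MarginalsIntegrable.avg hJc hPQ hP hQ
  set M := avg P Q
  have hctrl := hM.controlled n.succ_pos hJc hpdi hJ0 (by simp) (le_avg_left P Q)
    (le_avg_right P Q)
  obtain ⟨a, b, hab⟩ := hγ.exists_ne_zero hγ0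
  have hMI := hM.map_initPt hIc hab
  have : IsProbabilityMeasure (M.map initPt) :=
    Measure.isProbabilityMeasure_map continuous_initPt.aemeasurable
  have : (M.map initPt).InnerRegular := Measure.InnerRegular.map_of_continuous continuous_initPt
  have hi : ∀ y, Integrable (fun x : CartProd X => I (initPt x) y) (P + Q) := by
    intro y
    have hm : Continuous fun x => I x y := hIc.comp (Continuous.prodMk_left y)
    have h1 : Integrable (fun x => I x y) (M.map initPt) := by
      refine ⟨hm.aestronglyMeasurable, ?_⟩
      have := hMI.lintegral_lt_top hn univ y y
      simp only [mix_univ] at this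
      exact this
    have h2 : Integrable (fun x : CartProd X => I (initPt x) y) M :=
      (integrable_map_measure hm.aestronglyMeasurable continuous_initPt.aemeasurable).1 h1
    have h3 := h2.smul_measure (c := 2) (by simp)
    exact (h3.mono_measure (le_avg_left _ _)).add_measure (h3.mono_measure (le_avg_right _ _))
  have hle : ∀ {ν : Measure (CartProd X)}, ν ≤ (2 : ℝ≥0∞) • M → ∀ B,
      slice ν B ≤ (2 : ℝ≥0∞) • M.map initPt := by
    intro ν hν B
    rw [← Measure.map_smul]
    exact (slice_le ν B).trans (Measure.map_mono hν continuous_initPt.measurable)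
  refine eq_of_slice_eq fun B hB => ?_
  have hunivbox : (Set.univ : Set (CartProd fun i : Fin n => X i.castSucc)) =
      box fun _ => Set.univ := by ext; simp [box]
  rcases isEmpty_or_nonempty (CartProd fun i : Fin n => X i.castSucc) with hX | ⟨⟨z⟩⟩
  · rw [Measure.eq_zero_of_isEmpty (slice P B), Measure.eq_zero_of_isEmpty (slice Q B)]
  have huniv : slice P B Set.univ = slice Q B Set.univ := by
    rw [hunivbox]
    exact hPQ.slice hB _ (fun _ => MeasurableSet.univ) ⟨0, hn⟩ rfl
  exact hI.eq_of_alternating_potential hn hIc hI0 hMI (c := 2) (by simp)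
    (hle (le_avg_left P Q) B) (hle (le_avg_right P Q) B) (hPQ.slice hB) huniv z fun w =>
      sum_sgn_potential_slice hIc hI.1 hI0 hγc hγ hγ0 hctrl hPQ hi hE hB w z

/-- If both factors are characteristic, then so is the product. -/
theorem kronecker_isPDICharacteristic (hn : 0 < n) [∀ i, T2Space (X i)]
    [Nontrivial (X (Fin.last n))]
    [∀ i, MeasurableSpace (X i)] [∀ i, BorelSpace (X i)] (hIc : Continuous (uncurry I))
    (hI0 : ZeroOnExtendedDiagonal I) (hγc : Continuous (uncurry γ)) (hγ0 : ∀ a, γ a a = 0)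
    (hI : IsPDICharacteristic I) (hγ : IsCNDCharacteristic γ) :
    IsPDICharacteristic (kronecker I γ) := by
  refine ⟨kronecker_isPDI hI.1 hγ.1 hγ0, ?_⟩
  rintro P ⟨hPr, hP⟩ Q ⟨⟨hQr, hQ⟩, hPQ⟩ hE
  have := hPr.inner
  have := hQr.inner
  have key : (P : Measure (CartProd X)) = Q :=
    eq_of_energy_kronecker_eq_zero hn hIc hI0 hγc hγ0 hI hγ hP hQ
      ((diff_mem_radonM_iff hPr.inner hQr.inner).1 hPQ) hE
  exact Subtype.ext key

end Converse

/-! ### The first factor of a characteristic product -/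

section Twist

variable {n : ℕ} {X : Fin (n + 1) → Type u} [∀ i, TopologicalSpace (X i)]
  {I : CartProd (fun i : Fin n => X i.castSucc) →
      CartProd (fun i : Fin n => X i.castSucc) → ℝ} {γ : X (Fin.last n) → X (Fin.last n) → ℝ}

lemma continuous_snocPt_left (a : X (Fin.last n)) :
    Continuous fun x : CartProd (fun i : Fin n => X i.castSucc) => (snocPt x a : CartProd X) :=
  continuous_snocPt.comp (Continuous.prodMk_left a)

lemma continuous_snocPt_right (x : CartProd fun i : Fin n => X i.castSucc) :
    Continuous fun a : X (Fin.last n) => (snocPt x a : CartProd X) :=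
  continuous_snocPt.comp (Continuous.prodMk_right x)

omit [∀ i, TopologicalSpace (X i)] in
lemma enorm_kronecker_mix (F : Finset (Fin (n + 1))) (y z w : CartProd X) :
    ‖kronecker I γ (mix F y z) w‖ₑ =
      ‖γ (if Fin.last n ∈ F then y (Fin.last n) else z (Fin.last n)) (w (Fin.last n))‖ₑ *
        ‖I (mix (initFin F) (initPt y) (initPt z)) (initPt w)‖ₑ := by
  rw [kronecker_apply, enorm_mul, mul_comm, initPt_mix, mix_apply]

/-- If the last coordinate takes finitely many values, then the factor `γ` is bounded. The first
`n` indices carry at most `n` labels, hence one of the `n + 1` independent points can be dropped. -/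
lemma MarginalsIntegrable.of_map_initPt [∀ i, T2Space (X i)] (hIc : Continuous (uncurry I))
    {M : Measure (CartProd X)}
    [IsProbabilityMeasure M] [M.InnerRegular] (hM : MarginalsIntegrable I (M.map initPt))
    (S : Finset (X (Fin.last n))) (hS : ∀ᵐ x ∂M, x ∈ {x : CartProd X | x (Fin.last n) ∈ S}) :
    MarginalsIntegrable (kronecker I γ) M := by
  classical
  intro c F z w
  set C : ℝ≥0∞ := ∑ a ∈ insert (z (Fin.last n)) S, ‖γ a (w (Fin.last n))‖ₑ with hC
  have hCt : C ≠ ∞ := by simp [hC, ENNReal.sum_eq_top]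
  obtain ⟨j, hj⟩ : ∃ j, ∀ i : Fin n, c i.castSucc ≠ j := by
    by_contra! h
    have := Fintype.card_le_of_surjective (fun i : Fin n => c i.castSucc) h
    simp at this
  choose c' hc' using fun i => Fin.exists_succAbove_eq (hj i)
  have hev : Continuous fun ω : Fin n → CartProd (fun i : Fin n => X i.castSucc) =>
      (fun i => ω (c' i) i : CartProd (fun i : Fin n => X i.castSucc)) :=
    continuous_pi fun i => (CartProd.continuous_apply i).comp (continuous_apply (c' i))
  have hs : SumCont fun ω : Fin n → CartProd (fun i : Fin n => X i.castSucc) =>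
      ‖I (mix (initFin F) (fun i => ω (c' i) i) (initPt z)) (initPt w)‖ₑ :=
    sumCont_kernel_mix hIc ((continuous_mix _).comp (hev.prodMk continuous_const))
      continuous_const
  have h := hM c' (initFin F) (initPt z) (initPt w)
  rw [lintegralPartition, iterLIntegral_map M continuous_initPt hs,
    ← iterLIntegral_succAbove M j] at h
  refine (iterLIntegral_mono_ae M hS fun t ht => ?_).trans_lt
    ((iterLIntegral_const_mul M hCt _).trans_lt (ENNReal.mul_lt_top hCt.lt_top h))
  refine (enorm_kronecker_mix F (fun i => t (c i) i) z w).trans_le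
    (mul_le_mul' ?_ (le_of_eq ?_))
  · refine single_le_sum (f := fun a => ‖γ a (w (Fin.last n))‖ₑ) (fun _ _ => zero_le) ?_
    split_ifs
    · exact mem_insert_of_mem (ht _)
    · exact mem_insert_self _ _
  · congr 4
    funext i
    change t (c i.castSucc) i.castSucc = t (j.succAbove (c' i)) i.castSucc
    rw [hc']

/-- The measure `(P ⊗ δ_a + Q ⊗ δ_b) / 2`. The difference `twist P Q a b - twist Q P a b` is
`(P - Q) ⊗ (δ_a - δ_b) / 2`. -/
noncomputable def twist (P Q : Measure (CartProd fun i : Fin n => X i.castSucc))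
    (a b : X (Fin.last n)) : Measure (CartProd X) :=
  avg (P.map fun x => snocPt x a) (Q.map fun x => snocPt x b)

variable (P Q : Measure (CartProd fun i : Fin n => X i.castSucc)) (a b : X (Fin.last n))

instance [IsProbabilityMeasure P] [IsProbabilityMeasure Q] :
    IsProbabilityMeasure (twist P Q a b) := by
  have := Measure.isProbabilityMeasure_map (μ := P) (continuous_snocPt_left a).aemeasurable
  have := Measure.isProbabilityMeasure_map (μ := Q) (continuous_snocPt_left b).aemeasurable
  rw [twist]
  infer_instance

instance [∀ i, T2Space (X i)] [IsFiniteMeasure P] [IsFiniteMeasure Q] [P.InnerRegular]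
    [Q.InnerRegular] : (twist P Q a b).InnerRegular := by
  have := Measure.InnerRegular.map_of_continuous (μ := P) (continuous_snocPt_left a)
  have := Measure.InnerRegular.map_of_continuous (μ := Q) (continuous_snocPt_left b)
  rw [twist]
  infer_instance

lemma twist_map_initPt : (twist P Q a b).map initPt = avg P Q := by
  have e : ∀ (ν : Measure (CartProd fun i : Fin n => X i.castSucc)) (a : X (Fin.last n)),
      (ν.map fun x => (snocPt x a : CartProd X)).map initPt = ν := by
    intro ν a
    rw [Measure.map_map continuous_initPt.measurable (continuous_snocPt_left a).measurable]
    simp only [comp_def, initPt_snocPt]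
    exact Measure.map_id
  rw [twist, avg, Measure.map_smul, Measure.map_add _ _ continuous_initPt.measurable, e, e, avg]

lemma twist_apply {A : Set (CartProd X)} (hA : MeasurableSet A) :
    twist P Q a b A =
      2⁻¹ * (P ((fun x => snocPt x a) ⁻¹' A) + Q ((fun x => snocPt x b) ⁻¹' A)) := by
  rw [twist, avg, Measure.smul_apply, Measure.add_apply,
    Measure.map_apply (continuous_snocPt_left a).measurable hA,
    Measure.map_apply (continuous_snocPt_left b).measurable hA, smul_eq_mul]

variable [∀ i, MeasurableSpace (X i)] [∀ i, BorelSpace (X i)]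

lemma twist_last_mem [DecidableEq (X (Fin.last n))] [∀ i, T2Space (X i)] :
    ∀ᵐ x ∂(twist P Q a b), x ∈ {x : CartProd X | x (Fin.last n) ∈ ({a, b} : Finset _)} := by
  have hm : MeasurableSet {x : CartProd X | x (Fin.last n) ∈ ({a, b} : Finset _)} :=
    measurableSet_last_preimage (B := (({a, b} : Finset _) : Set (X (Fin.last n))))
      (Finset.measurableSet _)
  rw [ae_iff]
  change twist P Q a b ({x : CartProd X | x (Fin.last n) ∈ ({a, b} : Finset _)}ᶜ) = 0
  rw [twist_apply P Q a b hm.compl]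
  simp

variable {P Q}

lemma SameMarginals.twist (h : SameMarginals P Q) :
    SameMarginals (twist P Q a b) (twist Q P a b) := by
  intro A hA i hi
  have hm := measurableSet_box hA
  rw [twist_apply _ _ _ _ hm, twist_apply _ _ _ _ hm]
  congr 1
  have e : ∀ a : X (Fin.last n), (fun x => (snocPt x a : CartProd X)) ⁻¹' box A =
      {x | a ∈ A (Fin.last n) ∧ x ∈ box fun i : Fin n => A i.castSucc} := by
    intro a
    ext x
    simp [box, Fin.forall_fin_succ', and_comm]
  simp only [e]
  induction i using Fin.lastCases with
  | last => simp [hi, add_comm]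
  | cast i =>
    have h1 : ∀ a : X (Fin.last n),
        P {x | a ∈ A (Fin.last n) ∧ x ∈ box fun i : Fin n => A i.castSucc} =
        Q {x | a ∈ A (Fin.last n) ∧ x ∈ box fun i : Fin n => A i.castSucc} := by
      intro a
      by_cases ha : a ∈ A (Fin.last n)
      · simpa [ha] using h _ (fun i => hA i.castSucc) i hi
      · simp [ha]
    rw [h1, h1]

omit [∀ i, BorelSpace (X i)] [∀ i, MeasurableSpace (X i)] in
lemma integral_twist [IsFiniteMeasure P] [IsFiniteMeasure Q] {g : CartProd X → ℝ}
    (hg : Measurable g) (hP : Integrable (fun x => g (snocPt x a)) P)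
    (hQ : Integrable (fun x => g (snocPt x b)) Q) :
    ∫ x, g x ∂(PDI.twist P Q a b) =
      2⁻¹ * (∫ x, g (snocPt x a) ∂P + ∫ x, g (snocPt x b) ∂Q) := by
  have ha := (continuous_snocPt_left (X := X) a).aemeasurable (μ := P)
  have hb := (continuous_snocPt_left (X := X) b).aemeasurable (μ := Q)
  rw [PDI.twist, avg, integral_smul_measure, integral_add_measure,
    integral_map ha hg.aestronglyMeasurable, integral_map hb hg.aestronglyMeasurable]
  · simp
  · exact (integrable_map_measure hg.aestronglyMeasurable ha).2 hP
  · exact (integrable_map_measure hg.aestronglyMeasurable hb).2 hQ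

variable {a b}

lemma eq_of_twist_eq [∀ i, T2Space (X i)] (hab : a ≠ b) (h : twist P Q a b = twist Q P a b) :
    P = Q := by
  refine Measure.ext fun A hA => ?_
  have hm : MeasurableSet {x : CartProd X | initPt x ∈ A ∧ x (Fin.last n) = a} :=
    (continuous_initPt.measurable hA).inter
      (measurableSet_last_preimage (B := {a}) (measurableSet_singleton a))
  have := congrArg (fun ν : Measure _ => ν {x : CartProd X | initPt x ∈ A ∧ x (Fin.last n) = a}) h
  rw [twist_apply _ _ _ _ hm, twist_apply _ _ _ _ hm] at this
  simpa [hab.symm, ENNReal.mul_right_inj] using this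

omit [∀ i, BorelSpace (X i)] [∀ i, MeasurableSpace (X i)] in
lemma potential_kronecker_twist [∀ i, T2Space (X i)] [IsFiniteMeasure P] [IsFiniteMeasure Q]
    (hIc : Continuous (uncurry I)) (hγc : Continuous (uncurry γ))
    (hi : ∀ y, Integrable (fun x => I x y) (P + Q)) (y : CartProd X) :
    potential (kronecker I γ) (twist P Q a b) (twist Q P a b) y =
      2⁻¹ * potential I P Q (initPt y) * (γ a (y (Fin.last n)) - γ b (y (Fin.last n))) := by
  have hg : Measurable fun x => kronecker I γ x y :=
    ((kronecker_continuous hIc hγc).comp (Continuous.prodMk_left y)).measurable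
  have hint : ∀ a, Integrable (fun x => kronecker I γ (snocPt x a) y) (P + Q) := by
    intro a
    simp only [kronecker_apply, initPt_snocPt, snocPt_last]
    exact (hi _).mul_const _
  rw [potential, integral_twist _ _ hg (hint a).left_of_add_measure (hint b).right_of_add_measure,
    integral_twist _ _ hg (hint a).right_of_add_measure (hint b).left_of_add_measure]
  simp only [kronecker_apply, initPt_snocPt, snocPt_last, integral_mul_const, potential]
  ring

/-- If the product is characteristic, then so is its first factor. -/
theorem isPDICharacteristic_left (hn : 0 < n) [∀ i, T2Space (X i)] [∀ i, Nontrivial (X i)]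
    (hIc : Continuous (uncurry I)) (hI : IsPDI I) (hI0 : ZeroOnExtendedDiagonal I)
    (hγc : Continuous (uncurry γ)) (hγ0 : ∀ a, γ a a = 0)
    (hJ : IsPDICharacteristic (kronecker I γ)) : IsPDICharacteristic I := by
  classical
  refine ⟨hI, ?_⟩
  rintro P ⟨hPr, hP⟩ Q ⟨⟨hQr, hQ⟩, hPQ⟩ hE
  have := hPr.inner
  have := hQr.inner
  replace hPQ := (diff_mem_radonM_iff hPr.inner hQr.inner).1 hPQ
  have hM := MarginalsIntegrable.avg hIc hPQ hP hQ
  have hctrl := hM.controlled hn hIc hI hI0 (by simp) (le_avg_left _ _) (le_avg_right _ _)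
  obtain ⟨a, b, hab⟩ := exists_pair_ne (X (Fin.last n))
  have z : CartProd fun i : Fin n => X i.castSucc := fun i => Classical.arbitrary _
  have hpot := (hctrl.energy_eq_zero_iff hPQ hIc hI hI0 z).1 hE
  have hJc := kronecker_continuous hIc hγc
  have hJ0 := kronecker_zeroOnExtendedDiagonal hI0 hγ0
  have hint : ∀ y, Integrable (fun x => I x y)
      ((P : Measure (CartProd fun i : Fin n => X i.castSucc)) + Q) := fun y => by
    simpa using! hctrl.integrable univ y y
  set P' := twist (P : Measure (CartProd fun i : Fin n => X i.castSucc)) Q a b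
  set Q' := twist (Q : Measure (CartProd fun i : Fin n => X i.castSucc)) P a b
  have hP' : MarginalsIntegrable (kronecker I γ) P' := by
    refine MarginalsIntegrable.of_map_initPt hIc ?_ {a, b} (twist_last_mem _ _ a b)
    rwa [twist_map_initPt]
  have hQ' : MarginalsIntegrable (kronecker I γ) Q' := by
    refine MarginalsIntegrable.of_map_initPt hIc ?_ {a, b} (twist_last_mem _ _ a b)
    rw [twist_map_initPt, avg, add_comm]
    exact hM
  have hPQ' : SameMarginals P' Q' := hPQ.twist a b
  have hctrl' := (MarginalsIntegrable.avg hJc hPQ' hP' hQ').controlled n.succ_pos hJc hJ.1 hJ0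
    (by simp) (le_avg_left _ _) (le_avg_right _ _)
  have key := hJ.2 ⟨P', inferInstance⟩ ⟨isRadon_of_innerRegular P', hP'⟩ ⟨Q', inferInstance⟩
    ⟨⟨isRadon_of_innerRegular Q', hQ'⟩, ?_⟩ ?_
  · have key2 : P' = Q' := congrArg Subtype.val key
    exact Subtype.ext (eq_of_twist_eq hab key2)
  · exact (diff_mem_radonM_iff (P := ⟨P', inferInstance⟩) (Q := ⟨Q', inferInstance⟩)
      (inferInstanceAs P'.InnerRegular) (inferInstanceAs Q'.InnerRegular)).2 hPQ'
  · refine (hctrl'.energy_eq_zero_iff hPQ' hJc hJ.1 hJ0 (snocPt z a)).2 fun w => ?_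
    rw [← snocPt_initPt w, sum_finset_succ]
    simp_rw [mix_snocPt_map, mix_snocPt_insert, sgn_insert_last, sgn_map_castSucc, P', Q',
      potential_kronecker_twist hIc hγc hint, initPt_snocPt, snocPt_last]
    have e : ∀ s p u v : ℝ, -s * (2⁻¹ * p * u) + s * (2⁻¹ * p * v) =
      s * p * (2⁻¹ * (v - u)) := by intros; ring
    simp_rw [e, ← sum_mul]
    rw [hpot, zero_mul]

end Twist

/-! ### The second factor of a characteristic product -/

/-- The measure `p` or `q`, according to the sign of `F`. -/
noncomputable def pick {Y : Type u} [MeasurableSpace Y] {n : ℕ} (p q : Measure Y)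
    (F : Finset (Fin n)) : Measure Y :=
  if sgn F = 1 then p else q

lemma pick_le {Y : Type u} [MeasurableSpace Y] {n : ℕ} (p q : Measure Y) (F : Finset (Fin n)) :
    pick p q F ≤ p + q := by
  rw [pick]
  split_ifs
  exacts [Measure.le_add_right le_rfl, Measure.le_add_left le_rfl]

section Fan

variable {n : ℕ} {X : Fin (n + 1) → Type u} [∀ i, TopologicalSpace (X i)]
  [∀ i, MeasurableSpace (X i)] [∀ i, BorelSpace (X i)]
  {I : CartProd (fun i : Fin n => X i.castSucc) →
      CartProd (fun i : Fin n => X i.castSucc) → ℝ} {γ : X (Fin.last n) → X (Fin.last n) → ℝ}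

/-- The measure `c ∑_F δ_{mix F x z} ⊗ p_F`, where `p_F` is `p` or `q` according to the sign
of `F`. The difference `fan c p q x z - fan c q p x z` is
`c ⨂ i, (δ_{x i} - δ_{z i}) ⊗ (p - q)`. -/
noncomputable def fan (c : ℝ≥0∞) (p q : Measure (X (Fin.last n)))
    (x z : CartProd fun i : Fin n => X i.castSucc) : Measure (CartProd X) :=
  c • ∑ F, (pick p q F).map (snocPt (mix F x z))

variable {c : ℝ≥0∞} {p q : Measure (X (Fin.last n))}
  {x z : CartProd fun i : Fin n => X i.castSucc}

lemma fan_apply {A : Set (CartProd X)} (hA : MeasurableSet A) : fan c p q x z A =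
    c * ∑ F, pick p q F (snocPt (mix F x z) ⁻¹' A) := by
  rw [fan, Measure.smul_apply, Measure.finsetSum_apply, smul_eq_mul]
  simp_rw [Measure.map_apply (continuous_snocPt_right _).measurable hA]

lemma isProbabilityMeasure_fan (hpq : p Set.univ = q Set.univ) (h0 : p Set.univ ≠ 0)
    (ht : p Set.univ ≠ ∞) (hc : c = (2 ^ n * p Set.univ)⁻¹) :
    IsProbabilityMeasure (fan c p q x z) := by
  refine ⟨?_⟩
  have e : ∀ F : Finset (Fin n), pick p q F Set.univ = p Set.univ := by
    intro F
    rw [pick]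
    split_ifs
    exacts [rfl, hpq.symm]
  rw [fan_apply MeasurableSet.univ]
  simp only [Set.preimage_univ, e, sum_const, card_univ, Fintype.card_finset, Fintype.card_fin,
    nsmul_eq_mul, hc]
  push_cast
  exact ENNReal.inv_mul_cancel (by simp [h0]) (by finiteness)

lemma innerRegular_fan [∀ i, T2Space (X i)] [IsFiniteMeasure p] [IsFiniteMeasure q]
    [p.InnerRegular] [q.InnerRegular] : (fan c p q x z).InnerRegular := by
  have : (∑ F, (pick p q F).map (snocPt (X := X) (mix F x z))).InnerRegular := by
    refine sum_induction _ (fun μ : Measure (CartProd X) => μ.InnerRegular)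
      (fun _ _ _ _ => inferInstance) inferInstance fun F _ => ?_
    have : IsFiniteMeasure (pick p q F) := by rw [pick]; split_ifs <;> infer_instance
    have : (pick p q F).InnerRegular := by rw [pick]; split_ifs <;> infer_instance
    exact Measure.InnerRegular.map_of_continuous (continuous_snocPt_right _)
  exact Measure.InnerRegular.smul _

lemma integral_fan {g : CartProd X → ℝ} (hg : Measurable g)
    (hi : ∀ F, Integrable (fun a => g (snocPt (mix F x z) a)) (p + q)) :
    ∫ y, g y ∂(fan c p q x z) =
      c.toReal * ∑ F, ∫ a, g (snocPt (mix F x z) a) ∂(pick p q F) := by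
  have hm := fun F : Finset (Fin n) =>
    (continuous_snocPt_right (X := X) (mix F x z)).aemeasurable (μ := pick p q F)
  rw [fan, integral_smul_measure, smul_eq_mul, integral_finsetSum_measure]
  · simp_rw [integral_map (hm _) hg.aestronglyMeasurable]
  · intro F _
    exact (integrable_map_measure hg.aestronglyMeasurable (hm F)).2
      ((hi F).mono_measure (pick_le p q F))

lemma integral_fan_sub {g : CartProd X → ℝ} (hg : Measurable g)
    (hi : ∀ F, Integrable (fun a => g (snocPt (mix F x z) a)) (p + q)) :
    ∫ y, g y ∂(fan c p q x z) - ∫ y, g y ∂(fan c q p x z) =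
      c.toReal * ∑ F, sgn F * (∫ a, g (snocPt (mix F x z) a) ∂p -
        ∫ a, g (snocPt (mix F x z) a) ∂q) := by
  rw [integral_fan hg hi, integral_fan hg (add_comm p q ▸ hi), ← mul_sub, ← sum_sub_distrib]
  congr 1
  refine sum_congr rfl fun F _ => ?_
  rcases mul_self_eq_one_iff.1 (sgn_mul_self F) with h | h
  · simp [pick, h]
  · simp [pick, h]
    norm_num

/-- Evaluation of the difference of two fans at the set of points with initial part in `A` and
last coordinate in `B`. -/
lemma fan_apply_sub [IsFiniteMeasure p] [IsFiniteMeasure q]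
    [IsFiniteMeasure (fan c p q x z)] [IsFiniteMeasure (fan c q p x z)]
    {A : Set (CartProd fun i : Fin n => X i.castSucc)} (hA : MeasurableSet A)
    {B : Set (X (Fin.last n))} (hB : MeasurableSet B) :
    (fan c p q x z {y | initPt y ∈ A ∧ y (Fin.last n) ∈ B}).toReal -
      (fan c q p x z {y | initPt y ∈ A ∧ y (Fin.last n) ∈ B}).toReal =
      c.toReal * ((∑ F, sgn F * A.indicator (fun _ => 1) (mix F x z)) *
        ((p B).toReal - (q B).toReal)) := by
  have hm : MeasurableSet {y : CartProd X | initPt y ∈ A ∧ y (Fin.last n) ∈ B} :=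
    (continuous_initPt.measurable hA).inter (measurableSet_last_preimage hB)
  have e : ∀ F a, {y : CartProd X | initPt y ∈ A ∧ y (Fin.last n) ∈ B}.indicator
      (fun _ => (1 : ℝ)) (snocPt (mix F x z) a) =
      A.indicator (fun _ => 1) (mix F x z) * B.indicator (fun _ => 1) a := by
    intro F a
    by_cases h1 : mix F x z ∈ A <;> by_cases h2 : a ∈ B <;> simp [h1, h2]
  have h := integral_fan_sub (c := c) (p := p) (q := q) (x := x) (z := z)
    (measurable_const.indicator hm) (g := Set.indicator _ fun _ => (1 : ℝ)) fun F => by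
      simp_rw [e]
      exact ((integrable_const _).indicator hB).const_mul _
  simp_rw [e, integral_const_mul] at h
  simp only [integral_indicator_const _ hm, integral_indicator_const _ hB, smul_eq_mul, mul_one,
    Measure.real] at h
  rw [h, sum_mul]
  simp_rw [← mul_sub, mul_assoc]

lemma sameMarginals_fan [IsFiniteMeasure p] [IsFiniteMeasure q] (hpq : p Set.univ = q Set.univ)
    [IsFiniteMeasure (fan c p q x z)] [IsFiniteMeasure (fan c q p x z)] :
    SameMarginals (fan c p q x z) (fan c q p x z) := by
  intro A hA i hi
  have e : box A = {y : CartProd X | initPt y ∈ box (fun i : Fin n => A i.castSucc) ∧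
      y (Fin.last n) ∈ A (Fin.last n)} := by
    ext y
    simp [box, Fin.forall_fin_succ']
  rw [e, ← ENNReal.toReal_eq_toReal_iff' (measure_ne_top _ _) (measure_ne_top _ _), ← sub_eq_zero,
    fan_apply_sub (measurableSet_box fun i => hA _) (hA _)]
  induction i using Fin.lastCases with
  | last => rw [hi, hpq, sub_self, mul_zero, mul_zero]
  | cast i =>
    have := (indepOf_indicator_box (X := fun i : Fin n => X i.castSucc)
      (A := fun i => A i.castSucc) hi (1 : ℝ)).sum_sgn_smul_eq_zero x z
    simp only [smul_eq_mul] at this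
    rw [this, zero_mul, mul_zero]

lemma eq_of_fan_eq [∀ i, T2Space (X i)] [IsFiniteMeasure p] [IsFiniteMeasure q] (hc0 : c ≠ 0)
    (hct : c ≠ ∞)
    [IsFiniteMeasure (fan c p q x z)] [IsFiniteMeasure (fan c q p x z)] (hxz : ∀ i, x i ≠ z i)
    (h : fan c p q x z = fan c q p x z) : p = q := by
  refine Measure.ext fun B hB => ?_
  have key := fan_apply_sub (c := c) (p := p) (q := q) (x := x) (z := z)
    (measurableSet_singleton x) hB
  have e : ∑ F, sgn F * ({x} : Set (CartProd fun i : Fin n => X i.castSucc)).indicator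
      (fun _ => (1 : ℝ)) (mix F x z) = 1 := by
    rw [sum_eq_single univ]
    · simp [sgn_univ]
    · intro F _ hF
      obtain ⟨i, hi⟩ : ∃ i, i ∉ F := by
        by_contra! h'
        exact hF (eq_univ_iff_forall.2 h')
      rw [Set.indicator_of_notMem, mul_zero]
      intro hx
      have := congrFun (Set.mem_singleton_iff.1 hx) i
      rw [mix_apply, if_neg hi] at this
      exact hxz i this.symm
    · simp
  rw [h, sub_self, e, one_mul] at key
  have := (mul_eq_zero.1 key.symm).resolve_left (ENNReal.toReal_ne_zero.2 ⟨hc0, hct⟩)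
  exact (ENNReal.toReal_eq_toReal_iff' (measure_ne_top _ _) (measure_ne_top _ _)).1
    (sub_eq_zero.1 this)

lemma fan_init_mem [∀ i, T2Space (X i)] : ∀ᵐ y ∂(fan c p q x z),
    y ∈ {y : CartProd X | ∀ i : Fin n, y i.castSucc = x i ∨ y i.castSucc = z i} := by
  have hm : MeasurableSet
      {y : CartProd X | ∀ i : Fin n, y i.castSucc = x i ∨ y i.castSucc = z i} := by
    have : {y : CartProd X | ∀ i : Fin n, y i.castSucc = x i ∨ y i.castSucc = z i} =
        ⋂ i : Fin n, (fun y : CartProd X => y i.castSucc) ⁻¹' {x i, z i} := by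
      ext; simp
    rw [this]
    exact MeasurableSet.iInter fun i => measurable_apply _ (Set.toFinite _).measurableSet
  rw [ae_iff]
  change fan c p q x z (_ᶜ) = 0
  rw [fan_apply hm.compl]
  simp only [mul_eq_zero]
  right
  refine sum_eq_zero fun F _ => ?_
  refine (congrArg (pick p q F) (Set.eq_empty_of_forall_notMem fun a => ?_)).trans measure_empty
  simp only [Set.mem_preimage, Set.mem_compl_iff, Set.mem_ofPred_eq, snocPt_castSucc, mix_apply,
    not_not]
  intro i
  split_ifs <;> simp

/-- If the first `n` coordinates take finitely many values, then the factor `I` is bounded. -/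
lemma marginalsIntegrable_fan [∀ i, T2Space (X i)] (hγc : Continuous (uncurry γ))
    [IsProbabilityMeasure (fan c p q x z)] (hct : c ≠ ∞)
    (hi : ∀ b, Integrable (fun a => γ a b) (p + q)) :
    MarginalsIntegrable (kronecker I γ) (fan c p q x z) := by
  intro l F z' w
  set b := w (Fin.last n) with hb
  set C : ℝ≥0∞ := ∑ A, ∑ B, ‖I (mix A x (mix B z (initPt z'))) (initPt w)‖ₑ with hC
  have hCt : C ≠ ∞ := by simp [hC, ENNReal.sum_eq_top]
  have hγm : Measurable fun y : CartProd X => ‖γ (y (Fin.last n)) b‖ₑ :=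
    (hγc.comp (((CartProd.continuous_apply (Fin.last n))).prodMk
      continuous_const)).measurable.enorm
  have hfin : ∫⁻ y, ‖γ (y (Fin.last n)) b‖ₑ ∂(fan c p q x z) < ∞ := by
    rw [fan, lintegral_smul_measure, lintegral_finsetSum_measure, smul_eq_mul]
    refine ENNReal.mul_lt_top hct.lt_top (ENNReal.sum_lt_top.2 fun G _ => ?_)
    rw [lintegral_map hγm (continuous_snocPt_right _).measurable]
    simp only [snocPt_last]
    exact (lintegral_mono' (pick_le p q G) le_rfl).trans_lt (hi b).2
  set g : CartProd X → ℝ≥0∞ := fun y => ‖γ (y (Fin.last n)) b‖ₑ + ‖γ (z' (Fin.last n)) b‖ₑ with hg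
  have h : iterLIntegral (fan c p q x z) (n + 1) (fun t => C * g (t (l (Fin.last n)))) < ∞ := by
    rw [iterLIntegral_const_mul _ hCt, iterLIntegral_apply _ (l (Fin.last n)) g, hg,
      lintegral_add_right _ measurable_const]
    refine ENNReal.mul_lt_top hCt.lt_top (ENNReal.add_lt_top.2 ⟨hfin, ?_⟩)
    simp
  refine (iterLIntegral_mono_ae _ fan_init_mem fun t ht => ?_).trans_lt h
  refine (enorm_kronecker_mix F (fun i => t (l i) i) z' w).trans_le ?_
  rw [mul_comm]
  refine mul_le_mul' ?_ ?_
  · classical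
    set A : Finset (Fin n) := univ.filter fun i => i ∈ initFin F ∧
      t (l i.castSucc) i.castSucc = x i with hA
    have e : mix (initFin F) (initPt fun i => t (l i) i) (initPt z') =
        mix A x (mix (initFin F) z (initPt z')) := by
      funext i
      change (if i ∈ initFin F then t (l i.castSucc) i.castSucc else initPt z' i) = _
      by_cases h1 : i ∈ initFin F
      · by_cases h2 : t (l i.castSucc) i.castSucc = x i
        · simp [hA, h1, h2]
        · simp [hA, h1, (ht (l i.castSucc) i).resolve_left h2]
      · simp [hA, h1]
    rw [e]
    refine le_trans ?_ (single_le_sum (f := fun A => ∑ B, ‖I (mix A x (mix B z (initPt z')))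
      (initPt w)‖ₑ) (fun _ _ => zero_le) (mem_univ A))
    exact single_le_sum (f := fun B => ‖I (mix A x (mix B z (initPt z'))) (initPt w)‖ₑ)
      (fun _ _ => zero_le) (mem_univ (initFin F))
  · split_ifs
    · exact le_self_add
    · exact le_add_self

end Fan

section Fan

variable {n : ℕ} {X : Fin (n + 1) → Type u} [∀ i, TopologicalSpace (X i)]
  [∀ i, T2Space (X i)] [∀ i, MeasurableSpace (X i)] [∀ i, BorelSpace (X i)]
  {I : CartProd (fun i : Fin n => X i.castSucc) →
      CartProd (fun i : Fin n => X i.castSucc) → ℝ} {γ : X (Fin.last n) → X (Fin.last n) → ℝ}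

variable {c : ℝ≥0∞} {p q : Measure (X (Fin.last n))}
  {x z : CartProd fun i : Fin n => X i.castSucc}

omit [∀ i, T2Space (X i)] in
lemma potential_kronecker_fan (hIc : Continuous (uncurry I)) (hγc : Continuous (uncurry γ))
    (hi : ∀ b, Integrable (fun a => γ a b) (p + q)) (y : CartProd X) :
    potential (kronecker I γ) (fan c p q x z) (fan c q p x z) y =
      c.toReal * (∑ F, sgn F * I (mix F x z) (initPt y)) * potential γ p q (y (Fin.last n)) := by
  have hg : Measurable fun x => kronecker I γ x y :=
    ((kronecker_continuous hIc hγc).comp (Continuous.prodMk_left y)).measurable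
  rw [potential, integral_fan_sub hg fun F => ?_]
  · simp only [kronecker_apply, initPt_snocPt, snocPt_last, integral_const_mul, potential]
    rw [mul_assoc, sum_mul]
    simp_rw [← mul_sub, mul_assoc]
  · simp only [kronecker_apply, initPt_snocPt, snocPt_last]
    exact (hi _).const_mul _

/-- If the product is characteristic and two finite measures of the same mass on the last factor
have a difference of zero energy, then they are equal. -/
lemma eq_of_integral_potential_eq (hIc : Continuous (uncurry I))
    (hI0 : ZeroOnExtendedDiagonal I) (hγc : Continuous (uncurry γ))
    (hγ0 : ∀ a, γ a a = 0) (hJ : IsPDICharacteristic (kronecker I γ)) [∀ i, Nontrivial (X i)]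
    [IsFiniteMeasure p] [IsFiniteMeasure q] [p.InnerRegular] [q.InnerRegular]
    (hpq : p Set.univ = q Set.univ) (hi : ∀ b, Integrable (fun a => γ a b) (p + q))
    (hpot : Integrable (potential γ p q) (p + q))
    (hE : ∫ b, potential γ p q b ∂p = ∫ b, potential γ p q b ∂q) : p = q := by
  by_cases hp0 : p Set.univ = 0
  · rw [Measure.measure_univ_eq_zero.1 hp0, Measure.measure_univ_eq_zero.1 (hpq.symm.trans hp0)]
  obtain ⟨x, z, hxz⟩ : ∃ x z : CartProd (fun i : Fin n => X i.castSucc), ∀ i, x i ≠ z i := by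
    choose x z hxz using fun i : Fin n => exists_pair_ne (X i.castSucc)
    exact ⟨x, z, hxz⟩
  set c : ℝ≥0∞ := (2 ^ n * p Set.univ)⁻¹ with hc
  have hc0 : c ≠ 0 := ENNReal.inv_ne_zero.2 (by finiteness)
  have hct : c ≠ ∞ := ENNReal.inv_ne_top.2 (by simp [hp0])
  set P' := fan c p q x z with hP'def
  set Q' := fan c q p x z with hQ'def
  have hP'p : IsProbabilityMeasure P' := isProbabilityMeasure_fan hpq hp0 (by finiteness) hc
  have hQ'p : IsProbabilityMeasure Q' :=
    isProbabilityMeasure_fan hpq.symm (hpq ▸ hp0) (by finiteness) (hpq ▸ hc)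
  have hP'r : P'.InnerRegular := innerRegular_fan
  have hQ'r : Q'.InnerRegular := innerRegular_fan
  have hP' : MarginalsIntegrable (kronecker I γ) P' := marginalsIntegrable_fan hγc hct hi
  have hQ' : MarginalsIntegrable (kronecker I γ) Q' :=
    marginalsIntegrable_fan hγc hct (add_comm p q ▸ hi)
  have hPQ' : SameMarginals P' Q' := sameMarginals_fan hpq
  have hJc := kronecker_continuous hIc hγc
  have hJ0 := kronecker_zeroOnExtendedDiagonal hI0 hγ0
  have hctrl := (MarginalsIntegrable.avg hJc hPQ' hP' hQ').controlled n.succ_pos hJc hJ.1 hJ0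
    (by simp) (le_avg_left _ _) (le_avg_right _ _)
  have key := hJ.2 ⟨P', hP'p⟩ ⟨isRadon_of_innerRegular P', hP'⟩ ⟨Q', hQ'p⟩
    ⟨⟨isRadon_of_innerRegular Q', hQ'⟩, ?_⟩ ?_
  · have key2 : P' = Q' := congrArg Subtype.val key
    exact eq_of_fan_eq hc0 hct hxz key2
  · exact (diff_mem_radonM_iff (P := ⟨P', hP'p⟩) (Q := ⟨Q', hQ'p⟩) hP'r hQ'r).2 hPQ'
  · refine hctrl.energy_eq.trans ?_
    have e := fun F : Finset (Fin n) => fun a : X (Fin.last n) =>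
      potential_kronecker_fan (c := c) (x := x) (z := z) hIc hγc hi (snocPt (mix F x z) a)
    simp only [initPt_snocPt, snocPt_last] at e
    rw [hP'def, hQ'def] at hctrl ⊢
    rw [integral_fan_sub hctrl.measurable fun F => ?_]
    · simp_rw [e, integral_const_mul, hE, sub_self, mul_zero, sum_const_zero, mul_zero]
    · simp_rw [e]
      exact hpot.const_mul _

/-- If the product is characteristic, then so is its second factor. -/
theorem isCNDCharacteristic_right (hIc : Continuous (uncurry I))
    (hI0 : ZeroOnExtendedDiagonal I) (hγc : Continuous (uncurry γ)) (hγ : IsCND γ)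
    (hγ0 : ∀ a, γ a a = 0) (hJ : IsPDICharacteristic (kronecker I γ)) [∀ i, Nontrivial (X i)] :
    IsCNDCharacteristic γ := by
  refine ⟨hγ, fun ν hν hint huniv hE => ?_⟩
  have hnn := hγ.nonneg hγ0
  set p := ν.toJordanDecomposition.posPart
  set q := ν.toJordanDecomposition.negPart
  have hνpq : p.toSignedMeasure - q.toSignedMeasure = ν := ν.toSignedMeasure_toJordanDecomposition
  have hvar : ν.variation = p + q := (SignedMeasure.totalVariation_eq_variation ν).symm
  have hVr : (p + q).InnerRegular := hvar ▸ hν.inner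
  have hpr : p.InnerRegular := innerRegular_of_absolutelyContinuous
    (Measure.absolutelyContinuous_of_le (Measure.le_add_right le_rfl : p ≤ p + q))
  have hqr : q.InnerRegular := innerRegular_of_absolutelyContinuous
    (Measure.absolutelyContinuous_of_le (Measure.le_add_left le_rfl : q ≤ p + q))
  rw [hvar] at hint
  rw [← hνpq] at huniv hE ⊢
  refine toSignedMeasure_sub_eq_zero.2 ?_
  rw [toSignedMeasure_sub_apply_eq_zero MeasurableSet.univ] at huniv
  have hm : ∀ b, Continuous fun a => γ a b := fun b => hγc.comp (Continuous.prodMk_left b)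
  have hsum : SumCont fun r : X (Fin.last n) × X (Fin.last n) => ‖γ r.2 r.1‖ₑ :=
    sumCont_enorm (hγc.comp (continuous_snd.prodMk continuous_fst))
  have hi : ∀ b, Integrable (fun a => γ a b) (p + q) := by
    intro b
    by_cases h0 : p + q = 0
    · rw [h0]
      exact integrable_zero_measure
    have : NeZero (p + q) := ⟨h0⟩
    obtain ⟨o, ho⟩ := (ae_lt_top (hsum.lintegral (p + q)).measurable hint.ne).exists
    have h1 : Integrable (fun a => γ a o) (p + q) := ⟨(hm o).aestronglyMeasurable, ho⟩
    refine ((h1.const_mul 2).add (integrable_const (2 * γ o b))).mono'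
      (hm b).aestronglyMeasurable (Filter.Eventually.of_forall fun a => ?_)
    rw [Real.norm_of_nonneg (hnn _ _)]
    exact hγ.triangle hγ0 a b o
  have hpot1 : ∀ (r : Measure (X (Fin.last n))) [IsFiniteMeasure r] [r.InnerRegular],
      r ≤ p + q → Integrable (fun b => ∫ a, γ a b ∂r) (p + q) := by
    intro r _ _ hr
    refine ⟨(measurable_integral_kernel hγc hnn r).aestronglyMeasurable, ?_⟩
    refine lt_of_le_of_lt (lintegral_mono fun b => ?_) hint
    exact (enorm_integral_le_lintegral_enorm _).trans (lintegral_mono' hr le_rfl)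
  have hpot : Integrable (potential γ p q) (p + q) :=
    (hpot1 p (Measure.le_add_right le_rfl)).sub (hpot1 q (Measure.le_add_left le_rfl))
  refine eq_of_integral_potential_eq hIc hI0 hγc hγ0 hJ huniv hi hpot ?_
  have h1 := energy_sub (-1) hi hpot
  simp only [neg_one_mul] at h1
  linarith [h1.symm.trans hE]

end Fan

end PDI

theorem theorem3p17 {n : ℕ} (hn : 1 ≤ n) (X : Fin (n + 1) → Type*)
    [∀ i, TopologicalSpace (X i)] [∀ i, T2Space (X i)] [∀ i, Nontrivial (X i)]
    [∀ i, MeasurableSpace (X i)] [∀ i, BorelSpace (X i)]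
    (I : PDI.CartProd (fun i : Fin n => X i.castSucc) →
      PDI.CartProd (fun i : Fin n => X i.castSucc) → ℝ)
    (hI_cont : Continuous (Function.uncurry I)) (hI_pdi : PDI.IsPDI I)
    (hI_zero : PDI.ZeroOnExtendedDiagonal I)
    (γ : X (Fin.last n) → X (Fin.last n) → ℝ)
    (hγ_cont : Continuous (Function.uncurry γ)) (hγ_cnd : PDI.IsCND γ)
    (hγ_zero : ∀ a, γ a a = 0) :
    PDI.IsPDICharacteristic (PDI.kronecker I γ) ↔
      PDI.IsPDICharacteristic I ∧ PDI.IsCNDCharacteristic γ :=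
  ⟨fun h => ⟨PDI.isPDICharacteristic_left hn hI_cont hI_pdi hI_zero hγ_cont hγ_zero h,
      PDI.isCNDCharacteristic_right hI_cont hI_zero hγ_cont hγ_cnd hγ_zero h⟩,
    fun h => PDI.kronecker_isPDICharacteristic hn hI_cont hI_zero hγ_cont hγ_zero h.1 h.2⟩
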